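/- Let $1<p<\infty$, let $p'=p/(p-1)$ and $p^*=\max(p,p')$, and let $B=B_{\mathbb R^d}(0,1)$ be the open unit ball of $\mathbb R^d$. $M_d(\mathbb R)$ carries the Frobenius norm. For a vector field $u$ on $B$ with weak gradient $\nabla u=(\partial_j u_i)_{ij}$ put $$\mathcal E(u)=\tfrac12(\nabla u+\nabla u^t),\quad \mathcal A(u)=\tfrac12(\nabla u-\nabla u^t),\quad \mathcal E_0(u)=\mathcal E(u)-\tfrac1d\mathrm{Tr}(\nabla u)\,\mathrm{Id},\quad \mathcal A_0(u)=\mathcal A(u)+\tfrac1d\mathrm{Tr}(\nabla u)\,\mathrm{Id}.$$ Let $u_p(t)=(p-1)(1+t^2)^{\frac{2-p}2}-p+(1+t)^{2-p}-t(2-p)$ and $g(x)=\frac{1+x}{1-x}$. Let $p_0\approx1.638$ be the root of $q\mapsto u_q(g(-1+2/q))$ in $(1,2)$ and, for $p\in(p_0,2)$, let $s_0=s_0(p)$ be the root of $u_p\circ g$ in $(-1+2/p,1)$ (each of these roots is unique; formally, take the infimum of the set of roots in the interval). Define $$c(p)=\begin{cases}\sqrt{1+(p^*-1)^2}&\text{if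 }p\ge2\text{ or }p\le p_0,\\[2pt]\left(1-\dfrac{2^{1-p}(1-s_0)^{p-1}}{(p-1)(1-s_0)+(2-p)}\right)^{-1/p}&\text{if }p\in(p_0,2).\end{cases}$$ Call $u\in W^{1,p}_0(B,\mathbb R^d)$ generalised-radial if $u(x)=r(|x|)x$ for a.e. $x\in B$, for some function $r\colon\mathbb R^+\to M_d(\mathbb R)$. All $L^p$ norms are taken over $B$. (i) If $d\ge1$, every generalised-radial $u\in W^{1,p}_0(B,\mathbb R^d)$ satisfies $$\|\mathcal A(u)\|_{L^p}\le(p^*-1)\|\mathcal E(u)\|_{L^p},\qquad \|\nabla u\|_{L^p}\le c(p)\|\mathcal E(u)\|_{L^p}.$$ (ii) If $d\ge2$, every generalised-radial $u\in W^{1,p}_0(B,\mathbb R^d)$ satisfies $$\|\mathcal A_0(u)\|_{L^p}\le(p^*-1)\|\mathcal E_0(u)\|_{L^p},\qquad \|\nabla u\|_{L^p}\le c(p)\|\mathcal E_0(u)\|_{L^p}.$$ (iii) If $p\ge2$ and $d=2$, all four inequalities are sharp: in each of them the stated constant is the least $K\ge0$ for which the inequality holds for all generalised-radial $u\in W^{1,p}_0(B,\mathbb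 R^2)$. -/

import Mathlib

open MeasureTheory Filter Set
open scoped Topology ContDiff Matrix.Norms.Frobenius

noncomputable section

namespace RadialKorn

/-- Euclidean space of dimension `d`. -/
abbrev E (d : ℕ) : Type := EuclideanSpace ℝ (Fin d)

/-- Real `d × d` matrices; they carry the Frobenius norm. -/
abbrev M (d : ℕ) : Type := Matrix (Fin d) (Fin d) ℝ

/-! ### Parts of a matrix -/

/-- The symmetric part; applied to `∇u` it gives `𝓔(u)`. -/
def symPart {d : ℕ} (A : M d) : M d := (1 / 2 : ℝ) • (A + A.transpose)

/-- The skew part; applied to `∇u` it gives `𝓐(u)`. -/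
def skewPart {d : ℕ} (A : M d) : M d := (1 / 2 : ℝ) • (A - A.transpose)

/-- The trace-free symmetric part; applied to `∇u` it gives `𝓔₀(u)`. -/
def symPart₀ {d : ℕ} (A : M d) : M d := symPart A - (A.trace / (d : ℝ)) • (1 : M d)

/-- The skew part plus the trace part; applied to `∇u` it gives `𝓐₀(u)`. -/
def skewPart₀ {d : ℕ} (A : M d) : M d := skewPart A + (A.trace / (d : ℝ)) • (1 : M d)

/-! ### Sobolev functions -/

/-- The open unit ball of `ℝ^d`. -/
def unitBall (d : ℕ) : Set (E d) := Metric.ball 0 1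

/-- The classical Jacobian matrix, `(∇φ)_{ij} = ∂_j φ_i`. -/
def jacobian {d : ℕ} (φ : E d → E d) (x : E d) : M d :=
  Matrix.of fun i j => fderiv ℝ φ x (EuclideanSpace.single j 1) i

/-- `φ` is smooth with compact support contained in `Ω`. -/
def IsTestFunction {d : ℕ} {F : Type} [NormedAddCommGroup F] [NormedSpace ℝ F]
    (Ω : Set (E d)) (φ : E d → F) : Prop :=
  ContDiff ℝ ∞ φ ∧ HasCompactSupport φ ∧ tsupport φ ⊆ Ω

/-- `G` is the weak gradient of `u` on the open set `Ω`: both are locally integrable on `Ω`, and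
`∫ u_i ∂_j φ = - ∫ G_{ij} φ` for all test functions `φ`. -/
def HasWeakGradient {d : ℕ} (Ω : Set (E d)) (u : E d → E d) (G : E d → M d) : Prop :=
  LocallyIntegrableOn u Ω ∧ (∀ i j : Fin d, LocallyIntegrableOn (fun x => G x i j) Ω) ∧
    ∀ φ : E d → ℝ, IsTestFunction Ω φ → ∀ i j : Fin d,
      ∫ x in Ω, u x i * fderiv ℝ φ x (EuclideanSpace.single j 1) = -∫ x in Ω, G x i j * φ x

/-- The space `W^{1,p}_0(Ω, ℝ^d)`: functions in `L^p` with weak gradient in `L^p` which are limits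
in `W^{1,p}(Ω, ℝ^d)` of smooth functions with compact support in `Ω`. -/
def MemW01p {d : ℕ} (p : ℝ) (Ω : Set (E d)) (u : E d → E d) : Prop :=
  MemLp u (ENNReal.ofReal p) (volume.restrict Ω) ∧
    ∃ G : E d → M d, HasWeakGradient Ω u G ∧
      (∀ i j : Fin d, MemLp (fun x => G x i j) (ENNReal.ofReal p) (volume.restrict Ω)) ∧
      ∃ φ : ℕ → E d → E d, (∀ n, IsTestFunction Ω (φ n)) ∧
        Tendsto (fun n => eLpNorm (fun x => φ n x - u x) (ENNReal.ofReal p) (volume.restrict Ω))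
          atTop (𝓝 0) ∧
        Tendsto (fun n => eLpNorm (fun x => jacobian (φ n) x - G x) (ENNReal.ofReal p)
          (volume.restrict Ω)) atTop (𝓝 0)

/-- `u(x) = r(|x|) x` for almost every `x ∈ Ω`, for some matrix-valued function `r`, on which no
regularity is imposed. -/
def IsGeneralisedRadial {d : ℕ} (Ω : Set (E d)) (u : E d → E d) : Prop :=
  ∃ r : ℝ → M d, ∀ᵐ x ∂(volume.restrict Ω), u x = Matrix.toEuclideanLin (r ‖x‖) x

/-- The inequality `‖T(∇u)‖_{L^p} ≤ K ‖S(∇u)‖_{L^p}` on the unit ball `B` of `ℝ^d` for all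
generalised-radial `u ∈ W^{1,p}_0(B, ℝ^d)`. -/
def RadialBound (d : ℕ) (p : ℝ) (T S : M d → M d) (K : ℝ) : Prop :=
  ∀ (u : E d → E d) (G : E d → M d), MemW01p p (unitBall d) u →
    HasWeakGradient (unitBall d) u G → IsGeneralisedRadial (unitBall d) u →
    eLpNorm (fun x => T (G x)) (ENNReal.ofReal p) (volume.restrict (unitBall d)) ≤
      ENNReal.ofReal K *
        eLpNorm (fun x => S (G x)) (ENNReal.ofReal p) (volume.restrict (unitBall d))

/-! ### The constants -/

/-- `p* = max(p, p')` with `p' = p / (p - 1)` the Hölder conjugate of `p`. -/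
def pStar (p : ℝ) : ℝ := max p (p / (p - 1))

/-- `u_p(t) = (p-1)(1+t²)^{(2-p)/2} - p + (1+t)^{2-p} - t(2-p)`. -/
def auxU (p t : ℝ) : ℝ :=
  (p - 1) * (1 + t ^ 2) ^ ((2 - p) / 2) - p + (1 + t) ^ (2 - p) - t * (2 - p)

/-- `g(x) = (1 + x) / (1 - x)`. -/
def auxG (x : ℝ) : ℝ := (1 + x) / (1 - x)

/-- `p₀ ≈ 1.638`, the root in `(1, 2)` of `p ↦ u_p(g(-1 + 2/p))` (there is only one, and `p = 2` is
a trivial root). -/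
def pZero : ℝ := sInf {p : ℝ | p ∈ Ioo (1 : ℝ) 2 ∧ auxU p (auxG (-1 + 2 / p)) = 0}

/-- For `p ∈ (p₀, 2)`, the root of `u_p ∘ g` in `(-1 + 2/p, 1)` (there is only one, and `-1` is
a trivial root of `u_p ∘ g`). -/
def sZero (p : ℝ) : ℝ := sInf {s : ℝ | s ∈ Ioo (-1 + 2 / p) 1 ∧ auxU p (auxG s) = 0}

open Classical in
/-- The constant `c(p)`. -/
def cKorn (p : ℝ) : ℝ :=
  if 2 ≤ p ∨ p ≤ pZero then √(1 + (pStar p - 1) ^ 2)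
  else (1 - 2 ^ (1 - p) * (1 - sZero p) ^ (p - 1) / ((p - 1) * (1 - sZero p) + (2 - p)))
    ^ (-1 / p)

end RadialKorn

end

open MeasureTheory Filter Set
open scoped Topology ContDiff Matrix.Norms.Frobenius

noncomputable section

namespace RadialKorn

/-! Put `T = p* - 1`, and let `S` and `K` denote the symmetric and skew parts, or their
trace-corrected versions. Everything rests on Burkholder's function `b(X, Y) = (Y - T X)(X +
Y)^{p-1}` evaluated at `X = |S A|`, `Y = |K A|`, which gives a function `U` of a matrix `A`.

Pointwise, up to a nonnegative factor, `b` dominates both `Y^p - T^p X^p` and `(X² + Y²)^{p/2} -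
c(p)^p X^p` (`exists_majorant`, `exists_norm_majorant`). Since `|A|² = |S A|² + |K A|²`, both upper
bounds follow from `∫_B U(∇u) ≤ 0`. The constant `c(p)` comes from fitting the second majorant. For
`p ≥ 2` convexity suffices. For `p < 2` the majorant touches either at `Y = T X` or at a root of
`u_p`, and the sign of `u_p(T)` decides which; the study of `signFun` shows that this sign changes
only at `p₀`.

A rank-one matrix satisfies `|K(a ⊗ b)| ≤ |S(a ⊗ b)|`, and along directions with this property `U`,
smoothed by a parameter `δ`, is concave (`burk_zigzag`). So `U` lies below its tangents in rank-one
directions.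

For generalised-radial fields this is enough. If `A(s)` is the average of `∇u` over the ball of
radius `s`, then `u(x) = A(|x|) x` (`IBP.ae_eq_avgG`), and `∇u(x) - A(|x|)` is a rank-one matrix `b
⊗ x` (`IBP.ae_eq_add_vecMulVec`). Integrating the tangent inequality over the sphere of radius `s`
bounds the integral of `U(∇u)` there by the derivative of `|B_s| U(A(s))`. Integration in `s` gives
`∫_B U(∇u) ≤ |B| U(A(1)) = |B| U(0)` (`IBP.integral_comp_le`), because zero boundary values force
`A(1) = 0`. Finally `U(0) ≤ 0`, and `δ → 0`.

For sharpness in the plane take `u = h(|x|²) J x` with `J` a right-angle rotation. With `t = |x|²`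
the norms of the symmetric and skew parts are `√2 |t h'|` and `√2 |h + t h'|`, and the trace
vanishes. For the borderline power `h = t^{-1/p}` their ratio is exactly `p - 1`; a slow logarithmic
cut-off makes it admissible, with an error that vanishes in the limit. -/

/-! ### Burkholder's function -/

/-- Burkholder's function `(Y - T X)(X + Y)^{p-1}`. -/
def burk (p T X Y : ℝ) : ℝ := (Y - T * X) * (X + Y) ^ (p - 1)

lemma pStar_sub_one_of_two_le {p : ℝ} (hp : 2 ≤ p) : pStar p - 1 = p - 1 := by
  have : p / (p - 1) ≤ p := by
    rw [div_le_iff₀ (by linarith)]; nlinarith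
  rw [pStar, max_eq_left this]

lemma pStar_sub_one_of_lt_two {p : ℝ} (h1 : 1 < p) (hp : p < 2) : pStar p - 1 = 1 / (p - 1) := by
  have h0 : 0 < p - 1 := by linarith
  have : p ≤ p / (p - 1) := by
    rw [le_div_iff₀ h0]; nlinarith
  rw [pStar, max_eq_right this]
  field_simp
  ring

lemma one_le_pStar_sub_one {p : ℝ} (h1 : 1 < p) : 1 ≤ pStar p - 1 := by
  rcases le_or_gt 2 p with h | h
  · rw [pStar_sub_one_of_two_le h]; linarith
  · rw [pStar_sub_one_of_lt_two h1 h, le_div_iff₀ (by linarith)]; linarith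

/-- This is the second derivative of `b` along a line, divided by `(X + Y)^{p-2}`; `h`, `k` are the
first derivatives of `X`, `Y`, and `(a - h²)/X`, `(b - k²)/Y` the second ones. Of the two terms with
a quotient of `X` and `Y`, one vanishes by the value of `T` and the other is nonpositive; what
remains is bounded by a nonnegative multiple of `b - a`. -/
lemma burk_second_deriv_nonpos {p T X Y h k a b : ℝ} (hp : 1 < p) (hT : T = pStar p - 1)
    (hX : 0 < X) (hY : 0 < Y) (hh : h ^ 2 ≤ a) (hk : k ^ 2 ≤ b) (hab : b ≤ a) :
    ((b - k ^ 2) / Y - T * ((a - h ^ 2) / X)) * (X + Y) + 2 * (p - 1) * (k - T * h) * (h + k)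
      + (p - 1) * (Y - T * X) * ((a - h ^ 2) / X + (b - k ^ 2) / Y)
      + (p - 1) * (p - 2) * (h + k) ^ 2 * ((Y - T * X) / (X + Y)) ≤ 0 := by
  have hR : 0 < X + Y := by linarith
  have hT1 : 1 ≤ T := hT ▸ one_le_pStar_sub_one hp
  obtain ⟨P, hP⟩ : ∃ P, P = a - h ^ 2 := ⟨_, rfl⟩
  obtain ⟨Q, hQ⟩ : ∃ Q, Q = b - k ^ 2 := ⟨_, rfl⟩
  obtain ⟨w, hw⟩ : ∃ w, w = (Y - T * X) / (X + Y) := ⟨_, rfl⟩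
  have hw1 : w ≤ 1 := by
    rw [hw, div_le_one hR]; nlinarith
  have hw2 : -T ≤ w := by
    rw [hw, le_div_iff₀ hR]; nlinarith
  have hP0 : 0 ≤ P := by linarith
  have hQ0 : 0 ≤ Q := by linarith
  rw [← hP, ← hQ, ← hw]
  have e : (Q / Y - T * (P / X)) * (X + Y) + 2 * (p - 1) * (k - T * h) * (h + k)
      + (p - 1) * (Y - T * X) * (P / X + Q / Y) + (p - 1) * (p - 2) * (h + k) ^ 2 * w
      = p * Q - p * T * P + Q * X / Y * (1 - (p - 1) * T) + P * Y / X * (p - 1 - T)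
        + ((p - 1) * (2 * (k - T * h) * (h + k)) + (p - 1) * ((p - 2) * w) * (h + k) ^ 2) := by
    field_simp
    ring
  rw [e]
  have hQX : 0 ≤ Q * X / Y := by positivity
  have hPY : 0 ≤ P * Y / X := by positivity
  rcases le_or_gt 2 p with h2 | h2
  · have hTp : T = p - 1 := by rw [hT, pStar_sub_one_of_two_le h2]
    have h3 : Q * X / Y * (1 - (p - 1) * T) ≤ 0 := by
      refine mul_nonpos_of_nonneg_of_nonpos hQX ?_
      rw [hTp]; nlinarith
    have h4 : P * Y / X * (p - 1 - T) = 0 := by rw [hTp]; ring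
    -- For `p ≥ 2` the bound `w ≤ 1` is the useful one: the first-order terms then collapse to `p (p
    -- - 1) (k² - h²)`.
    have h5 : (p - 1) * ((p - 2) * w) * (h + k) ^ 2 ≤ (p - 1) * (p - 2) * (h + k) ^ 2 := by
      have : (p - 2) * w ≤ p - 2 := by nlinarith
      have h0 : 0 ≤ p - 1 := by linarith
      gcongr
    have h6 : 0 ≤ p * (p - 2) := by nlinarith
    have h7 : 0 ≤ p * (p - 1) := by nlinarith
    have h8 : p * (p - 2) * k ^ 2 ≤ p * (p - 2) * b := by gcongr
    have h9 : p * (p - 1) * b ≤ p * (p - 1) * a := by gcongr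
    subst hTp
    rw [hP, hQ] at *
    nlinarith
  · have hTp : T = 1 / (p - 1) := by rw [hT, pStar_sub_one_of_lt_two hp h2]
    have hp1 : (p - 1) * T = 1 := by
      rw [hTp]; field_simp [show p - 1 ≠ 0 by linarith]
    have h3 : Q * X / Y * (1 - (p - 1) * T) = 0 := by rw [hp1]; ring
    have h4 : P * Y / X * (p - 1 - T) ≤ 0 :=
      mul_nonpos_of_nonneg_of_nonpos hPY (by linarith)
    -- Now `p - 2 < 0`, so the lower bound `-T ≤ w` takes over; the first-order terms collapse to `p
    -- (k² - h²)`.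
    have h5 : (p - 1) * ((p - 2) * w) * (h + k) ^ 2 ≤ (p - 1) * ((2 - p) * T) * (h + k) ^ 2 := by
      have : (p - 2) * w ≤ (2 - p) * T := by
        linarith [mul_nonneg (by linarith : 0 ≤ 2 - p) (by linarith : 0 ≤ w + T)]
      have h0 : 0 ≤ p - 1 := by linarith
      gcongr
    have h6 : (p - 1) * (2 * (k - T * h) * (h + k)) + (p - 1) * ((2 - p) * T) * (h + k) ^ 2
        = p * (k ^ 2 - h ^ 2) := by
      linear_combination (-2 * h * (h + k) + (2 - p) * (h + k) ^ 2) * hp1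
    have h7 : p * P ≤ p * T * P := by
      have : 0 ≤ p * P := by positivity
      linarith [mul_nonneg this (by linarith : 0 ≤ T - 1)]
    have h8 : p * b ≤ p * a := by gcongr
    have h9 : p * Q = p * b - p * k ^ 2 := by rw [hQ]; ring
    have h10 : p * P = p * a - p * h ^ 2 := by rw [hP]; ring
    linarith

section Zigzag

variable {H : Type*} [NormedAddCommGroup H] [InnerProductSpace ℝ H]

lemma hasDerivAt_sqrt_add_norm_sq {δ : ℝ} (hδ : 0 < δ) (x h : H) (t : ℝ) :
    HasDerivAt (fun t : ℝ => √(δ + ‖x + t • h‖ ^ 2))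
      (inner ℝ (x + t • h) h / √(δ + ‖x + t • h‖ ^ 2)) t := by
  have h1 : HasDerivAt (fun t : ℝ => x + t • h) h t := by
    simpa using ((hasDerivAt_id t).smul_const h).const_add x
  have h2 := (h1.norm_sq.const_add δ).sqrt (by positivity)
  rwa [mul_div_mul_left _ _ two_ne_zero] at h2

lemma sq_inner_div_sqrt_le {δ : ℝ} (hδ : 0 < δ) (x h : H) :
    (inner ℝ x h / √(δ + ‖x‖ ^ 2)) ^ 2 ≤ ‖h‖ ^ 2 := by
  have h0 : 0 < δ + ‖x‖ ^ 2 := by positivity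
  rw [div_pow, Real.sq_sqrt h0.le, div_le_iff₀ h0]
  have := abs_real_inner_le_norm x h
  have h3 : inner ℝ x h ^ 2 ≤ (‖x‖ * ‖h‖) ^ 2 := by
    rw [← sq_abs]; gcongr
  nlinarith [sq_nonneg ‖h‖]

lemma hasDerivAt_inner_div_sqrt {δ : ℝ} (hδ : 0 < δ) (x h : H) (t : ℝ) :
    HasDerivAt (fun t : ℝ => inner ℝ (x + t • h) h / √(δ + ‖x + t • h‖ ^ 2))
      ((‖h‖ ^ 2 - (inner ℝ (x + t • h) h / √(δ + ‖x + t • h‖ ^ 2)) ^ 2)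
        / √(δ + ‖x + t • h‖ ^ 2)) t := by
  have h1 : HasDerivAt (fun t : ℝ => x + t • h) h t := by
    simpa using ((hasDerivAt_id t).smul_const h).const_add x
  have h2 : HasDerivAt (fun t : ℝ => inner ℝ (x + t • h) h) (‖h‖ ^ 2) t := by
    have := h1.inner ℝ (hasDerivAt_const t h)
    simpa [real_inner_self_eq_norm_sq] using this
  have h0 : 0 < √(δ + ‖x + t • h‖ ^ 2) := by positivity
  have h3 := h2.div (hasDerivAt_sqrt_add_norm_sq hδ x h t) h0.ne'
  refine h3.congr_deriv ?_
  field_simp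

/-- Along a direction in which the second component moves at most as fast as the first one,
the regularised Burkholder function lies below its tangent. -/
lemma burk_zigzag {p T δ : ℝ} (hp : 1 < p) (hT : T = pStar p - 1) (hδ : 0 < δ) (x y h k : H)
    (hkh : ‖k‖ ≤ ‖h‖) {D : ℝ}
    (hD : HasDerivAt (fun t : ℝ => burk p T (√(δ + ‖x + t • h‖ ^ 2)) (√(δ + ‖y + t • k‖ ^ 2))) D 0) :
    burk p T (√(δ + ‖x + h‖ ^ 2)) (√(δ + ‖y + k‖ ^ 2)) ≤
      burk p T (√(δ + ‖x‖ ^ 2)) (√(δ + ‖y‖ ^ 2)) + D := by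
  set X : ℝ → ℝ := fun t => √(δ + ‖x + t • h‖ ^ 2) with hX
  set Y : ℝ → ℝ := fun t => √(δ + ‖y + t • k‖ ^ 2) with hY
  set X' : ℝ → ℝ := fun t => inner ℝ (x + t • h) h / X t with hX'
  set Y' : ℝ → ℝ := fun t => inner ℝ (y + t • k) k / Y t with hY'
  have Xpos : ∀ t, 0 < X t := fun t => by simp only [hX]; positivity
  have Ypos : ∀ t, 0 < Y t := fun t => by simp only [hY]; positivity
  have dX : ∀ t, HasDerivAt X (X' t) t := fun t => hasDerivAt_sqrt_add_norm_sq hδ x h t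
  have dY : ∀ t, HasDerivAt Y (Y' t) t := fun t => hasDerivAt_sqrt_add_norm_sq hδ y k t
  have dX' : ∀ t, HasDerivAt X' ((‖h‖ ^ 2 - X' t ^ 2) / X t) t :=
    fun t => hasDerivAt_inner_div_sqrt hδ x h t
  have dY' : ∀ t, HasDerivAt Y' ((‖k‖ ^ 2 - Y' t ^ 2) / Y t) t :=
    fun t => hasDerivAt_inner_div_sqrt hδ y k t
  have Rpos : ∀ t, 0 < X t + Y t := fun t => add_pos (Xpos t) (Ypos t)
  have dR : ∀ (e t : ℝ), HasDerivAt (fun t => (X t + Y t) ^ e)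
      ((X' t + Y' t) * e * (X t + Y t) ^ (e - 1)) t := fun e t =>
    ((dX t).add (dY t)).rpow_const (Or.inl (Rpos t).ne')
  set f : ℝ → ℝ := fun t => burk p T (X t) (Y t) with hf
  set g : ℝ → ℝ := fun t => (Y' t - T * X' t) * (X t + Y t) ^ (p - 1) +
    (Y t - T * X t) * ((X' t + Y' t) * (p - 1) * (X t + Y t) ^ (p - 1 - 1)) with hg
  have df : ∀ t, HasDerivAt f (g t) t := fun t =>
    ((dY t).sub ((dX t).const_mul T)).mul (dR (p - 1) t)
  have dg : ∀ t, ∃ g', HasDerivAt g g' t ∧ g' ≤ 0 := by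
    intro t
    refine ⟨_, (((dY' t).sub ((dX' t).const_mul T)).mul (dR (p - 1) t)).add
      (((dY t).sub ((dX t).const_mul T)).mul
        ((((dX' t).add (dY' t)).mul_const (p - 1)).mul (dR (p - 1 - 1) t))), ?_⟩
    have key := burk_second_deriv_nonpos (h := X' t) (k := Y' t) (a := ‖h‖ ^ 2) (b := ‖k‖ ^ 2)
      hp hT (Xpos t) (Ypos t) (sq_inner_div_sqrt_le hδ _ h) (sq_inner_div_sqrt_le hδ _ k)
      (by gcongr)
    have e1 : (X t + Y t) ^ (p - 1) = (X t + Y t) ^ (p - 1 - 1) * (X t + Y t) := by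
      rw [← Real.rpow_add_one (Rpos t).ne']; ring_nf
    have e2 : (X t + Y t) ^ (p - 1 - 1 - 1) = (X t + Y t) ^ (p - 1 - 1) / (X t + Y t) := by
      rw [← Real.rpow_sub_one (Rpos t).ne']
    have := mul_nonpos_of_nonneg_of_nonpos (Real.rpow_nonneg (Rpos t).le (p - 1 - 1)) key
    refine le_trans (le_of_eq ?_) this
    simp only [Pi.add_apply, Pi.sub_apply]
    rw [e1, e2]
    ring
  have hanti : Antitone g := by
    refine antitone_of_deriv_nonpos (fun t => ?_) (fun t => ?_)
    · obtain ⟨g', h1, -⟩ := dg t; exact h1.differentiableAt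
    · obtain ⟨g', h1, h2⟩ := dg t; rw [h1.deriv]; exact h2
  have hD0 : D = g 0 := hD.unique (df 0)
  -- The derivative decreases, so its value at `0` bounds the increment over `[0, 1]`.
  have h3 := Convex.image_sub_le_mul_sub_of_deriv_le (convex_Icc (0 : ℝ) 1) (f := f)
    (fun t _ => (df t).continuousAt.continuousWithinAt)
    (fun t _ => (df t).differentiableAt.differentiableWithinAt) (C := g 0)
    (fun t ht => by
      rw [interior_Icc] at ht
      rw [(df t).deriv]; exact hanti ht.1.le) 0 (by simp) 1 (by simp) zero_le_one
  simp only [hf, hX, hY] at h3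
  simp only [one_smul, zero_smul, add_zero, sub_zero, mul_one] at h3
  rw [hD0]
  linarith

end Zigzag

/-! ### Pointwise majorants -/

/-- Homogeneity of degree `p`: the majorant estimates reduce to one variable, the ratio of `X` and
`Y`. -/
lemma burk_mul {p T X s t : ℝ} (hX : 0 ≤ X) (hst : 0 ≤ s + t) (hp : 1 < p) :
    burk p T (X * s) (X * t) = X ^ p * burk p T s t := by
  rcases hX.eq_or_lt with rfl | hX
  · simp [burk, Real.zero_rpow (by linarith : p ≠ 0)]
  · have e : X * s + X * t = X * (s + t) := by ring
    have e2 : X ^ p = X * X ^ (p - 1) := by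
      rw [mul_comm, ← Real.rpow_add_one hX.ne']; ring_nf
    rw [burk, burk, e, Real.mul_rpow hX.le hst, e2]
    ring

/-- The relation `(p - 1) T = 1` cancels the constant term in `(1 + t) + (p - 1)(t - T)`, so the
derivative has a single sign-carrying factor. For `T = p - 1` the same happens after normalising `Y
= 1` instead of `X = 1`. -/
lemma hasDerivAt_burk_one {p T t : ℝ} (hT : (p - 1) * T = 1) (ht : 0 < 1 + t) :
    HasDerivAt (fun t => burk p T 1 t) (p * t * (1 + t) ^ (p - 2)) t := by
  have h1 : HasDerivAt (fun t : ℝ => t - T * 1) 1 t := (hasDerivAt_id t).sub_const _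
  have h2 := ((hasDerivAt_id t).const_add (1 : ℝ)).rpow_const (p := p - 1) (Or.inl ht.ne')
  refine (h1.mul h2).congr_deriv ?_
  have e1 : (1 + t) ^ (p - 1) = (1 + t) ^ (p - 2) * (1 + t) := by
    rw [← Real.rpow_add_one ht.ne']; ring_nf
  have e2 : p - 1 - 1 = p - 2 := by ring
  simp only [id]
  rw [e2, e1]
  linear_combination (-(1 + t) ^ (p - 2)) * hT

lemma hasDerivAt_burk_right_one {p s : ℝ} (hs : 0 < s + 1) :
    HasDerivAt (fun s => burk p (p - 1) s 1) (-((p - 1) * p * s * (s + 1) ^ (p - 2))) s := by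
  have h1 : HasDerivAt (fun s : ℝ => 1 - (p - 1) * s) (-((p - 1) * 1)) s :=
    ((hasDerivAt_id s).const_mul (p - 1)).const_sub 1
  have h2 := ((hasDerivAt_id s).add_const (1 : ℝ)).rpow_const (p := p - 1) (Or.inl hs.ne')
  refine (h1.mul h2).congr_deriv ?_
  have e1 : (s + 1) ^ (p - 1) = (s + 1) ^ (p - 2) * (s + 1) := by
    rw [← Real.rpow_add_one hs.ne']; ring_nf
  have e2 : p - 1 - 1 = p - 2 := by ring
  simp only [id]
  rw [e2, e1]
  ring

lemma hasDerivAt_rpow_two_sub {p t : ℝ} (ht : 0 < t) :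
    HasDerivAt (fun t : ℝ => t ^ p) (p * t * t ^ (p - 2)) t := by
  refine (Real.hasDerivAt_rpow_const (p := p) (Or.inl ht.ne')).congr_deriv ?_
  have e1 : t ^ (p - 1) = t ^ (p - 2) * t := by
    rw [← Real.rpow_add_one ht.ne']; ring_nf
  rw [e1]; ring

lemma continuousOn_burk {p T : ℝ} (hp : 1 < p) {f g : ℝ → ℝ} (hf : Continuous f)
    (hg : Continuous g) : Continuous fun t => burk p T (f t) (g t) := by
  unfold burk
  have h : Continuous fun t => (f t + g t) ^ (p - 1) :=
    (hf.add hg).rpow_const fun _ => Or.inr (by linarith)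
  fun_prop

lemma le_of_deriv_sign {D D' : ℝ → ℝ} {T t : ℝ} (hT : 0 ≤ T) (hc : Continuous D)
    (hd : ∀ t, 0 < t → HasDerivAt D (D' t) t) (h1 : ∀ t, 0 < t → t < T → D' t ≤ 0)
    (h2 : ∀ t, T < t → 0 ≤ D' t) (ht : 0 ≤ t) : D T ≤ D t := by
  rcases le_total t T with h | h
  · have : AntitoneOn D (Icc 0 T) := by
      refine antitoneOn_of_deriv_nonpos (convex_Icc _ _) hc.continuousOn ?_ ?_
      · rw [interior_Icc]
        exact fun x hx => (hd x hx.1).differentiableAt.differentiableWithinAt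
      · rw [interior_Icc]
        intro x hx
        rw [(hd x hx.1).deriv]; exact h1 x hx.1 hx.2
    exact this ⟨ht, h⟩ ⟨hT, le_rfl⟩ h
  · have : MonotoneOn D (Ici T) := by
      refine monotoneOn_of_deriv_nonneg (convex_Ici _) hc.continuousOn ?_ ?_
      · rw [interior_Ici]
        exact fun x hx => (hd x (hT.trans_lt hx)).differentiableAt.differentiableWithinAt
      · rw [interior_Ici]
        intro x hx
        rw [(hd x (hT.trans_lt hx)).deriv]; exact h2 x hx
    exact this (mem_Ici.2 le_rfl) h h

/-- `Y^p - T^p X^p` is dominated by a multiple of Burkholder's function. -/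
lemma exists_majorant {p T : ℝ} (hp : 1 < p) (hT : T = pStar p - 1) :
    ∃ α : ℝ, 0 ≤ α ∧ ∀ X Y : ℝ, 0 ≤ X → 0 ≤ Y → Y ^ p - T ^ p * X ^ p ≤ α * burk p T X Y := by
  have hT1 : 1 ≤ T := hT ▸ one_le_pStar_sub_one hp
  have hT0 : 0 < T := by linarith
  have hp0 : 0 < p := by linarith
  rcases le_or_gt 2 p with h2 | h2
  · have hTp : T = p - 1 := by rw [hT, pStar_sub_one_of_two_le h2]
    -- The only possible choice: at `s = T⁻¹`, that is `Y = T X`, both sides vanish, and `α` makes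
    -- their derivatives agree.
    set α : ℝ := T ^ (p - 1) * (T⁻¹ / (T⁻¹ + 1)) ^ (p - 2) with hα
    have hα0 : 0 ≤ α := by positivity
    refine ⟨α, hα0, fun X Y hX hY => ?_⟩
    -- The normalisation `Y = 1` misses `Y = 0`, where the claim becomes `α T ≤ T^p`.
    rcases hY.eq_or_lt with rfl | hY
    · have hα1 : α * T ≤ T ^ p := by
        have h3 : (T⁻¹ / (T⁻¹ + 1)) ^ (p - 2) ≤ 1 := by
          refine Real.rpow_le_one (by positivity) ?_ (by linarith)
          rw [div_le_one (by positivity)]; linarith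
        have h4 : T ^ p = T ^ (p - 1) * T := by
          rw [← Real.rpow_add_one hT0.ne']; ring_nf
        rw [hα, h4]
        have : 0 ≤ T ^ (p - 1) * T := by positivity
        nlinarith
      have h5 := burk_mul (T := T) (s := 1) (t := 0) hX (by norm_num) hp
      simp only [mul_one, mul_zero] at h5
      rw [h5, Real.zero_rpow hp0.ne']
      have : burk p T 1 0 = -T := by simp [burk]
      rw [this]
      have : 0 ≤ X ^ p := by positivity
      nlinarith
    · set D : ℝ → ℝ := fun s => α * burk p T s 1 - 1 + T ^ p * s ^ p with hD
      have key := le_of_deriv_sign (D := D) (T := T⁻¹) (t := X / Y)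
        (D' := fun s => α * (-((p - 1) * p * s * (s + 1) ^ (p - 2)))
          + T ^ p * (p * s * s ^ (p - 2))) (by positivity) ?_ ?_ ?_ ?_ (by positivity)
      · have h6 : D T⁻¹ = 0 := by
          have : burk p T T⁻¹ 1 = 0 := by simp [burk, hT0.ne']
          rw [hD]; dsimp only
          rw [this, Real.inv_rpow hT0.le, mul_inv_cancel₀ (by positivity)]; ring
        rw [h6] at key
        have h7 := burk_mul (T := T) (s := X / Y) (t := 1) hY.le (by positivity) hp
        rw [mul_div_cancel₀ _ hY.ne', mul_one] at h7
        rw [h7]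
        simp only [hD, Real.div_rpow hX hY.le] at key
        have h8 := mul_nonneg (Real.rpow_nonneg hY.le p) key
        have h9 : 0 < Y ^ p := by positivity
        field_simp at h8
        linarith
      · have := continuousOn_burk (T := T) hp continuous_id (continuous_const (y := (1 : ℝ)))
        have h : Continuous fun s : ℝ => s ^ p :=
          continuous_id.rpow_const fun _ => Or.inr (by linarith)
        simp only [hD]
        simp only [id] at this
        fun_prop
      · intro s hs
        have h3 := hasDerivAt_burk_right_one (p := p) (s := s) (by linarith)
        rw [← hTp] at h3
        rw [← hTp]
        exact ((h3.const_mul α).sub_const 1).add ((hasDerivAt_rpow_two_sub hs).const_mul _)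
      all_goals
        -- Factored this way, the sign of the derivative is that of the difference of two values of
        -- the increasing function `s / (s + 1)`, raised to `p - 2 ≥ 0`.
        have hform : ∀ s : ℝ, 0 < s → α * (-((p - 1) * p * s * (s + 1) ^ (p - 2)))
          + T ^ p * (p * s * s ^ (p - 2)) = T ^ p * p * s * (s + 1) ^ (p - 2) *
            ((s / (s + 1)) ^ (p - 2) - (T⁻¹ / (T⁻¹ + 1)) ^ (p - 2)) := by
          intro s hs
          have h4 : T ^ p = T ^ (p - 1) * T := by
            rw [← Real.rpow_add_one hT0.ne']; ring_nf
          rw [Real.div_rpow hs.le (by linarith) (p - 2), hα, h4, ← hTp]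
          field_simp
          ring
      · intro s hs hs2
        rw [hform s hs]
        refine mul_nonpos_of_nonneg_of_nonpos (by positivity) (sub_nonpos.2 ?_)
        refine Real.rpow_le_rpow (by positivity) ?_ (by linarith)
        rw [div_le_div_iff₀ (by positivity) (by positivity)]
        nlinarith
      · intro s hs
        have hs0 : 0 < s := lt_trans (by positivity) hs
        rw [hform s hs0]
        refine mul_nonneg (by positivity) (sub_nonneg.2 ?_)
        refine Real.rpow_le_rpow (by positivity) ?_ (by linarith)
        rw [div_le_div_iff₀ (by positivity) (by positivity)]
        nlinarith
  · have hTp : (p - 1) * T = 1 := by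
      rw [hT, pStar_sub_one_of_lt_two hp h2]; field_simp [show p - 1 ≠ 0 by linarith]
    -- Again fixed by tangency at `Y = T X`, now with `X = 1` as normalisation.
    set α : ℝ := ((1 + T) / T) ^ (2 - p) with hα
    have hα0 : 0 ≤ α := by positivity
    refine ⟨α, hα0, fun X Y hX hY => ?_⟩
    rcases hX.eq_or_lt with rfl | hX
    · have hα1 : 1 ≤ α := by
        refine Real.one_le_rpow ?_ (by linarith)
        rw [le_div_iff₀ hT0]; linarith
      have h5 := burk_mul (T := T) (s := 0) (t := 1) hY (by norm_num) hp
      simp only [mul_one, mul_zero] at h5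
      rw [h5, Real.zero_rpow hp0.ne']
      have : burk p T 0 1 = 1 := by simp [burk]
      rw [this]
      have : 0 ≤ Y ^ p := by positivity
      nlinarith
    · set D : ℝ → ℝ := fun t => α * burk p T 1 t - t ^ p + T ^ p with hD
      have key := le_of_deriv_sign (D := D) (T := T) (t := Y / X)
        (D' := fun t => α * (p * t * (1 + t) ^ (p - 2)) - p * t * t ^ (p - 2))
          hT0.le ?_ ?_ ?_ ?_ (by positivity)
      · have h6 : D T = 0 := by simp [hD, burk]
        rw [h6] at key
        have h7 := burk_mul (T := T) (s := 1) (t := Y / X) hX.le (by positivity) hp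
        rw [mul_div_cancel₀ _ hX.ne', mul_one] at h7
        rw [h7]
        simp only [hD, Real.div_rpow hY hX.le] at key
        have h8 := mul_nonneg (Real.rpow_nonneg hX.le p) key
        have h9 : 0 < X ^ p := by positivity
        field_simp at h8
        linarith
      · have := continuousOn_burk (T := T) hp (continuous_const (y := (1 : ℝ))) continuous_id
        have h : Continuous fun s : ℝ => s ^ p :=
          continuous_id.rpow_const fun _ => Or.inr (by linarith)
        simp only [hD]
        simp only [id] at this
        fun_prop
      · intro t ht
        exact (((hasDerivAt_burk_one hTp (by linarith)).const_mul α).sub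
          (hasDerivAt_rpow_two_sub ht)).add_const _
      all_goals
        have hform : ∀ t : ℝ, 0 < t → α * (p * t * (1 + t) ^ (p - 2)) - p * t * t ^ (p - 2)
            = p * t * (1 + t) ^ (p - 2) * (α - ((1 + t) / t) ^ (2 - p)) := by
          intro t ht
          have e : p - 2 = -(2 - p) := by ring
          rw [Real.div_rpow (by linarith) ht.le (2 - p), e, Real.rpow_neg (by linarith),
            Real.rpow_neg ht.le]
          have h3 : (1 + t) ^ (2 - p) ≠ 0 := by positivity
          have h4 : t ^ (2 - p) ≠ 0 := by positivity
          field_simp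
      · intro t ht ht2
        rw [hform t ht]
        refine mul_nonpos_of_nonneg_of_nonpos (by positivity) (sub_nonpos.2 ?_)
        refine Real.rpow_le_rpow (by positivity) ?_ (by linarith)
        rw [div_le_div_iff₀ (by positivity) (by positivity)]
        nlinarith
      · intro t ht
        have ht0 : 0 < t := hT0.trans ht
        rw [hform t ht0]
        refine mul_nonneg (by positivity) (sub_nonneg.2 ?_)
        refine Real.rpow_le_rpow (by positivity) ?_ (by linarith)
        rw [div_le_div_iff₀ (by positivity) (by positivity)]
        nlinarith

/-- For `p ≥ 2`, convexity reduces the estimate of the full gradient to the one of its skew part. -/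
lemma norm_rpow_le_of_two_le {p T X Y : ℝ} (hp : 2 ≤ p) (hT : 0 < T) (hX : 0 ≤ X) (hY : 0 ≤ Y) :
    (X ^ 2 + Y ^ 2) ^ (p / 2) - (1 + T ^ 2) ^ (p / 2) * X ^ p
      ≤ (1 + T ^ 2) ^ (p / 2) * (T ^ 2 / (1 + T ^ 2)) / T ^ p * (Y ^ p - T ^ p * X ^ p) := by
  -- With these weights the mean of `X²` and `(Y / T)²` is `(X² + Y²) / (1 + T²)`, and the two
  -- points coincide when `Y = T X`.
  have hc := (convexOn_rpow (p := p / 2) (by linarith)).2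
    (mem_Ici.2 (by positivity : 0 ≤ X ^ 2)) (mem_Ici.2 (by positivity : 0 ≤ (Y / T) ^ 2))
    (by positivity : 0 ≤ 1 / (1 + T ^ 2)) (by positivity : 0 ≤ T ^ 2 / (1 + T ^ 2))
    (by field_simp)
  have e : ∀ Z : ℝ, 0 ≤ Z → (Z ^ 2) ^ (p / 2) = Z ^ p := by
    intro Z hZ
    rw [← Real.rpow_natCast Z 2, ← Real.rpow_mul hZ]
    congr 1; push_cast; ring
  simp only [smul_eq_mul] at hc
  rw [e X hX, e (Y / T) (by positivity), Real.div_rpow hY hT.le] at hc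
  have e1 : 1 / (1 + T ^ 2) * X ^ 2 + T ^ 2 / (1 + T ^ 2) * (Y / T) ^ 2
      = (X ^ 2 + Y ^ 2) / (1 + T ^ 2) := by field_simp
  rw [e1, Real.div_rpow (by positivity) (by positivity)] at hc
  have h0 : 0 < (1 + T ^ 2) ^ (p / 2) := by positivity
  have h1 : 0 < T ^ p := by positivity
  rw [div_le_iff₀ h0] at hc
  refine (sub_le_sub_right hc _).trans (le_of_eq ?_)
  field_simp
  ring

/-! ### The full gradient for `p < 2` -/

/-- The slope of the tangent majorant of `(X^2 + Y^2)^{p/2}` touching at `Y = t X`. -/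
def tangentSlope (p t : ℝ) : ℝ := ((1 + t) ^ 2 / (1 + t ^ 2)) ^ ((2 - p) / 2)

lemma sq_rpow_half {x : ℝ} (hx : 0 ≤ x) (e : ℝ) : (x ^ 2) ^ (e / 2) = x ^ e := by
  rw [← Real.rpow_natCast x 2, ← Real.rpow_mul hx]
  congr 1; push_cast; ring

lemma tangentSlope_pos {p t : ℝ} (ht : 0 ≤ t) : 0 < tangentSlope p t := by
  unfold tangentSlope; positivity

lemma one_le_tangentSlope {p t : ℝ} (hp : p < 2) (ht : 0 ≤ t) : 1 ≤ tangentSlope p t := by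
  refine Real.one_le_rpow ?_ (by linarith)
  rw [le_div_iff₀ (by positivity)]
  nlinarith

lemma tangentSlope_mul {p t : ℝ} (ht : 0 ≤ t) :
    tangentSlope p t * (1 + t ^ 2) ^ ((2 - p) / 2) = (1 + t) ^ (2 - p) := by
  rw [tangentSlope, Real.div_rpow (by positivity) (by positivity), sq_rpow_half (by positivity),
    div_mul_cancel₀ _ (by positivity)]

/-- After cross-multiplication the difference of the bases is `2 (t - s)(1 - s t)`; the slope is
invariant under `t ↦ 1 / t`. -/
lemma tangentSlope_le {p s t : ℝ} (hp : p < 2) (hs : 0 ≤ s)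
    (h : 0 ≤ (t - s) * (1 - s * t)) : tangentSlope p s ≤ tangentSlope p t := by
  refine Real.rpow_le_rpow (by positivity) ?_ (by linarith)
  rw [div_le_div_iff₀ (by positivity) (by positivity)]
  nlinarith

/-- The difference between the majorant and the function to be dominated, at `Y = t X`. -/
def majorantGap (p T a C t : ℝ) : ℝ := a * burk p T 1 t - (1 + t ^ 2) ^ (p / 2) + C

lemma continuous_majorantGap {p T a C : ℝ} (hp : 1 < p) : Continuous (majorantGap p T a C) := by
  have h1 := continuousOn_burk (T := T) hp (continuous_const (y := (1 : ℝ))) continuous_id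
  have h2 : Continuous fun t : ℝ => (1 + t ^ 2) ^ (p / 2) :=
    (by fun_prop : Continuous fun t : ℝ => 1 + t ^ 2).rpow_const fun _ => Or.inr (by linarith)
  unfold majorantGap
  simp only [id] at h1
  fun_prop

/-- The factor `tangentSlope p t₀` is chosen so that the derivative vanishes at `t₀`; by the
symmetry `t ↦ 1 / t` it then vanishes at `t₀⁻¹` too. -/
lemma hasDerivAt_majorantGap {p T t₀ C t : ℝ} (hT : (p - 1) * T = 1)
    (ht : 0 < t) :
    HasDerivAt (majorantGap p T (tangentSlope p t₀) C)
      (p * t * (1 + t) ^ (p - 2) * (tangentSlope p t₀ - tangentSlope p t)) t := by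
  have h1 := (hasDerivAt_burk_one hT (by linarith : 0 < 1 + t)).const_mul (tangentSlope p t₀)
  have h2 : HasDerivAt (fun t : ℝ => 1 + t ^ 2) (2 * t) t := by
    simpa using (hasDerivAt_pow 2 t).const_add 1
  have h3 := h2.rpow_const (p := p / 2) (Or.inl (by positivity))
  refine ((h1.sub h3).add_const C).congr_deriv ?_
  have e1 : (1 + t ^ 2) ^ (p / 2 - 1) = ((1 + t ^ 2) ^ ((2 - p) / 2))⁻¹ := by
    rw [← Real.rpow_neg (by positivity)]; ring_nf
  have e2 : (1 + t) ^ (p - 2) * (1 + t) ^ (2 - p) = 1 := by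
    rw [← Real.rpow_add (by positivity)]; ring_nf; simp
  have e3 := tangentSlope_mul (p := p) ht.le
  have e4 : (1 + t ^ 2) ^ ((2 - p) / 2) ≠ 0 := by positivity
  rw [e1]
  field_simp
  rw [← e3] at e2
  linear_combination p * e2

/-- The gap increases on `[0, t₀⁻¹]`, decreases on `[t₀⁻¹, t₀]` and increases afterwards, so its
minimum over `t ≥ 0` is attained at `0` or at `t₀`. -/
lemma majorantGap_nonneg {p T t₀ C t : ℝ} (hp1 : 1 < p) (hp : p < 2) (hT : (p - 1) * T = 1)
    (ht₀ : 1 ≤ t₀) (h0 : 0 ≤ majorantGap p T (tangentSlope p t₀) C 0)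
    (h1 : 0 ≤ majorantGap p T (tangentSlope p t₀) C t₀) (ht : 0 ≤ t) :
    0 ≤ majorantGap p T (tangentSlope p t₀) C t := by
  set D := majorantGap p T (tangentSlope p t₀) C
  have hc : Continuous D := continuous_majorantGap hp1
  have hd : ∀ t, 0 < t → HasDerivAt D
      (p * t * (1 + t) ^ (p - 2) * (tangentSlope p t₀ - tangentSlope p t)) t :=
    fun t ht => hasDerivAt_majorantGap hT ht
  have hi : t₀⁻¹ ≤ 1 := inv_le_one_of_one_le₀ ht₀
  have hi0 : 0 < t₀⁻¹ := by positivity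
  rcases le_total t t₀⁻¹ with h | h
  · have : MonotoneOn D (Icc 0 t₀⁻¹) := by
      refine monotoneOn_of_deriv_nonneg (convex_Icc _ _) hc.continuousOn ?_ ?_
      · rw [interior_Icc]
        exact fun x hx => (hd x hx.1).differentiableAt.differentiableWithinAt
      · rw [interior_Icc]
        intro x hx
        have hx0 := hx.1
        rw [(hd x hx.1).deriv]
        refine mul_nonneg (by positivity) (sub_nonneg.2 (tangentSlope_le hp hx.1.le ?_))
        have h2 : x * t₀ ≤ 1 := by
          have := hx.2.le
          rwa [← one_div, le_div_iff₀ (by linarith)] at this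
        exact mul_nonneg (by linarith [hx.2]) (by linarith)
    exact h0.trans (this ⟨le_rfl, hi0.le⟩ ⟨ht, h⟩ ht)
  rcases le_total t t₀ with h' | h'
  · have : AntitoneOn D (Icc t₀⁻¹ t₀) := by
      refine antitoneOn_of_deriv_nonpos (convex_Icc _ _) hc.continuousOn ?_ ?_
      · rw [interior_Icc]
        exact fun x hx => (hd x (hi0.trans hx.1)).differentiableAt.differentiableWithinAt
      · rw [interior_Icc]
        intro x hx
        have hx0 := hi0.trans hx.1
        rw [(hd x hx0).deriv]
        refine mul_nonpos_of_nonneg_of_nonpos (by positivity)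
          (sub_nonpos.2 (tangentSlope_le hp (by linarith) ?_))
        have h2 : 1 ≤ x * t₀ := by
          have := hx.1.le
          rwa [← one_div, div_le_iff₀ (by linarith)] at this
        exact mul_nonneg_of_nonpos_of_nonpos (by linarith [hx.2]) (by linarith)
    exact h1.trans (this ⟨h, h'⟩ ⟨by linarith, le_rfl⟩ h')
  · have : MonotoneOn D (Ici t₀) := by
      refine monotoneOn_of_deriv_nonneg (convex_Ici _) hc.continuousOn ?_ ?_
      · rw [interior_Ici]
        exact fun x hx => (hd x (by linarith [mem_Ioi.1 hx])).differentiableAt.differentiableWithinAt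
      · rw [interior_Ici]
        intro x hx
        have hx := mem_Ioi.1 hx
        have hx0 : 0 < x := by linarith
        rw [(hd x hx0).deriv]
        refine mul_nonneg (by positivity) (sub_nonneg.2 (tangentSlope_le hp hx0.le ?_))
        exact mul_nonneg_of_nonpos_of_nonpos (by linarith) (by nlinarith)
    exact h1.trans (this (mem_Ici.2 le_rfl) h' h')

/-- By homogeneity only the ratio `Y / X` matters; the remaining case `X = 0` is where `1 ≤ a`
enters. -/
lemma norm_rpow_le_of_majorantGap {p T a C X Y : ℝ} (hp : 1 < p) (ha : 1 ≤ a)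
    (h : ∀ t, 0 ≤ t → 0 ≤ majorantGap p T a C t) (hX : 0 ≤ X) (hY : 0 ≤ Y) :
    (X ^ 2 + Y ^ 2) ^ (p / 2) - C * X ^ p ≤ a * burk p T X Y := by
  rcases hX.eq_or_lt with rfl | hX
  · have h5 := burk_mul (T := T) (s := 0) (t := 1) hY (by norm_num) hp
    simp only [mul_one, mul_zero] at h5
    rw [h5, Real.zero_rpow (by linarith)]
    have e : burk p T 0 1 = 1 := by simp [burk]
    have e2 : ((0 : ℝ) ^ 2 + Y ^ 2) ^ (p / 2) = Y ^ p := by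
      rw [← sq_rpow_half hY]; simp
    rw [e, e2]
    have : 0 ≤ Y ^ p := by positivity
    nlinarith
  · have key := h (Y / X) (by positivity)
    have h7 := burk_mul (T := T) (s := 1) (t := Y / X) hX.le (by positivity) hp
    rw [mul_div_cancel₀ _ hX.ne', mul_one] at h7
    have e1 : X ^ 2 + Y ^ 2 = X ^ 2 * (1 + (Y / X) ^ 2) := by field_simp
    rw [h7, e1, Real.mul_rpow (by positivity) (by positivity), sq_rpow_half hX.le]
    unfold majorantGap at key
    nlinarith [mul_nonneg (Real.rpow_nonneg hX.le p) key]

/-- The origin of `u_p`: when `C` makes the gap vanish at `0`, the gap at the point of tangency is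
`u_p` up to a positive factor. A root of `u_p` therefore gives contact at `0` and at `t`
simultaneously. -/
lemma majorantGap_eq_auxU {p T t : ℝ} (hT : (p - 1) * T = 1) (ht : 0 ≤ t) :
    (p - 1) * (1 + t ^ 2) ^ ((2 - p) / 2) *
      majorantGap p T (tangentSlope p t) (1 + tangentSlope p t * T) t = auxU p t := by
  have e1 : (1 + t ^ 2) ^ (p / 2) * (1 + t ^ 2) ^ ((2 - p) / 2) = 1 + t ^ 2 := by
    rw [← Real.rpow_add (by positivity), show p / 2 + (2 - p) / 2 = 1 by ring, Real.rpow_one]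
  have e2 : (1 + t) ^ (p - 1) * (1 + t) ^ (2 - p) = 1 + t := by
    rw [← Real.rpow_add (by positivity), show p - 1 + (2 - p) = 1 by ring, Real.rpow_one]
  have e3 := tangentSlope_mul (p := p) ht
  unfold majorantGap burk auxU
  set a := tangentSlope p t
  set w := (1 + t ^ 2) ^ ((2 - p) / 2)
  set v := (1 + t) ^ (2 - p)
  set z := (1 + t) ^ (p - 1)
  rw [mul_one]
  have e4 : w * a * z = 1 + t := by linear_combination z * e3 + e2
  linear_combination ((p - 1) * (t - T)) * e4 - (p - 1) * e1 + (p - 1) * T * e3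
    + (v - 1 - t) * hT

lemma majorantGap_zero {p T a C : ℝ} : majorantGap p T a C 0 = C - 1 - a * T := by
  simp [majorantGap, burk]; ring

/-- The majorant touching at a root of `auxU`. -/
lemma norm_rpow_le_of_auxU_eq_zero {p T t₀ X Y : ℝ} (hp1 : 1 < p) (hp : p < 2)
    (hT : (p - 1) * T = 1) (ht₀ : 1 ≤ t₀) (h : auxU p t₀ = 0) (hX : 0 ≤ X) (hY : 0 ≤ Y) :
    (X ^ 2 + Y ^ 2) ^ (p / 2) - (1 + tangentSlope p t₀ * T) * X ^ p
      ≤ tangentSlope p t₀ * burk p T X Y := by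
  refine norm_rpow_le_of_majorantGap hp1 (one_le_tangentSlope hp (by linarith)) (fun t ht => ?_) hX hY
  refine majorantGap_nonneg hp1 hp hT ht₀ ?_ ?_ ht
  · rw [majorantGap_zero]; linarith
  · have h1 := majorantGap_eq_auxU hT (by linarith : 0 ≤ t₀)
    rw [h] at h1
    have h2 : (p - 1) * (1 + t₀ ^ 2) ^ ((2 - p) / 2) ≠ 0 :=
      mul_ne_zero (by linarith) (by positivity)
    exact ((mul_eq_zero.1 h1).resolve_left h2).ge

/-- The majorant touching at `Y = T X`. -/
lemma norm_rpow_le_of_auxU_nonpos {p T X Y : ℝ} (hp1 : 1 < p) (hp : p < 2)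
    (hT : (p - 1) * T = 1) (hT1 : 1 ≤ T) (h : auxU p T ≤ 0) (hX : 0 ≤ X) (hY : 0 ≤ Y) :
    (X ^ 2 + Y ^ 2) ^ (p / 2) - (1 + T ^ 2) ^ (p / 2) * X ^ p
      ≤ tangentSlope p T * burk p T X Y := by
  refine norm_rpow_le_of_majorantGap hp1 (one_le_tangentSlope hp (by linarith)) (fun t ht => ?_) hX hY
  have hgap : ∀ C, majorantGap p T (tangentSlope p T) C T = C - (1 + T ^ 2) ^ (p / 2) := by
    intro C; simp [majorantGap, burk]; ring
  refine majorantGap_nonneg hp1 hp hT hT1 ?_ ?_ ht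
  · rw [majorantGap_zero]
    -- Here `C` makes the gap vanish at `T`, and `auxU p T ≤ 0` says exactly that `1 + a T ≤ C` with
    -- `a = tangentSlope p T`: the gap at `0` is nonnegative.
    have h1 := majorantGap_eq_auxU hT (by linarith : 0 ≤ T)
    rw [hgap] at h1
    have h2 : 0 < (p - 1) * (1 + T ^ 2) ^ ((2 - p) / 2) :=
      mul_pos (by linarith) (by positivity)
    by_contra! h3
    have := mul_pos h2 (by linarith :
      0 < 1 + tangentSlope p T * T - (1 + T ^ 2) ^ (p / 2))
    linarith
  · rw [hgap]; simp

/-! ### The sign of `auxU` at `pStar p - 1` -/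

/-- Parametrises `[a, b)` by `s ≥ 0`. A rational inequality on the interval turns into the
positivity of a polynomial in `s` whose coefficients can be checked term by term with `positivity`.
-/
lemma exists_eq_moebius {a b q : ℝ} (h1 : a ≤ q) (h2 : q < b) :
    ∃ s : ℝ, 0 ≤ s ∧ q = (a + b * s) / (1 + s) := by
  have h3 : 0 < b - q := by linarith
  have h4 : 0 ≤ (q - a) / (b - q) := div_nonneg (by linarith) h3.le
  refine ⟨(q - a) / (b - q), h4, ?_⟩
  rw [eq_div_iff (by positivity)]
  field_simp
  ring

/-- Logarithm of the first term of `signFun`. -/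
def logFst (q : ℝ) : ℝ := (1 + q) * Real.log q + (1 - q) / 2 * Real.log (1 + q ^ 2)

/-- Logarithm of the second term of `signFun`. -/
def logSnd (q : ℝ) : ℝ := q * Real.log q + (1 - q) * Real.log (1 + q)

/-- A function with the sign of `auxU p (pStar p - 1)`, where `p = 1 + q`. -/
def signFun (q : ℝ) : ℝ := Real.exp (logFst q) + Real.exp (logSnd q) - (1 + q ^ 2)

lemma exp_logFst {q : ℝ} (hq : 0 < q) :
    Real.exp (logFst q) = q ^ (1 + q) * (1 + q ^ 2) ^ ((1 - q) / 2) := by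
  rw [logFst, Real.exp_add, Real.rpow_def_of_pos hq, Real.rpow_def_of_pos (by positivity)]
  ring_nf

lemma exp_logSnd {q : ℝ} (hq : 0 < q) :
    Real.exp (logSnd q) = q ^ q * (1 + q) ^ (1 - q) := by
  rw [logSnd, Real.exp_add, Real.rpow_def_of_pos hq, Real.rpow_def_of_pos (by positivity)]
  ring_nf

lemma signFun_eq {q : ℝ} (hq : 0 < q) : signFun q = q * auxU (1 + q) (1 / q) := by
  have e0 : 2 - (1 + q) = 1 - q := by ring
  have e1 : 1 + (1 / q) ^ 2 = (1 + q ^ 2) / q ^ 2 := by field_simp; ring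
  have e2 : 1 + 1 / q = (1 + q) / q := by field_simp; ring
  have e3 : q ^ (1 + q) * q ^ (1 - q) = q * q := by
    rw [← Real.rpow_add hq, show 1 + q + (1 - q) = 2 by ring, Real.rpow_two, sq]
  have e4 : q ^ q * q ^ (1 - q) = q := by
    rw [← Real.rpow_add hq]; ring_nf; rw [Real.rpow_one]
  rw [signFun, exp_logFst hq, exp_logSnd hq, auxU, e0, e1, e2,
    Real.div_rpow (by positivity) (by positivity), Real.div_rpow (by positivity) hq.le,
    sq_rpow_half hq.le]
  have h0 : q ^ (1 - q) ≠ 0 := by positivity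
  field_simp
  linear_combination (1 + q ^ 2) ^ ((1 - q) / 2) * e3 + (1 + q) ^ (1 - q) * e4

/-- Bernoulli's inequality for `(e q)^q`, with equality at `q = 1 / e`, where `q^q` is smallest;
hence accurate on the range needed in `signFun_neg`. -/
lemma self_rpow_self_le {q : ℝ} (hq : 0 < q) (hq1 : q ≤ 1) :
    q ^ q ≤ (1 - q + Real.exp 1 * q ^ 2) * Real.exp (-q) := by
  have h1 := rpow_one_add_le_one_add_mul_self (s := Real.exp 1 * q - 1) (p := q)
    (by linarith [mul_pos (Real.exp_pos 1) hq]) hq.le hq1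
  rw [add_sub_cancel, Real.mul_rpow (Real.exp_pos 1).le hq.le, Real.exp_one_rpow] at h1
  have h2 : Real.exp q * Real.exp (-q) = 1 := by rw [← Real.exp_add]; simp
  calc q ^ q = (Real.exp q * q ^ q) * Real.exp (-q) := by linear_combination (-q ^ q) * h2
    _ ≤ (1 + q * (Real.exp 1 * q - 1)) * Real.exp (-q) := by gcongr
    _ = _ := by ring

/-- Bernoulli's inequality bounds each of the three powers, and a Taylor polynomial bounds `exp q`
from below; a polynomial inequality remains. -/
lemma signFun_neg {q : ℝ} (hq : 0 < q) (hq1 : q ≤ 2 / 5) : signFun q < 0 := by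
  have h1 : (1 + q ^ 2) ^ ((1 - q) / 2) ≤ 1 + (1 - q) / 2 * q ^ 2 :=
    rpow_one_add_le_one_add_mul_self (by nlinarith) (by linarith) (by linarith)
  have h2 : (1 + q) ^ (1 - q) ≤ 1 + (1 - q) * q :=
    rpow_one_add_le_one_add_mul_self (by linarith) (by linarith) (by linarith)
  have h3 := self_rpow_self_le hq (by linarith)
  have h4 : 0 < q ^ q := by positivity
  have h5 : 1 + q + q ^ 2 / 2 + q ^ 3 / 6 ≤ Real.exp q := by
    have := Real.sum_le_exp_of_nonneg hq.le 4
    simp [Finset.sum_range_succ, Nat.factorial] at this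
    linarith
  have h6 : q ^ q * (1 + q + q ^ 2 / 2 + q ^ 3 / 6) ≤ 1 - q + 2.7183 * q ^ 2 := by
    have h7 : Real.exp (-q) * Real.exp q = 1 := by rw [← Real.exp_add]; simp
    have h8 := Real.exp_one_lt_d9
    calc q ^ q * (1 + q + q ^ 2 / 2 + q ^ 3 / 6) ≤ q ^ q * Real.exp q := by gcongr
      _ ≤ (1 - q + Real.exp 1 * q ^ 2) * Real.exp (-q) * Real.exp q := by gcongr
      _ = 1 - q + Real.exp 1 * q ^ 2 := by rw [mul_assoc, h7, mul_one]
      _ ≤ 1 - q + 2.7183 * q ^ 2 := by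
        have : Real.exp 1 ≤ 2.7183 := by linarith
        gcongr
  have e1 : q ^ (1 + q) = q * q ^ q := by rw [Real.rpow_add hq, Real.rpow_one]
  rw [signFun, exp_logFst hq, exp_logSnd hq, e1]
  have h9 : q * q ^ q * (1 + q ^ 2) ^ ((1 - q) / 2) + q ^ q * (1 + q) ^ (1 - q)
      ≤ q ^ q * (q * (1 + (1 - q) / 2 * q ^ 2) + (1 + (1 - q) * q)) := by
    have h10 := mul_le_mul_of_nonneg_left h1 (by positivity : 0 ≤ q * q ^ q)
    have h11 := mul_le_mul_of_nonneg_left h2 h4.le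
    linarith
  have hR : 0 < 1 + q + q ^ 2 / 2 + q ^ 3 / 6 := by positivity
  have hS : 0 < q * (1 + (1 - q) / 2 * q ^ 2) + (1 + (1 - q) * q) := by
    have a1 : 0 ≤ (1 - q) / 2 * q ^ 2 := mul_nonneg (by linarith) (by positivity)
    have a2 : 0 ≤ (1 - q) * q := mul_nonneg (by linarith) hq.le
    have a3 := mul_pos hq (by linarith : 0 < 1 + (1 - q) / 2 * q ^ 2)
    linarith
  have h12 : (1 - q + 2.7183 * q ^ 2) * (q * (1 + (1 - q) / 2 * q ^ 2) + (1 + (1 - q) * q))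
      < (1 + q ^ 2) * (1 + q + q ^ 2 / 2 + q ^ 3 / 6) := by
    -- The endpoint `41 / 100` leaves room beyond `2 / 5`. At `q = 0` both sides are equal, so
    -- strictness requires `s > 0`.
    obtain ⟨s, hs, rfl⟩ := exists_eq_moebius hq.le (by linarith : q < 41 / 100)
    have hs : 0 < s := by
      rcases hs.eq_or_lt with rfl | h
      · simp at hq
      · exact h
    rw [← sub_pos]
    field_simp
    ring_nf
    positivity
  have h13 := mul_le_mul_of_nonneg_right h6 hS.le
  have h14 : q ^ q * (q * (1 + (1 - q) / 2 * q ^ 2) + (1 + (1 - q) * q)) < 1 + q ^ 2 := by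
    by_contra! h
    have := mul_le_mul_of_nonneg_right h hR.le
    nlinarith
  linarith

/-! ### Rational estimates for the concavity of `signFun` on `[2/5, 1]` -/

/-- The left side is the bound for `logFst'² + logFst''` that results from `logFst'_le_left`. An
affine majorant keeps the degree low in `rational_sum_bound_left`. The ranges of the left and right
versions overlap around `1 / √3`. -/
lemma rational_bound_left {q : ℝ} (h1 : 2 / 5 ≤ q) (h2 : q ≤ 29 / 50) :
    (-(0.6931 + (1 - 3 * q ^ 2) / (1 + 5 * q ^ 2)) + 1 / q + (1 + q) / (1 + q ^ 2)) ^ 2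
      + (1 / (q * (1 + q ^ 2)) - 1 / q ^ 2 + (1 - 2 * q - q ^ 2) / (1 + q ^ 2) ^ 2)
      ≤ 4.078 - 1.7 * q := by
  obtain ⟨s, hs, rfl⟩ := exists_eq_moebius h1 (by linarith : q < 3 / 5)
  rw [← sub_nonneg]
  field_simp
  ring_nf
  positivity

lemma rational_sum_bound_left {q : ℝ} (h1 : 2 / 5 ≤ q) (h2 : q ≤ 29 / 50) :
    (q ^ 2 + q * (1 - q) ^ 2) * (1 + (1 - q) * q ^ 2 / 2) * (4.078 - 1.7 * q)
      + (2 * q / ((1 + q) * (1 + 2 * q))) ^ 2 + (1 - q) / (q * (1 + q) ^ 2) < 2 := by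
  obtain ⟨s, hs, rfl⟩ := exists_eq_moebius h1 (by linarith : q < 3 / 5)
  rw [← sub_pos]
  field_simp
  ring_nf
  positivity

lemma rational_bound_right {q : ℝ} (h1 : 57 / 100 ≤ q) (h2 : q ≤ 1) :
    (-(0.34655 + (1 - q ^ 2) / (1 + 3 * q ^ 2)) + 1 / q + (1 + q) / (1 + q ^ 2)) ^ 2
      + (1 / (q * (1 + q ^ 2)) - 1 / q ^ 2 + (1 - 2 * q - q ^ 2) / (1 + q ^ 2) ^ 2)
      ≤ 4.8085 - 3.05 * q := by
  obtain ⟨s, hs, rfl⟩ := exists_eq_moebius h1 (by linarith : q < 101 / 100)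
  rw [← sub_nonneg]
  field_simp
  ring_nf
  positivity

lemma rational_sum_bound_right {q : ℝ} (h1 : 57 / 100 ≤ q) (h2 : q ≤ 1) :
    (q ^ 2 + q * (1 - q) ^ 2) * (1 + (1 - q) * q ^ 2 / 2) * (4.8085 - 3.05 * q)
      + (2 * q / ((1 + q) * (1 + 2 * q))) ^ 2 + (1 - q) / (q * (1 + q) ^ 2) < 2 := by
  obtain ⟨s, hs, rfl⟩ := exists_eq_moebius h1 (by linarith : q < 101 / 100)
  rw [← sub_pos]
  field_simp
  ring_nf
  positivity

/-- The derivative of `logFst`. -/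
def logFst' (q : ℝ) : ℝ :=
  Real.log q - Real.log (1 + q ^ 2) / 2 + 1 / q + (1 + q) / (1 + q ^ 2)

/-- The second derivative of `logFst`. -/
def logFst'' (q : ℝ) : ℝ :=
  1 / (q * (1 + q ^ 2)) - 1 / q ^ 2 + (1 - 2 * q - q ^ 2) / (1 + q ^ 2) ^ 2

/-- The derivative of `logSnd`. -/
def logSnd' (q : ℝ) : ℝ := Real.log q - Real.log (1 + q) + 2 / (1 + q)

/-- The second derivative of `logSnd`. -/
def logSnd'' (q : ℝ) : ℝ := (1 - q) / (q * (1 + q) ^ 2)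

lemma hasDerivAt_log_one_add_sq {q : ℝ} :
    HasDerivAt (fun q : ℝ => Real.log (1 + q ^ 2)) (2 * q / (1 + q ^ 2)) q := by
  have h : HasDerivAt (fun q : ℝ => 1 + q ^ 2) (2 * q) q := by
    simpa using (hasDerivAt_pow 2 q).const_add 1
  exact h.log (by positivity)

lemma hasDerivAt_log_one_add {q : ℝ} (hq : 0 < q) :
    HasDerivAt (fun q : ℝ => Real.log (1 + q)) (1 / (1 + q)) q :=
  ((hasDerivAt_id q).const_add 1).log (by simp only [id]; positivity)

lemma hasDerivAt_logFst {q : ℝ} (hq : 0 < q) : HasDerivAt logFst (logFst' q) q := by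
  have h1 := ((hasDerivAt_id q).const_add 1).mul (Real.hasDerivAt_log hq.ne')
  have h2 := (((hasDerivAt_id q).const_sub 1).div_const 2).mul (hasDerivAt_log_one_add_sq (q := q))
  refine (h1.add h2).congr_deriv ?_
  simp only [id, logFst']
  field_simp
  ring

lemma hasDerivAt_logFst' {q : ℝ} (hq : 0 < q) : HasDerivAt logFst' (logFst'' q) q := by
  have h : HasDerivAt (fun q : ℝ => 1 + q ^ 2) (2 * q) q := by
    simpa using (hasDerivAt_pow 2 q).const_add 1
  have h1 := (Real.hasDerivAt_log hq.ne').sub ((hasDerivAt_log_one_add_sq (q := q)).div_const 2)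
  have h2 := (hasDerivAt_const q (1 : ℝ)).div (hasDerivAt_id q) hq.ne'
  have h3 := ((hasDerivAt_id q).const_add 1).div h (by positivity : 1 + q ^ 2 ≠ 0)
  refine ((h1.add h2).add h3).congr_deriv ?_
  simp only [id, logFst'']
  field_simp
  ring

lemma hasDerivAt_logSnd {q : ℝ} (hq : 0 < q) : HasDerivAt logSnd (logSnd' q) q := by
  have h1 := (hasDerivAt_id q).mul (Real.hasDerivAt_log hq.ne')
  have h2 := ((hasDerivAt_id q).const_sub 1).mul (hasDerivAt_log_one_add hq)
  refine (h1.add h2).congr_deriv ?_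
  simp only [id, logSnd']
  field_simp
  ring

lemma hasDerivAt_logSnd' {q : ℝ} (hq : 0 < q) : HasDerivAt logSnd' (logSnd'' q) q := by
  have h1 := (Real.hasDerivAt_log hq.ne').sub (hasDerivAt_log_one_add hq)
  have h2 := (hasDerivAt_const q (2 : ℝ)).div ((hasDerivAt_id q).const_add 1)
    (by simp only [id]; positivity)
  refine (h1.add h2).congr_deriv ?_
  simp only [id, logSnd'']
  field_simp
  ring

/-- The derivative of `signFun`. -/
def signFun' (q : ℝ) : ℝ :=
  Real.exp (logFst q) * logFst' q + Real.exp (logSnd q) * logSnd' q - 2 * q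

lemma hasDerivAt_signFun {q : ℝ} (hq : 0 < q) : HasDerivAt signFun (signFun' q) q := by
  have h : HasDerivAt (fun q : ℝ => 1 + q ^ 2) (2 * q) q := by
    simpa using (hasDerivAt_pow 2 q).const_add 1
  exact ((hasDerivAt_logFst hq).exp.add (hasDerivAt_logSnd hq).exp).sub h

lemma hasDerivAt_signFun' {q : ℝ} (hq : 0 < q) :
    HasDerivAt signFun' (Real.exp (logFst q) * (logFst' q ^ 2 + logFst'' q)
      + Real.exp (logSnd q) * (logSnd' q ^ 2 + logSnd'' q) - 2) q := by
  have h := ((hasDerivAt_logFst hq).exp.mul (hasDerivAt_logFst' hq)).add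
    ((hasDerivAt_logSnd hq).exp.mul (hasDerivAt_logSnd' hq))
  refine (h.sub ((hasDerivAt_id q).const_mul 2)).congr_deriv ?_
  ring

/-- Writing `q^{1+q} = q² (1/q)^{1-q}` leaves exponents in `[0, 1]`, to which Bernoulli's inequality
applies. -/
lemma exp_logFst_le {q : ℝ} (hq : 0 < q) (hq1 : q ≤ 1) :
    Real.exp (logFst q) ≤ (q ^ 2 + q * (1 - q) ^ 2) * (1 + (1 - q) * q ^ 2 / 2) := by
  have h1 : (1 + q ^ 2) ^ ((1 - q) / 2) ≤ 1 + (1 - q) / 2 * q ^ 2 :=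
    rpow_one_add_le_one_add_mul_self (by nlinarith) (by linarith) (by linarith)
  have h2 : (1 / q) ^ (1 - q) ≤ 1 + (1 - q) * (1 / q - 1) := by
    have := rpow_one_add_le_one_add_mul_self (s := 1 / q - 1) (p := 1 - q)
      (by have : 0 < 1 / q := by positivity
          linarith) (by linarith) (by linarith)
    simpa using this
  have h3 : q ^ (1 + q) = q ^ 2 * (1 / q) ^ (1 - q) := by
    rw [one_div, Real.inv_rpow hq.le, ← Real.rpow_neg hq.le, ← Real.rpow_two, ← Real.rpow_add hq]
    ring_nf
  have h4 : q ^ (1 + q) ≤ q ^ 2 + q * (1 - q) ^ 2 := by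
    rw [h3]
    calc q ^ 2 * (1 / q) ^ (1 - q) ≤ q ^ 2 * (1 + (1 - q) * (1 / q - 1)) := by gcongr
      _ = _ := by field_simp
  rw [exp_logFst hq]
  calc q ^ (1 + q) * (1 + q ^ 2) ^ ((1 - q) / 2)
      ≤ (q ^ 2 + q * (1 - q) ^ 2) * (1 + (1 - q) / 2 * q ^ 2) := by gcongr
    _ = _ := by ring

/-- Weighted AM-GM: `q^q (1+q)^{1-q} ≤ q · q + (1-q)(1+q) = 1`. -/
lemma exp_logSnd_le_one {q : ℝ} (hq : 0 < q) (hq1 : q ≤ 1) : Real.exp (logSnd q) ≤ 1 := by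
  rw [exp_logSnd hq]
  have := Real.geom_mean_le_arith_mean2_weighted hq.le (by linarith : 0 ≤ 1 - q) hq.le
    (by linarith : 0 ≤ 1 + q) (by ring)
  linarith [this]

/-- The logarithm is `-log (1 + 1/q)`. The upper bound comes from `2x/(x+2) ≤ log (1+x)`, which
produces the stated fraction exactly; the lower one from comparing with `log 2` at `q = 1`. -/
lemma abs_logSnd'_le {q : ℝ} (hq : 2 / 5 ≤ q) (hq1 : q ≤ 1) :
    |logSnd' q| ≤ 2 * q / ((1 + q) * (1 + 2 * q)) := by
  have hq0 : 0 < q := by linarith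
  have h1 : Real.log q - Real.log (1 + q) = -Real.log (1 + 1 / q) := by
    rw [← Real.log_div hq0.ne' (by positivity), ← Real.log_inv]
    congr 1
    field_simp
    ring
  have h2 := Real.le_log_one_add_of_nonneg (x := 1 / q) (by positivity)
  have h3 : Real.log (1 + 1 / q) ≤ 0.6932 + (1 - q) / (2 * q) := by
    have h4 : 1 + 1 / q = 2 * ((1 + q) / (2 * q)) := by field_simp; ring
    rw [h4, Real.log_mul (by norm_num) (by positivity)]
    have h5 := Real.log_le_sub_one_of_pos (by positivity : 0 < (1 + q) / (2 * q))
    have h6 := Real.log_two_lt_d9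
    have h7 : (1 + q) / (2 * q) - 1 = (1 - q) / (2 * q) := by field_simp; ring
    linarith
  rw [logSnd', h1, abs_le]
  constructor
  · have h8 : 0.6932 + (1 - q) / (2 * q) ≤ 2 / (1 + q) + 2 * q / ((1 + q) * (1 + 2 * q)) := by
      obtain ⟨s, hs, rfl⟩ := exists_eq_moebius hq (by linarith : q < 101 / 100)
      rw [← sub_nonneg]
      field_simp
      ring_nf
      positivity
    linarith
  · have h8 : 2 * (1 / q) / (1 / q + 2) = 2 / (1 + q) - 2 * q / ((1 + q) * (1 + 2 * q)) := by
      field_simp; ring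
    linarith

lemma log_sub_half_log {q : ℝ} (hq : 0 < q) :
    Real.log q - Real.log (1 + q ^ 2) / 2 = -(Real.log (1 + 1 / q ^ 2) / 2) := by
  have h : 1 + 1 / q ^ 2 = (1 + q ^ 2) / q ^ 2 := by field_simp; ring
  rw [h, Real.log_div (by positivity) (by positivity), Real.log_pow]
  push_cast
  ring

/-- Needed so that upper bounds for `logFst'` can be squared. -/
lemma logFst'_nonneg {q : ℝ} (hq : 2 / 5 ≤ q) : 0 ≤ logFst' q := by
  have hq0 : 0 < q := by linarith
  rw [logFst', log_sub_half_log hq0]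
  have h1 := Real.log_le_sub_one_of_pos (by positivity : 0 < 1 + 1 / q ^ 2)
  have h2 : 1 / q ^ 2 / 2 ≤ 1 / q + (1 + q) / (1 + q ^ 2) := by
    obtain ⟨s, hs, rfl⟩ : ∃ s : ℝ, 0 ≤ s ∧ q = 2 / 5 + s := ⟨q - 2 / 5, by linarith, by ring⟩
    rw [← sub_nonneg]
    field_simp
    ring_nf
    positivity
  linarith

/-- The logarithm of `1 + 1/q²` is compared with `log 4`, its value at `q² = 1/3`; the remainder
`log (1 + z)`, `z ≥ 0`, is bounded below by `2z/(z+2)`. In `logFst'_le_right` the reference value is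
`log 2`, at `q = 1`. -/
lemma logFst'_le_left {q : ℝ} (hq : 2 / 5 ≤ q) (hq1 : 3 * q ^ 2 ≤ 1) :
    logFst' q ≤ -(0.6931 + (1 - 3 * q ^ 2) / (1 + 5 * q ^ 2)) + 1 / q + (1 + q) / (1 + q ^ 2) := by
  have hq0 : 0 < q := by linarith
  rw [logFst', log_sub_half_log hq0]
  have h3 : 1 + 1 / q ^ 2 = 2 ^ 2 * (1 + (1 - 3 * q ^ 2) / (4 * q ^ 2)) := by field_simp; ring
  have h0 : 0 ≤ (1 - 3 * q ^ 2) / (4 * q ^ 2) := div_nonneg (by linarith) (by positivity)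
  have h2 := Real.le_log_one_add_of_nonneg h0
  rw [h3, Real.log_mul (by positivity) (by positivity), Real.log_pow]
  have h6 := Real.log_two_gt_d9
  have h7 : 2 * ((1 - 3 * q ^ 2) / (4 * q ^ 2)) / ((1 - 3 * q ^ 2) / (4 * q ^ 2) + 2)
      = 2 * ((1 - 3 * q ^ 2) / (1 + 5 * q ^ 2)) := by
    have h8 : (1 - 3 * q ^ 2) / (4 * q ^ 2) + 2 = (1 + 5 * q ^ 2) / (4 * q ^ 2) := by
      field_simp; ring
    rw [h8]
    field_simp
  rw [h7] at h2
  push_cast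
  linarith

lemma logFst'_le_right {q : ℝ} (hq : 0 < q) (hq1 : q ≤ 1) :
    logFst' q ≤ -(0.34655 + (1 - q ^ 2) / (1 + 3 * q ^ 2)) + 1 / q + (1 + q) / (1 + q ^ 2) := by
  rw [logFst', log_sub_half_log hq]
  have h3 : 1 + 1 / q ^ 2 = 2 * (1 + (1 - q ^ 2) / (2 * q ^ 2)) := by field_simp; ring
  have h0 : 0 ≤ (1 - q ^ 2) / (2 * q ^ 2) := div_nonneg (by nlinarith) (by positivity)
  have h2 := Real.le_log_one_add_of_nonneg h0
  rw [h3, Real.log_mul (by positivity) (by positivity)]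
  have h6 := Real.log_two_gt_d9
  have h7 : 2 * ((1 - q ^ 2) / (2 * q ^ 2)) / ((1 - q ^ 2) / (2 * q ^ 2) + 2)
      = 2 * ((1 - q ^ 2) / (1 + 3 * q ^ 2)) := by
    have h8 : (1 - q ^ 2) / (2 * q ^ 2) + 2 = (1 + 3 * q ^ 2) / (2 * q ^ 2) := by
      field_simp; ring
    rw [h8]
    field_simp
  rw [h7] at h2
  linarith

lemma signFun_second_deriv_neg {q : ℝ} (hq : 2 / 5 ≤ q) (hq1 : q ≤ 1) :
    Real.exp (logFst q) * (logFst' q ^ 2 + logFst'' q)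
      + Real.exp (logSnd q) * (logSnd' q ^ 2 + logSnd'' q) - 2 < 0 := by
  have hq0 : 0 < q := by linarith
  have h1 := exp_logFst_le hq0 hq1
  have h2 := exp_logSnd_le_one hq0 hq1
  have h3 := abs_logSnd'_le hq hq1
  have h4 : logSnd' q ^ 2 ≤ (2 * q / ((1 + q) * (1 + 2 * q))) ^ 2 := by
    rw [← sq_abs]; gcongr
  have h5 : 0 ≤ logSnd'' q := div_nonneg (by linarith) (by positivity)
  have h6 : Real.exp (logSnd q) * (logSnd' q ^ 2 + logSnd'' q) ≤
      (2 * q / ((1 + q) * (1 + 2 * q))) ^ 2 + (1 - q) / (q * (1 + q) ^ 2) := by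
    calc _ ≤ 1 * (logSnd' q ^ 2 + logSnd'' q) := by gcongr
      _ ≤ _ := by rw [one_mul]; exact add_le_add h4 le_rfl
  have h7 := logFst'_nonneg hq
  -- The bracket has no known sign, so it is replaced by `z ≥ 0` before the exponential is
  -- estimated.
  have h8 : ∀ z : ℝ, 0 ≤ z → logFst' q ^ 2 + logFst'' q ≤ z →
      Real.exp (logFst q) * (logFst' q ^ 2 + logFst'' q) ≤
        (q ^ 2 + q * (1 - q) ^ 2) * (1 + (1 - q) * q ^ 2 / 2) * z := by
    intro z hz h
    exact (mul_le_mul_of_nonneg_left h (Real.exp_pos _).le).trans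
      (mul_le_mul_of_nonneg_right h1 hz)
  rcases le_total (3 * q ^ 2) 1 with h | h
  · have hq2 : q ≤ 29 / 50 := by nlinarith
    have h9 := logFst'_le_left hq h
    have h10 : logFst' q ^ 2 + logFst'' q ≤ 4.078 - 1.7 * q := by
      refine le_trans ?_ (rational_bound_left hq hq2)
      unfold logFst''
      gcongr
    have := h8 _ (by linarith) h10
    linarith [rational_sum_bound_left hq hq2]
  · have hq2 : 57 / 100 ≤ q := by nlinarith
    have h9 := logFst'_le_right hq0 hq1
    have h10 : logFst' q ^ 2 + logFst'' q ≤ 4.8085 - 3.05 * q := by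
      refine le_trans ?_ (rational_bound_right hq2 hq1)
      unfold logFst''
      gcongr
    have := h8 _ (by linarith) h10
    linarith [rational_sum_bound_right hq2 hq1]

lemma strictConcaveOn_signFun : StrictConcaveOn ℝ (Icc (2 / 5) 1) signFun := by
  refine StrictAntiOn.strictConcaveOn_of_deriv (convex_Icc _ _) (fun q hq => ?_) ?_
  · exact (hasDerivAt_signFun (by linarith [hq.1])).continuousAt.continuousWithinAt
  · rw [interior_Icc]
    have h1 : StrictAntiOn signFun' (Ioo (2 / 5) 1) := by
      refine strictAntiOn_of_deriv_neg (convex_Ioo _ _) (fun q hq => ?_) (fun q hq => ?_)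
      · exact (hasDerivAt_signFun' (by linarith [hq.1])).continuousAt.continuousWithinAt
      · rw [interior_Ioo] at hq
        rw [(hasDerivAt_signFun' (by linarith [hq.1])).deriv]
        exact signFun_second_deriv_neg hq.1.le hq.2.le
    intro x hx y hy hxy
    have hx0 : 0 < x := lt_trans (by norm_num) hx.1
    rw [(hasDerivAt_signFun hx0).deriv, (hasDerivAt_signFun (hx0.trans hxy)).deriv]
    exact h1 hx hy hxy

lemma signFun_one : signFun 1 = 0 := by
  simp [signFun, logFst, logSnd]

lemma signFun'_one_neg : signFun' 1 < 0 := by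
  have h := Real.log_two_gt_d9
  simp [signFun', logFst, logSnd, logFst', logSnd']
  norm_num
  linarith

/-- `signFun` changes sign exactly once on `(0, 1)`. -/
lemma exists_signFun_root : ∃ q₀ ∈ Ioo (2 / 5 : ℝ) 1, signFun q₀ = 0 ∧
    (∀ q, 0 < q → q < q₀ → signFun q < 0) ∧ ∀ q, q₀ < q → q < 1 → 0 < signFun q := by
  have hc : ContinuousOn signFun (Icc (2 / 5) 1) := fun q hq =>
    (hasDerivAt_signFun (by linarith [hq.1])).continuousAt.continuousWithinAt
  -- As `signFun 1 = 0` with negative derivative, `signFun` is positive just to the left of `1`.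
  obtain ⟨r, hr, hr1, hr0⟩ : ∃ r, 2 / 5 < r ∧ r < 1 ∧ 0 < signFun r := by
    have h1 := hasDerivAt_iff_tendsto_slope.1 (hasDerivAt_signFun one_pos)
    have h2 := h1.mono_left (nhdsWithin_mono 1 (fun x (hx : x ∈ Iio 1) => ne_of_lt hx))
    have h3 := h2.eventually_lt_const signFun'_one_neg
    have h4 : ∀ᶠ x in 𝓝[<] (1 : ℝ), x ∈ Ioo (2 / 5 : ℝ) 1 := Ioo_mem_nhdsLT (by norm_num)
    obtain ⟨r, h5, h6⟩ := (h3.and h4).exists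
    refine ⟨r, h6.1, h6.2, ?_⟩
    rw [slope_def_field, signFun_one] at h5
    by_contra! h7
    exact absurd h5 (not_lt.2 (div_nonneg_of_nonpos (by linarith) (by linarith [h6.2])))
  obtain ⟨q₀, hq₀, h0⟩ : (0 : ℝ) ∈ signFun '' Icc (2 / 5) r :=
    intermediate_value_Icc hr.le (hc.mono (Icc_subset_Icc_right hr1.le))
      ⟨(signFun_neg (by norm_num) le_rfl).le, hr0.le⟩
  have h25 : signFun (2 / 5) < 0 := signFun_neg (by norm_num) le_rfl
  have hq₁ : 2 / 5 < q₀ := lt_of_le_of_ne hq₀.1 (by rintro rfl; exact h25.ne h0)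
  have hq₂ : q₀ < 1 := by linarith [hq₀.2]
  have hcc := strictConcaveOn_signFun
  refine ⟨q₀, ⟨hq₁, hq₂⟩, h0, fun q h1 h2 => ?_, fun q h1 h2 => ?_⟩
  · rcases le_or_gt q (2 / 5) with h3 | h3
    · exact signFun_neg h1 h3
    · by_contra! h4
      -- If `signFun q ≥ 0`, strict concavity between `q` and `1` would make `signFun q₀` positive.
      have := hcc.lt_on_openSegment (x := q) (y := 1) ⟨h3.le, by linarith⟩ ⟨by norm_num, le_rfl⟩
        (by linarith) (z := q₀) (by rw [openSegment_eq_Ioo (by linarith)]; exact ⟨h2, hq₂⟩)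
      rw [signFun_one, h0] at this
      exact absurd this (not_lt.2 (le_min h4 le_rfl))
  · have := hcc.lt_on_openSegment (x := q₀) (y := 1) ⟨hq₁.le, hq₂.le⟩ ⟨by norm_num, le_rfl⟩
      hq₂.ne (z := q) (by rw [openSegment_eq_Ioo hq₂]; exact ⟨h1, h2⟩)
    rwa [signFun_one, h0, min_self] at this

/-! ### The constants -/

/-- The point `-1 + 2/p` in the definitions of the constants thus corresponds to the ratio `T =
1/(p-1)`. -/
lemma auxG_eq {p : ℝ} (hp : 1 < p) : auxG (-1 + 2 / p) = 1 / (p - 1) := by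
  have h1 : p - 1 ≠ 0 := by linarith
  have h2 : 1 - (-1 + 2 / p) ≠ 0 := by
    have : 1 - (-1 + 2 / p) = 2 * (p - 1) / p := by field_simp; ring
    rw [this]
    exact div_ne_zero (by positivity) (by linarith)
  rw [auxG, div_eq_div_iff h2 h1]
  field_simp
  ring

lemma signFun_sub_one {p : ℝ} (hp : 1 < p) :
    signFun (p - 1) = (p - 1) * auxU p (1 / (p - 1)) := by
  rw [signFun_eq (by linarith), add_sub_cancel]

lemma pZero_spec : pZero ∈ Ioo (1 : ℝ) 2 ∧
    (∀ p, 1 < p → p ≤ pZero → auxU p (1 / (p - 1)) ≤ 0) ∧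
    ∀ p, pZero < p → p < 2 → 0 < auxU p (1 / (p - 1)) := by
  obtain ⟨q₀, hq₀, h0, hneg, hpos⟩ := exists_signFun_root
  have hq0 : 0 < q₀ := lt_trans (by norm_num) hq₀.1
  -- The root is unique, so the infimum defining `pZero` is that root.
  have hset : {p : ℝ | p ∈ Ioo (1 : ℝ) 2 ∧ auxU p (auxG (-1 + 2 / p)) = 0} = {1 + q₀} := by
    ext p
    simp only [mem_ofPred_eq, mem_singleton_iff]
    constructor
    · rintro ⟨⟨h1, h2⟩, h3⟩
      rw [auxG_eq h1] at h3
      have h4 := signFun_sub_one h1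
      rw [h3, mul_zero] at h4
      rcases lt_trichotomy (p - 1) q₀ with h | h | h
      · exact absurd h4 (hneg _ (by linarith) h).ne
      · linarith
      · exact absurd h4 (hpos _ h (by linarith)).ne'
    · rintro rfl
      have h1 : 1 < 1 + q₀ := by linarith
      refine ⟨⟨h1, by linarith [hq₀.2]⟩, ?_⟩
      have h4 := signFun_sub_one h1
      rw [add_sub_cancel_left, h0] at h4
      rw [auxG_eq h1, add_sub_cancel_left]
      exact (mul_eq_zero.1 h4.symm).resolve_left hq0.ne'
  have hp0 : pZero = 1 + q₀ := by rw [pZero, hset, csInf_singleton]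
  rw [hp0]
  refine ⟨⟨by linarith, by linarith [hq₀.2]⟩, fun p h1 h2 => ?_, fun p h1 h2 => ?_⟩
  · have h4 := signFun_sub_one h1
    by_contra! h5
    have h6 := mul_pos (by linarith : 0 < p - 1) h5
    rcases h2.eq_or_lt with rfl | h
    · rw [add_sub_cancel_left] at *
      linarith
    · linarith [hneg (p - 1) (by linarith) (by linarith)]
  · have h3 : 1 < p := by linarith
    have h4 := signFun_sub_one h3
    have h5 := hpos (p - 1) (by linarith) (by linarith)
    rw [h4] at h5
    exact pos_of_mul_pos_right h5 (by linarith)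

lemma continuousAt_auxU {p t : ℝ} (ht : 0 < 1 + t) : ContinuousAt (auxU p) t := by
  have h1 : ContinuousAt (fun t : ℝ => (1 + t ^ 2) ^ ((2 - p) / 2)) t :=
    ContinuousAt.rpow_const (by fun_prop) (Or.inl (by positivity))
  have h2 : ContinuousAt (fun t : ℝ => (1 + t) ^ (2 - p)) t :=
    ContinuousAt.rpow_const (by fun_prop) (Or.inl ht.ne')
  unfold auxU
  fun_prop

/-- With `x = 1 + t`, the two powers contribute at most `p x^{2-p}`, which is beaten by the linear
term; the threshold `2p/(2-p)` for `x^{p-1}` makes it at most half of `(2-p) x`. -/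
lemma exists_auxU_neg {p T : ℝ} (hp1 : 1 < p) (hp : p < 2) : ∃ t, T < t ∧ 0 < t ∧ auxU p t < 0 := by
  have h1 := (tendsto_rpow_atTop (by linarith : 0 < p - 1)).eventually_ge_atTop (2 * p / (2 - p))
  obtain ⟨x, hx1, hx2, hx3⟩ := (h1.and ((eventually_gt_atTop (1 + T)).and
    (eventually_gt_atTop 1))).exists
  refine ⟨x - 1, by linarith, by linarith, ?_⟩
  have hx0 : 0 < x := by linarith
  have h2 : (1 + (x - 1) ^ 2) ^ ((2 - p) / 2) ≤ x ^ (2 - p) := by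
    rw [← sq_rpow_half hx0.le]
    refine Real.rpow_le_rpow (by positivity) ?_ (by linarith)
    nlinarith
  have h3 : x ^ (2 - p) * x ^ (p - 1) = x := by
    rw [← Real.rpow_add hx0]; ring_nf; rw [Real.rpow_one]
  have h4 : x ^ (2 - p) * (2 * p / (2 - p)) ≤ x := by
    calc _ ≤ x ^ (2 - p) * x ^ (p - 1) := by gcongr
      _ = x := h3
  rw [← mul_div_assoc, div_le_iff₀ (by linarith)] at h4
  have h5 : (p - 1) * (1 + (x - 1) ^ 2) ^ ((2 - p) / 2) ≤ (p - 1) * x ^ (2 - p) :=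
    mul_le_mul_of_nonneg_left h2 (by linarith)
  rw [auxU, add_sub_cancel]
  nlinarith

lemma sZero_spec {p : ℝ} (h0 : pZero < p) (hp : p < 2) :
    sZero p < 1 ∧ 1 ≤ auxG (sZero p) ∧ auxU p (auxG (sZero p)) = 0 := by
  have hp1 : 1 < p := pZero_spec.1.1.trans h0
  have hpos := pZero_spec.2.2 p h0 hp
  set T := 1 / (p - 1) with hT
  have hT1 : 1 ≤ T := by rw [hT, le_div_iff₀ (by linarith)]; linarith
  obtain ⟨t, hTt, ht0, htneg⟩ := exists_auxU_neg (T := T) hp1 hp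
  have hc : ContinuousOn (auxU p) (Icc T t) := fun x hx =>
    (continuousAt_auxU (by linarith [hx.1])).continuousWithinAt
  obtain ⟨x, hx, hx0⟩ := intermediate_value_Icc' hTt.le hc ⟨htneg.le, hpos.le⟩
  have hxT : T < x := lt_of_le_of_ne hx.1 (by rintro h; rw [h, hx0] at hpos; exact lt_irrefl _ hpos)
  set S : Set ℝ := {s : ℝ | s ∈ Ioo (-1 + 2 / p) 1 ∧ auxU p (auxG s) = 0} with hS
  have hlo : 0 < -1 + 2 / p := by
    have : 1 < 2 / p := by rw [lt_div_iff₀ (by linarith)]; linarith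
    linarith
  -- The preimage of `x` under `g`; the intermediate value theorem has supplied `x`.
  have hmem : (x - 1) / (x + 1) ∈ S := by
    have hg : auxG ((x - 1) / (x + 1)) = x := by
      have : x + 1 ≠ 0 := by linarith
      have h2 : 1 - (x - 1) / (x + 1) = 2 / (x + 1) := by field_simp; ring
      rw [auxG, h2]
      field_simp
      ring
    refine ⟨⟨?_, ?_⟩, by rw [hg, hx0]⟩
    · have h3 : 1 < x * (p - 1) := by rwa [hT, div_lt_iff₀ (by linarith)] at hxT
      rw [lt_div_iff₀ (by linarith)]
      have h4 : (2 / p) * (x + 1) < 2 * x := by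
        rw [div_mul_eq_mul_div, div_lt_iff₀ (by linarith)]
        nlinarith
      linarith
    · rw [div_lt_one (by linarith)]; linarith
  have hbdd : BddBelow S := ⟨-1 + 2 / p, fun s hs => hs.1.1.le⟩
  have hs1 : sInf S < 1 := (csInf_le hbdd hmem).trans_lt hmem.1.2
  have hs2 : -1 + 2 / p ≤ sInf S := le_csInf ⟨_, hmem⟩ fun s hs => hs.1.1.le
  have hs0 : 0 < sInf S := hlo.trans_le hs2
  have hg1 : 1 ≤ auxG (sInf S) := by
    rw [auxG, le_div_iff₀ (by linarith)]; linarith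
  have hsz : sZero p = sInf S := rfl
  rw [hsz]
  refine ⟨hs1, hg1, ?_⟩
  have hcg : ContinuousAt auxG (sInf S) := by
    unfold auxG
    exact ContinuousAt.div (by fun_prop) (by fun_prop) (by linarith)
  -- Uniqueness of the root is not needed: the infimum is a limit of roots, hence by continuity a
  -- root.
  have hcomp : ContinuousAt (fun s => auxU p (auxG s)) (sInf S) :=
    ContinuousAt.comp (g := auxU p) (continuousAt_auxU (by linarith)) hcg
  have hmaps : MapsTo (fun s => auxU p (auxG s)) S {0} := fun s hs => hs.2
  have := hcomp.continuousWithinAt.mem_closure (csInf_mem_closure ⟨_, hmem⟩ hbdd) hmaps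
  simpa using this

lemma cKorn_of_two_le {p : ℝ} (hp : 2 ≤ p ∨ p ≤ pZero) :
    cKorn p = √(1 + (pStar p - 1) ^ 2) := if_pos hp

lemma sqrt_rpow_eq {x p : ℝ} (hx : 0 ≤ x) : √x ^ p = x ^ (p / 2) := by
  rw [Real.sqrt_eq_rpow, ← Real.rpow_mul hx]
  ring_nf

/-- With `t = g(s₀)` one has `1 - s₀ = 2/(1+t)`. The equation `u_p(t) = 0`, written as `(p-1) w + v
= p + t (2-p)`, reduces the base in `c(p)` to `(p-1) w / ((p-1) w + v)`, whose inverse is `1 + v /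
((p-1) w)`. -/
lemma cKorn_of_lt_two {p : ℝ} (h0 : pZero < p) (hp : p < 2) : 0 ≤ cKorn p ∧
    cKorn p ^ p = 1 + tangentSlope p (auxG (sZero p)) * (1 / (p - 1)) := by
  have hp1 : 1 < p := pZero_spec.1.1.trans h0
  obtain ⟨h1, h2, h3⟩ := sZero_spec h0 hp
  set s := sZero p with hs
  set t := auxG s with ht
  have hs1 : 0 < 1 - s := by linarith
  have h1t : 1 + t = 2 / (1 - s) := by rw [ht, auxG]; field_simp; ring
  have hs2 : 1 - s = 2 / (1 + t) := by rw [h1t]; field_simp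
  have hc : cKorn p = (1 - 2 ^ (1 - p) * (1 - s) ^ (p - 1) / ((p - 1) * (1 - s) + (2 - p)))
      ^ (-1 / p) := if_neg (by push Not; exact ⟨hp, h0⟩)
  have ht0 : 0 < 1 + t := by linarith
  set v := (1 + t) ^ (2 - p) with hv
  set w := (1 + t ^ 2) ^ ((2 - p) / 2) with hw
  have hv0 : 0 < v := by positivity
  have hw0 : 0 < w := by positivity
  have hu : (p - 1) * w + v = p + t * (2 - p) := by
    have := h3
    rw [auxU] at this
    linarith
  have hden : 0 < (p - 1) * w + v := by
    have := mul_pos (by linarith : 0 < p - 1) hw0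
    linarith
  have e1 : (2 : ℝ) ^ (1 - p) * (1 - s) ^ (p - 1) = v / (1 + t) := by
    rw [hs2, Real.div_rpow (by norm_num) ht0.le, hv, ← mul_div_assoc,
      ← Real.rpow_add (by norm_num), div_eq_div_iff (by positivity) (by positivity),
      ← Real.rpow_add ht0]
    ring_nf
    rw [Real.rpow_zero, Real.rpow_one]
    ring
  have e2 : 1 - 2 ^ (1 - p) * (1 - s) ^ (p - 1) / ((p - 1) * (1 - s) + (2 - p))
      = (p - 1) * w / ((p - 1) * w + v) := by
    rw [e1, hs2]
    have e3 : (p - 1) * (2 / (1 + t)) + (2 - p) = ((p - 1) * w + v) / (1 + t) := by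
      rw [hu]; field_simp; ring
    rw [e3]
    field_simp
    ring
  have hβ : 0 < (p - 1) * w / ((p - 1) * w + v) :=
    div_pos (mul_pos (by linarith) hw0) hden
  rw [hc, e2]
  refine ⟨by positivity, ?_⟩
  rw [← Real.rpow_mul hβ.le, div_mul_cancel₀ _ (by linarith : p ≠ 0), Real.rpow_neg_one, inv_div]
  have e4 := tangentSlope_mul (p := p) (t := t) (by linarith)
  rw [← hw, ← hv] at e4
  rw [← e4]
  have : p - 1 ≠ 0 := by linarith
  field_simp

/-- `(X^2 + Y^2)^{p/2} - c(p)^p X^p` is dominated by a multiple of Burkholder's function. -/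
lemma exists_norm_majorant {p T : ℝ} (hp : 1 < p) (hT : T = pStar p - 1) :
    0 ≤ cKorn p ∧ ∃ α : ℝ, 0 ≤ α ∧ ∀ X Y : ℝ, 0 ≤ X → 0 ≤ Y →
      (X ^ 2 + Y ^ 2) ^ (p / 2) - cKorn p ^ p * X ^ p ≤ α * burk p T X Y := by
  have hT1 : 1 ≤ T := hT ▸ one_le_pStar_sub_one hp
  have hT0 : 0 < T := by linarith
  rcases le_or_gt 2 p with h2 | h2
  · rw [cKorn_of_two_le (Or.inl h2), sqrt_rpow_eq (by positivity), ← hT]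
    refine ⟨by positivity, ?_⟩
    obtain ⟨α, hα, h⟩ := exists_majorant hp hT
    refine ⟨(1 + T ^ 2) ^ (p / 2) * (T ^ 2 / (1 + T ^ 2)) / T ^ p * α, by positivity,
      fun X Y hX hY => (norm_rpow_le_of_two_le h2 hT0 hX hY).trans ?_⟩
    rw [mul_assoc]
    exact mul_le_mul_of_nonneg_left (h X Y hX hY) (by positivity)
  · have hTp : T = 1 / (p - 1) := by rw [hT, pStar_sub_one_of_lt_two hp h2]
    have hTp' : (p - 1) * T = 1 := by
      rw [hTp]; field_simp [show p - 1 ≠ 0 by linarith]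
    rcases le_or_gt p pZero with h3 | h3
    · rw [cKorn_of_two_le (Or.inr h3), sqrt_rpow_eq (by positivity), ← hT]
      refine ⟨by positivity, tangentSlope p T, (tangentSlope_pos hT0.le).le, fun X Y hX hY => ?_⟩
      exact norm_rpow_le_of_auxU_nonpos hp h2 hTp' hT1
        (by rw [hTp]; exact pZero_spec.2.1 p hp h3) hX hY
    · obtain ⟨h4, h5⟩ := cKorn_of_lt_two h3 h2
      obtain ⟨-, h6, h7⟩ := sZero_spec h3 h2
      refine ⟨h4, tangentSlope p (auxG (sZero p)), (tangentSlope_pos (by linarith)).le,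
        fun X Y hX hY => ?_⟩
      rw [h5, ← hTp]
      exact norm_rpow_le_of_auxU_eq_zero hp h2 hTp' h6 h7 hX hY

/-! ### Polar coordinates in the unit ball -/

section Polar

variable {d : ℕ}

/-- The surface measure on the unit sphere. -/
abbrev sphMeasure (d : ℕ) : Measure (Metric.sphere (0 : E d) 1) := (volume : Measure (E d)).toSphere

/-- The radial part of Lebesgue measure on the unit ball. -/
def radialMeasure (d : ℕ) : Measure ℝ :=
  (volume.restrict (Ioo (0 : ℝ) 1)).withDensity fun s => ENNReal.ofReal (s ^ (d - 1))

/-- The integral of `f` over the sphere of radius `s`. -/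
def sph (f : E d → ℝ) (s : ℝ) : ℝ :=
  s ^ (d - 1) * ∫ θ : Metric.sphere (0 : E d) 1, f (s • (θ : E d)) ∂(sphMeasure d)

lemma map_val_volumeIoiPow (n : ℕ) :
    (Measure.volumeIoiPow n).map (Subtype.val : Ioi (0 : ℝ) → ℝ) =
      (volume.restrict (Ioi (0 : ℝ))).withDensity fun s => ENNReal.ofReal (s ^ n) := by
  ext t ht
  rw [Measure.map_apply measurable_subtype_coe ht, Measure.volumeIoiPow,
    withDensity_apply _ (measurable_subtype_coe ht), withDensity_apply _ ht,
    setLIntegral_subtype measurableSet_Ioi _ fun a : ℝ => ENNReal.ofReal (a ^ n),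
    Subtype.image_preimage_coe, Measure.restrict_restrict ht, inter_comm]

instance (d : ℕ) : SFinite (radialMeasure d) := by
  unfold radialMeasure; infer_instance

lemma measurableSet_unitBall (d : ℕ) : MeasurableSet (unitBall d) :=
  Metric.isOpen_ball.measurableSet

/-- Polar coordinates live on the complement of the origin and on the subtype of positive radii; the
origin is a null set because `d ≥ 1`, and the radii are pushed forward to the line and cut at `1`.
-/
lemma map_polar [NeZero d] :
    ((radialMeasure d).prod (sphMeasure d)).map
      (fun z : ℝ × Metric.sphere (0 : E d) 1 => z.1 • (z.2 : E d)) =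
      volume.restrict (unitBall d) := by
  have hmeas : Measurable (fun z : ℝ × Metric.sphere (0 : E d) 1 => z.1 • (z.2 : E d)) := by
    fun_prop
  have hmeas' : Measurable (fun z : Metric.sphere (0 : E d) 1 × ℝ => z.2 • (z.1 : E d)) := by
    fun_prop
  set ν : Measure ℝ := (volume.restrict (Ioi (0 : ℝ))).withDensity fun s =>
    ENNReal.ofReal (s ^ (d - 1)) with hν
  have h1 := ((volume : Measure (E d)).measurePreserving_homeomorphUnitSphereProd).symm
    (homeomorphUnitSphereProd (E d)).toMeasurableEquiv
  have h2 : ((sphMeasure d).prod (Measure.volumeIoiPow (d - 1))).map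
      (fun z : Metric.sphere (0 : E d) 1 × Ioi (0 : ℝ) => (z.2 : ℝ) • (z.1 : E d)) =
      (volume : Measure (E d)) := by
    have h3 := h1.map_eq
    have h4 := congrArg (Measure.map (Subtype.val : ({0}ᶜ : Set (E d)) → E d)) h3
    rw [map_comap_subtype_coe (measurableSet_singleton _).compl, Measure.map_map
      measurable_subtype_coe (MeasurableEquiv.measurable _)] at h4
    rw [restrict_compl_singleton] at h4
    rw [finrank_euclideanSpace_fin] at h4
    rw [← h4]
    rfl
  have h5 : ((sphMeasure d).prod ν).map
      (fun z : Metric.sphere (0 : E d) 1 × ℝ => z.2 • (z.1 : E d)) = (volume : Measure (E d)) := by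
    rw [hν, ← map_val_volumeIoiPow, ← h2]
    conv_lhs => rw [← Measure.map_id (μ := sphMeasure d)]
    rw [Measure.map_prod_map _ _ measurable_id measurable_subtype_coe,
      Measure.map_map hmeas' (measurable_id.prodMap measurable_subtype_coe)]
    rfl
  have h6 : (ν.prod (sphMeasure d)).map
      (fun z : ℝ × Metric.sphere (0 : E d) 1 => z.1 • (z.2 : E d)) = (volume : Measure (E d)) := by
    rw [← Measure.prod_swap, Measure.map_map hmeas measurable_swap, ← h5]
    rfl
  have h7 : (radialMeasure d) = ν.restrict (Iio 1) := by
    rw [radialMeasure, hν, restrict_withDensity measurableSet_Iio,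
      Measure.restrict_restrict measurableSet_Iio]
    congr 2
    ext x; simp [and_comm]
  rw [h7, ← Measure.restrict_univ (μ := sphMeasure d), Measure.prod_restrict, ← h6, Measure.restrict_map hmeas (measurableSet_unitBall d)]
  have hs : ∀ᵐ z ∂(ν.prod (sphMeasure d)), 0 < z.1 := by
    have : ∀ᵐ s ∂ν, 0 < s := by
      rw [hν]
      exact (withDensity_absolutelyContinuous _ _) (ae_restrict_mem measurableSet_Ioi)
    exact Measure.quasiMeasurePreserving_fst.ae this
  rw [Measure.restrict_congr_set]
  filter_upwards [hs] with z hz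
  refine propext ?_
  change (z ∈ Iio (1 : ℝ) ×ˢ univ) ↔ z.1 • (z.2 : E d) ∈ Metric.ball (0 : E d) 1
  simp [norm_smul, abs_of_pos hz]

lemma measurable_polar : Measurable
    (fun z : ℝ × Metric.sphere (0 : E d) 1 => z.1 • (z.2 : E d)) := by fun_prop

lemma ae_radialMeasure {P : ℝ → Prop} :
    (∀ᵐ s ∂(radialMeasure d), P s) ↔ ∀ᵐ s ∂(volume.restrict (Ioo (0 : ℝ) 1)), P s := by
  rw [radialMeasure, ae_withDensity_iff (by fun_prop)]
  refine ⟨fun h => ?_, fun h => h.mono fun s hs _ => hs⟩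
  filter_upwards [h, ae_restrict_mem measurableSet_Ioo] with s hs hs1
  refine hs ?_
  have : 0 < s ^ (d - 1) := pow_pos hs1.1 _
  simpa using this

lemma ae_polar [NeZero d] {P : E d → Prop} (h : ∀ᵐ x ∂(volume.restrict (unitBall d)), P x) :
    ∀ᵐ s ∂(volume.restrict (Ioo (0 : ℝ) 1)), ∀ᵐ θ : Metric.sphere (0 : E d) 1 ∂(sphMeasure d),
      P (s • (θ : E d)) := by
  rw [← map_polar] at h
  have h1 := ae_of_ae_map measurable_polar.aemeasurable h
  exact ae_radialMeasure.1 (Measure.ae_ae_of_ae_prod h1)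

lemma ae_of_ae_norm [NeZero d] {P : ℝ → Prop} (h : ∀ᵐ s ∂(volume.restrict (Ioo (0 : ℝ) 1)), P s) :
    ∀ᵐ x ∂(volume.restrict (unitBall d)), P ‖x‖ := by
  have h1 : ∀ᵐ s ∂(radialMeasure d), 0 < s ∧ P s :=
    ae_radialMeasure.2 ((ae_restrict_mem measurableSet_Ioo).mono (fun s hs => hs.1) |>.and h)
  -- `P` need not be measurable, so its exceptional set is replaced by a measurable null superset.
  obtain ⟨t, ht1, ht2, ht3⟩ := exists_measurable_superset_of_null (ae_iff.1 h1)
  have h2 : ∀ᵐ s ∂(radialMeasure d), s ∉ t := by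
    rw [ae_iff]; simpa using ht3
  have h3 : ∀ᵐ x ∂(volume.restrict (unitBall d)), ‖x‖ ∉ t := by
    have h5 : MeasurableSet {x : E d | ‖x‖ ∉ t} := (measurable_norm ht2).compl
    rw [← map_polar, ae_map_iff measurable_polar.aemeasurable h5]
    have h4 : ∀ᵐ z ∂((radialMeasure d).prod (sphMeasure d)), z.1 ∉ t :=
      Measure.quasiMeasurePreserving_fst.ae h2
    filter_upwards [h4] with z hz
    have hz0 : 0 < z.1 := by
      by_contra hcon
      exact hz (ht1 (fun hh => hcon hh.1))
    simpa [norm_smul, abs_of_pos hz0] using hz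
  filter_upwards [h3] with x hx
  by_contra hcon
  exact hx (ht1 (fun hh => hcon hh.2))

lemma integrable_polar [NeZero d] {f : E d → ℝ} (hf : IntegrableOn f (unitBall d)) :
    Integrable (fun z : ℝ × Metric.sphere (0 : E d) 1 => f (z.1 • (z.2 : E d)))
      ((radialMeasure d).prod (sphMeasure d)) := by
  rw [IntegrableOn, ← map_polar] at hf
  exact hf.comp_measurable measurable_polar

lemma toReal_density {s : ℝ} (hs : s ∈ Ioo (0 : ℝ) 1) (y : ℝ) :
    (ENNReal.ofReal (s ^ (d - 1))).toReal • y = s ^ (d - 1) * y := by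
  rw [ENNReal.toReal_ofReal (pow_nonneg hs.1.le _), smul_eq_mul]

lemma integrableOn_sph [NeZero d] {f : E d → ℝ} (hf : IntegrableOn f (unitBall d)) :
    IntegrableOn (sph f) (Ioo 0 1) := by
  have h := (integrable_polar hf).integral_prod_left
  rw [radialMeasure, integrable_withDensity_iff_integrable_smul' (by fun_prop) (by simp)] at h
  refine h.congr ?_
  filter_upwards [ae_restrict_mem measurableSet_Ioo] with s hs
  exact toReal_density hs _

lemma integral_sph [NeZero d] {f : E d → ℝ} (hf : IntegrableOn f (unitBall d)) :
    ∫ x in unitBall d, f x = ∫ s in Ioo (0 : ℝ) 1, sph f s := by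
  have hf' := hf
  rw [IntegrableOn, ← map_polar] at hf'
  rw [← map_polar, integral_map measurable_polar.aemeasurable hf'.aestronglyMeasurable,
    integral_prod _ (integrable_polar hf), radialMeasure,
    integral_withDensity_eq_integral_toReal_smul (by fun_prop) (by simp)]
  refine setIntegral_congr_fun measurableSet_Ioo fun s hs => ?_
  exact toReal_density hs _

lemma ae_integrable_sphere [NeZero d] {f : E d → ℝ} (hf : IntegrableOn f (unitBall d)) :
    ∀ᵐ s ∂(volume.restrict (Ioo (0 : ℝ) 1)),
      Integrable (fun θ : Metric.sphere (0 : E d) 1 => f (s • (θ : E d))) (sphMeasure d) :=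
  ae_radialMeasure.1 (integrable_polar hf).prod_right_ae

lemma sph_radial_mul (ψ : ℝ → ℝ) (f : E d → ℝ) {s : ℝ} (hs : 0 < s) :
    sph (fun x => ψ ‖x‖ * f x) s = ψ s * sph f s := by
  have : ∀ θ : Metric.sphere (0 : E d) 1, ψ ‖s • (θ : E d)‖ * f (s • (θ : E d))
      = ψ s * f (s • (θ : E d)) := by
    intro θ
    simp [norm_smul, abs_of_pos hs]
  simp only [sph, this, integral_const_mul]
  ring

lemma integral_radial_mul [NeZero d] {ψ : ℝ → ℝ} {f : E d → ℝ}
    (hf : IntegrableOn (fun x => ψ ‖x‖ * f x) (unitBall d)) :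
    ∫ x in unitBall d, ψ ‖x‖ * f x = ∫ s in Ioo (0 : ℝ) 1, ψ s * sph f s := by
  rw [integral_sph hf]
  exact setIntegral_congr_fun measurableSet_Ioo fun s hs => sph_radial_mul ψ f hs.1

/-- The volume of the unit ball. -/
def ballVol (d : ℕ) : ℝ := (volume : Measure (E d)).real (unitBall d)

lemma ballVol_pos (d : ℕ) : 0 < ballVol d := by
  rw [ballVol, measureReal_def, ENNReal.toReal_pos_iff]
  exact ⟨Metric.measure_ball_pos _ _ one_pos, measure_ball_lt_top⟩

lemma sphMeasure_real_univ : (sphMeasure d).real univ = d * ballVol d := by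
  rw [Measure.toSphere_real_apply_univ, finrank_euclideanSpace_fin]
  rfl

lemma sph_one (s : ℝ) : sph (fun _ : E d => (1 : ℝ)) s = d * ballVol d * s ^ (d - 1) := by
  simp only [sph, integral_const, sphMeasure_real_univ, smul_eq_mul]
  ring

lemma integrableOn_of_continuous {f : E d → ℝ} (hf : Continuous f) :
    IntegrableOn f (unitBall d) :=
  (hf.continuousOn.integrableOn_compact (isCompact_closedBall (0 : E d) 1)).mono_set
    Metric.ball_subset_closedBall

/-! ### Second moments of the unit sphere -/

lemma integral_unitBall_comp (L : E d ≃ₗᵢ[ℝ] E d) (f : E d → ℝ) :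
    ∫ x in unitBall d, f (L x) = ∫ x in unitBall d, f x := by
  have h := L.measurePreserving.setIntegral_preimage_emb
    L.toHomeomorph.measurableEmbedding f (unitBall d)
  have h2 : L ⁻¹' (unitBall d) = unitBall d := by
    ext x; simp [unitBall]
  rwa [h2] at h

lemma integral_ball_coord_mul_of_ne {j k : Fin d} (hjk : j ≠ k) :
    ∫ x in unitBall d, x j * x k = 0 := by
  let L : E d ≃ₗᵢ[ℝ] E d := LinearIsometryEquiv.piLpCongrRight 2 fun i =>
    if i = j then LinearIsometryEquiv.neg ℝ else LinearIsometryEquiv.refl ℝ ℝ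
  have h := integral_unitBall_comp L (fun x => x j * x k)
  have h2 : ∀ x : E d, L x j * L x k = -(x j * x k) := by
    intro x
    simp [L, hjk.symm]
  simp only [h2, integral_neg] at h
  linarith

lemma integral_ball_coord_sq (j k : Fin d) :
    ∫ x in unitBall d, x j * x j = ∫ x in unitBall d, x k * x k := by
  let L : E d ≃ₗᵢ[ℝ] E d := LinearIsometryEquiv.piLpCongrLeft 2 ℝ ℝ (Equiv.swap j k)
  have h := integral_unitBall_comp L (fun x => x j * x j)
  have h2 : ∀ x : E d, L x j = x k := by
    intro x
    simp [L, LinearIsometryEquiv.piLpCongrLeft_apply]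
  simp only [h2] at h
  exact h.symm

/-- The second moments of the surface measure. -/
lemma integral_sphere_coord_mul [NeZero d] (j k : Fin d) :
    ∫ θ : Metric.sphere (0 : E d) 1, (θ : E d) j * (θ : E d) k ∂(sphMeasure d) =
      if j = k then ballVol d else 0 := by
  set I : Fin d → Fin d → ℝ := fun j k =>
    ∫ θ : Metric.sphere (0 : E d) 1, (θ : E d) j * (θ : E d) k ∂(sphMeasure d) with hI
  have hsph : ∀ j k, ∀ s, sph (fun x : E d => x j * x k) s = s ^ (d - 1) * s ^ 2 * I j k := by
    intro j k s
    have : ∀ θ : Metric.sphere (0 : E d) 1, (s • (θ : E d)) j * (s • (θ : E d)) k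
        = s ^ 2 * ((θ : E d) j * (θ : E d) k) := fun θ => by simp; ring
    simp only [sph, this, integral_const_mul, hI]
    ring
  -- Symmetry is available for Lebesgue measure on the ball; the nonzero radial factor transfers it
  -- to the sphere. The common diagonal value follows from `∑ θ_i² = 1`.
  have hball : ∀ j k, ∫ x in unitBall d, x j * x k =
      (∫ s in Ioo (0 : ℝ) 1, s ^ (d - 1) * s ^ 2) * I j k := by
    intro j k
    rw [integral_sph (integrableOn_of_continuous (by fun_prop))]
    simp only [hsph, integral_mul_const]
  set m := ∫ s in Ioo (0 : ℝ) 1, s ^ (d - 1) * s ^ 2 with hm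
  have hm0 : m ≠ 0 := by
    have : m = ∫ s in (0 : ℝ)..1, s ^ (d - 1 + 2) := by
      rw [hm, intervalIntegral.integral_of_le zero_le_one, integral_Ioc_eq_integral_Ioo]
      simp only [pow_add]
    rw [this, integral_pow]
    simp
    positivity
  have hsum : ∑ i, I i i = d * ballVol d := by
    rw [hI, ← integral_finsetSum]
    · have : ∀ θ : Metric.sphere (0 : E d) 1, ∑ i, (θ : E d) i * (θ : E d) i = 1 := by
        intro θ
        have h := EuclideanSpace.norm_sq_eq (θ : E d)
        simp only [norm_eq_of_mem_sphere, Real.norm_eq_abs, sq_abs] at h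
        simp only [← sq]
        linarith
      simp only [this, integral_const, sphMeasure_real_univ, smul_eq_mul, mul_one]
    · intro i _
      refine Continuous.integrable_of_hasCompactSupport (by fun_prop) ?_
      exact HasCompactSupport.of_compactSpace _
  change I j k = _
  split_ifs with hjk
  · subst hjk
    have h : ∀ i, I i i = I j j := by
      intro i
      have := integral_ball_coord_sq i j
      rw [hball, hball] at this
      exact mul_left_cancel₀ hm0 this
    simp only [h, Finset.sum_const, Finset.card_univ, Fintype.card_fin, nsmul_eq_mul] at hsum
    exact mul_left_cancel₀ (Nat.cast_ne_zero.2 (NeZero.ne d)) hsum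
  · have := integral_ball_coord_mul_of_ne hjk
    rw [hball] at this
    exact (mul_eq_zero.1 this).resolve_left hm0

end Polar

/-! ### Frobenius norm -/

/-- The topology of the Frobenius norm, preferred to the product topology. -/
instance (priority := 2000) topologicalSpaceFrobenius (d : ℕ) : TopologicalSpace (M d) :=
  (Matrix.frobeniusNormedAddCommGroup :
    NormedAddCommGroup (M d)).toSeminormedAddCommGroup.toPseudoMetricSpace.toUniformSpace.toTopologicalSpace

section Frobenius

variable {d : ℕ}

lemma frobenius_norm_sq (A : M d) : ‖A‖ ^ 2 = ∑ i, ∑ j, A i j ^ 2 := by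
  rw [Matrix.frobenius_norm_def, ← Real.rpow_natCast, ← Real.rpow_mul (by positivity)]
  simp

lemma norm_entry_le (A : M d) (i j : Fin d) : |A i j| ≤ ‖A‖ := by
  refine abs_le_of_sq_le_sq ?_ (norm_nonneg _)
  rw [frobenius_norm_sq]
  exact (Finset.single_le_sum (f := fun j => A i j ^ 2) (fun _ _ => sq_nonneg _)
    (Finset.mem_univ j)).trans
    (Finset.single_le_sum (f := fun i => ∑ j, A i j ^ 2)
      (fun _ _ => Finset.sum_nonneg fun _ _ => sq_nonneg _) (Finset.mem_univ i))

/-- A matrix as a vector of the Euclidean space of its entries. -/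
def flat (d : ℕ) : M d →L[ℝ] EuclideanSpace ℝ (Fin d × Fin d) :=
  LinearMap.toContinuousLinearMap
    { toFun := fun A => WithLp.toLp 2 fun ij => A ij.1 ij.2
      map_add' := fun _ _ => rfl
      map_smul' := fun _ _ => rfl }

/-- `burk_zigzag` differentiates norms through an inner product; `flat` provides one without
changing the Frobenius norm. -/
lemma norm_flat (A : M d) : ‖flat d A‖ = ‖A‖ := by
  have h : ‖flat d A‖ ^ 2 = ‖A‖ ^ 2 := by
    rw [frobenius_norm_sq, EuclideanSpace.norm_sq_eq, Fintype.sum_prod_type]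
    simp only [Real.norm_eq_abs, sq_abs]
    rfl
  exact (sq_eq_sq₀ (norm_nonneg _) (norm_nonneg _)).1 h

/-- An entry of a matrix as a continuous linear functional. -/
def entryL (i j : Fin d) : M d →L[ℝ] ℝ :=
  LinearMap.toContinuousLinearMap (Matrix.entryLinearMap ℝ ℝ i j)

end Frobenius

/-! ### Weak gradients -/

section Weak

variable {d : ℕ}

/-- The partial derivative of a function in direction `j`. -/
def pd (j : Fin d) (η : E d → ℝ) (x : E d) : ℝ := fderiv ℝ η x (EuclideanSpace.single j 1)

lemma contDiff_pd {j : Fin d} {η : E d → ℝ} (hη : ContDiff ℝ ∞ η) : ContDiff ℝ ∞ (pd j η) := by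
  unfold pd
  exact (hη.fderiv_right (m := ∞) (by simp)).clm_apply contDiff_const

lemma hasCompactSupport_pd {j : Fin d} {η : E d → ℝ} (hη : HasCompactSupport η) :
    HasCompactSupport (pd j η) := hη.fderiv_apply ℝ _

lemma pd_mul {j : Fin d} {f g : E d → ℝ} (hf : ContDiff ℝ ∞ f) (hg : ContDiff ℝ ∞ g) (x : E d) :
    pd j (fun x => f x * g x) x = pd j f x * g x + f x * pd j g x := by
  have h1 := (hf.differentiable (by simp)) x
  have h2 := (hg.differentiable (by simp)) x
  simp only [pd]
  rw [fderiv_fun_mul h1 h2]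
  simp
  ring

lemma contDiff_coord (k : Fin d) : ContDiff ℝ ∞ (fun x : E d => x k) :=
  (EuclideanSpace.proj (𝕜 := ℝ) k).contDiff

lemma pd_coord (j k : Fin d) (x : E d) : pd j (fun x : E d => x k) x = if j = k then 1 else 0 := by
  have h : HasFDerivAt (fun x : E d => x k) (EuclideanSpace.proj (𝕜 := ℝ) k) x :=
    (EuclideanSpace.proj (𝕜 := ℝ) k).hasFDerivAt
  rw [pd, h.fderiv]
  simp [eq_comm]

lemma integral_mul_pd {f η : E d → ℝ} (hf : ContDiff ℝ ∞ f) (hfc : HasCompactSupport f)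
    (hη : ContDiff ℝ ∞ η) (j : Fin d) :
    ∫ x, f x * pd j η x = -∫ x, pd j f x * η x := by
  have h1 : Continuous (pd j f) := (contDiff_pd hf).continuous
  have h2 : Continuous (pd j η) := (contDiff_pd hη).continuous
  refine integral_mul_fderiv_eq_neg_fderiv_mul_of_integrable ?_ ?_ ?_
    (fun x _ => hf.differentiable (by simp) x) (fun x _ => hη.differentiable (by simp) x)
  · exact (h1.mul hη.continuous).integrable_of_hasCompactSupport
      ((hasCompactSupport_pd hfc).mul_right)
  · exact (hf.continuous.mul h2).integrable_of_hasCompactSupport hfc.mul_right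
  · exact (hf.continuous.mul hη.continuous).integrable_of_hasCompactSupport hfc.mul_right

lemma integral_pd_eq_zero {f : E d → ℝ} (hf : ContDiff ℝ ∞ f) (hfc : HasCompactSupport f)
    (j : Fin d) : ∫ x, pd j f x = 0 := by
  have h := integral_mul_pd hf hfc (contDiff_const (c := (1 : ℝ))) j
  simp [pd] at h
  simpa [pd] using h

lemma contDiff_component {φ : E d → E d} (hφ : ContDiff ℝ ∞ φ) (i : Fin d) :
    ContDiff ℝ ∞ (fun x => φ x i) := (EuclideanSpace.proj (𝕜 := ℝ) i).contDiff.comp hφ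

lemma pd_component {φ : E d → E d} (hφ : ContDiff ℝ ∞ φ) (i j : Fin d) (x : E d) :
    pd j (fun x => φ x i) x = jacobian φ x i j := by
  have h : HasFDerivAt (fun x => φ x i)
      ((EuclideanSpace.proj (𝕜 := ℝ) i).comp (fderiv ℝ φ x)) x :=
    (EuclideanSpace.proj (𝕜 := ℝ) i).hasFDerivAt.comp x
      (hφ.differentiable (by simp) x).hasFDerivAt
  rw [pd, h.fderiv, jacobian]
  rfl

lemma hasCompactSupport_component {φ : E d → E d} (hφ : HasCompactSupport φ) (i : Fin d) :
    HasCompactSupport (fun x => φ x i) :=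
  hφ.comp_left (g := fun y : E d => y i) rfl

lemma component_eq_zero {Ω : Set (E d)} {φ : E d → E d} (hφ : IsTestFunction Ω φ) (i : Fin d)
    {x : E d} (hx : x ∉ Ω) : φ x i = 0 := by
  have : φ x = 0 := image_eq_zero_of_notMem_tsupport fun h => hx (hφ.2.2 h)
  rw [this]; rfl

lemma jacobian_eq_zero {Ω : Set (E d)} {φ : E d → E d} (hφ : IsTestFunction Ω φ) (i j : Fin d)
    {x : E d} (hx : x ∉ Ω) : jacobian φ x i j = 0 := by
  have : fderiv ℝ φ x = 0 := fderiv_of_notMem_tsupport ℝ fun h => hx (hφ.2.2 h)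
  rw [jacobian, this]; rfl

/-- Integration by parts for a test field against a function without support condition. -/
lemma integral_test_mul_pd {Ω : Set (E d)} {φ : E d → E d} (hφ : IsTestFunction Ω φ)
    {η : E d → ℝ} (hη : ContDiff ℝ ∞ η) (i j : Fin d) :
    ∫ x in Ω, φ x i * pd j η x = -∫ x in Ω, jacobian φ x i j * η x := by
  have h := integral_mul_pd (contDiff_component hφ.1 i) (hasCompactSupport_component hφ.2.1 i) hη j
  simp only [pd_component hφ.1] at h
  rw [setIntegral_eq_integral_of_forall_compl_eq_zero fun x hx => by
      rw [component_eq_zero hφ i hx, zero_mul],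
    setIntegral_eq_integral_of_forall_compl_eq_zero fun x hx => by
      rw [jacobian_eq_zero hφ i j hx, zero_mul], h]

lemma LocallyIntegrableOn.integrableOn_mul_test {Ω : Set (E d)} {f φ : E d → ℝ}
    (hf : LocallyIntegrableOn f Ω) (hφ : Continuous φ) (hc : HasCompactSupport φ)
    (hs : tsupport φ ⊆ Ω) : IntegrableOn (fun x => f x * φ x) Ω := by
  have h1 : IntegrableOn (fun x => f x * φ x) (tsupport φ) :=
    (hf.integrableOn_compact_subset hs hc.isCompact).mul_continuousOn hφ.continuousOn hc.isCompact
  refine Integrable.integrableOn ?_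
  refine (integrableOn_iff_integrable_of_support_subset ?_).1 h1
  refine (Function.support_mul_subset_right f φ).trans (subset_tsupport φ)

lemma ae_eq_zero_of_forall_test {Ω : Set (E d)} (hΩ : IsOpen Ω) {f : E d → ℝ}
    (hf : LocallyIntegrableOn f Ω)
    (h : ∀ φ : E d → ℝ, IsTestFunction Ω φ → ∫ x in Ω, f x * φ x = 0) :
    ∀ᵐ x ∂(volume.restrict Ω), f x = 0 := by
  rw [ae_restrict_iff' hΩ.measurableSet]
  refine hΩ.ae_eq_zero_of_integral_contDiff_smul_eq_zero hf fun g h1 h2 h3 => ?_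
  rw [← h g ⟨h1, h2, h3⟩, setIntegral_eq_integral_of_forall_compl_eq_zero]
  · simp [mul_comm]
  · intro x hx
    rw [image_eq_zero_of_notMem_tsupport fun h => hx (h3 h), mul_zero]

lemma isOpen_unitBall (d : ℕ) : IsOpen (unitBall d) := Metric.isOpen_ball

/-- `RadialBound` admits any weak gradient, while `MemW01p` comes with its own; this identifies the
two. -/
lemma HasWeakGradient.ae_eq {Ω : Set (E d)} (hΩ : IsOpen Ω) {u : E d → E d} {G G' : E d → M d}
    (h : HasWeakGradient Ω u G) (h' : HasWeakGradient Ω u G') :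
    ∀ᵐ x ∂(volume.restrict Ω), G x = G' x := by
  have key : ∀ i j, ∀ᵐ x ∂(volume.restrict Ω), G x i j - G' x i j = 0 := by
    intro i j
    refine ae_eq_zero_of_forall_test hΩ ((h.2.1 i j).sub (h'.2.1 i j)) fun φ hφ => ?_
    have h1 := h.2.2 φ hφ i j
    rw [h'.2.2 φ hφ i j] at h1
    simp only [sub_mul]
    rw [integral_sub
      (LocallyIntegrableOn.integrableOn_mul_test (h.2.1 i j) hφ.1.continuous hφ.2.1 hφ.2.2)
      (LocallyIntegrableOn.integrableOn_mul_test (h'.2.1 i j) hφ.1.continuous hφ.2.1 hφ.2.2)]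
    linarith
  have h2 : ∀ᵐ x ∂(volume.restrict Ω), ∀ i j, G x i j - G' x i j = 0 :=
    ae_all_iff.2 fun i => ae_all_iff.2 fun j => key i j
  filter_upwards [h2] with x hx
  ext i j
  linarith [hx i j]

instance : IsFiniteMeasure ((volume : Measure (E d)).restrict (unitBall d)) :=
  ⟨by rw [Measure.restrict_apply_univ]; exact measure_ball_lt_top⟩

lemma tendsto_integral_mul_of_eLpNorm {α : Type*} [MeasurableSpace α] {μ : Measure α}
    [IsFiniteMeasure μ] {q : ENNReal} (hq : 1 ≤ q) {F : ℕ → α → ℝ} {f g : α → ℝ} {C : ℝ}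
    (hF : ∀ n, MemLp (F n) q μ) (hf : MemLp f q μ) (hg : AEStronglyMeasurable g μ)
    (hC : ∀ᵐ x ∂μ, |g x| ≤ C)
    (h : Tendsto (fun n => eLpNorm (fun x => F n x - f x) q μ) atTop (𝓝 0)) :
    Tendsto (fun n => ∫ x, F n x * g x ∂μ) atTop (𝓝 (∫ x, f x * g x ∂μ)) := by
  have hFi : ∀ n, Integrable (fun x => F n x * g x) μ := fun n =>
    ((hF n).integrable hq).mul_bdd hg (by simpa using hC)
  have hfi : Integrable (fun x => f x * g x) μ := (hf.integrable hq).mul_bdd hg (by simpa using hC)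
  refine tendsto_integral_of_L1 _ hfi.aestronglyMeasurable (Eventually.of_forall hFi) ?_
  have h0 : Tendsto (fun n => ENNReal.ofReal C * (eLpNorm (fun x => F n x - f x) q μ *
      μ univ ^ (1 / (1 : ENNReal).toReal - 1 / q.toReal))) atTop (𝓝 0) := by
    have hfin : μ univ ^ (1 / (1 : ENNReal).toReal - 1 / q.toReal) ≠ ⊤ := by
      refine ENNReal.rpow_ne_top_of_nonneg ?_ (measure_ne_top _ _)
      rcases eq_or_ne q ⊤ with rfl | hq2
      · simp
      · have : 1 ≤ q.toReal := by
          rw [← ENNReal.toReal_one]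
          exact ENNReal.toReal_mono hq2 hq
        have : 1 / q.toReal ≤ 1 := by rw [div_le_one (by linarith)]; exact this
        simpa using this
    have h1 := ENNReal.Tendsto.mul_const h (b := μ univ ^ (1 / (1 : ENNReal).toReal - 1 / q.toReal))
      (Or.inr hfin)
    have h2 := ENNReal.Tendsto.const_mul (a := ENNReal.ofReal C) h1 (Or.inr ENNReal.ofReal_ne_top)
    simpa using h2
  refine tendsto_of_tendsto_of_tendsto_of_le_of_le tendsto_const_nhds h0 (fun n => bot_le) fun n => ?_
  calc ∫⁻ x, ‖F n x * g x - f x * g x‖ₑ ∂μ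
      ≤ ∫⁻ x, ENNReal.ofReal C * ‖F n x - f x‖ₑ ∂μ := by
        refine lintegral_mono_ae ?_
        filter_upwards [hC] with x hx
        rw [← sub_mul, enorm_mul, mul_comm]
        gcongr
        rw [← ofReal_norm, Real.norm_eq_abs]
        exact ENNReal.ofReal_le_ofReal hx
    _ = ENNReal.ofReal C * eLpNorm (fun x => F n x - f x) 1 μ := by
        rw [lintegral_const_mul' _ _ ENNReal.ofReal_ne_top, eLpNorm_one_eq_lintegral_enorm]
    _ ≤ _ := by
        gcongr
        exact eLpNorm_le_eLpNorm_mul_rpow_measure_univ hq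
          ((hF n).sub hf).aestronglyMeasurable

lemma exists_bound_unitBall {g : E d → ℝ} (hg : Continuous g) :
    ∃ C, ∀ᵐ x ∂(volume.restrict (unitBall d)), |g x| ≤ C := by
  obtain ⟨C, hC⟩ := (isCompact_closedBall (0 : E d) 1).exists_bound_of_continuousOn hg.continuousOn
  refine ⟨C, (ae_restrict_iff' (measurableSet_unitBall d)).2 (Eventually.of_forall fun x hx => ?_)⟩
  exact hC x (Metric.ball_subset_closedBall hx)

lemma memLp_of_continuous {g : E d → ℝ} (hg : Continuous g) (q : ENNReal) :
    MemLp g q (volume.restrict (unitBall d)) := by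
  obtain ⟨C, hC⟩ := exists_bound_unitBall hg
  exact MemLp.of_bound hg.aestronglyMeasurable C hC

/-- Functions in `W^{1,p}_0` of the ball satisfy integration by parts up to the boundary. -/
lemma MemW01p.integral_mul_pd {p : ℝ} (hp : 1 < p) {u : E d → E d} {G : E d → M d}
    (hu : MemW01p p (unitBall d) u) (hG : HasWeakGradient (unitBall d) u G) :
    (∀ i, MemLp (fun x => u x i) (ENNReal.ofReal p) (volume.restrict (unitBall d))) ∧
    (∀ i j, MemLp (fun x => G x i j) (ENNReal.ofReal p) (volume.restrict (unitBall d))) ∧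
    ∀ η : E d → ℝ, ContDiff ℝ ∞ η → ∀ i j,
      ∫ x in unitBall d, u x i * pd j η x = -∫ x in unitBall d, G x i j * η x := by
  obtain ⟨hu1, G', hG', hG'p, φ, hφ, hφu, hφG⟩ := hu
  have hae := hG.ae_eq (isOpen_unitBall d) hG'
  have hq : 1 ≤ ENNReal.ofReal p := by
    rw [← ENNReal.ofReal_one]; exact ENNReal.ofReal_le_ofReal hp.le
  have hui : ∀ i, MemLp (fun x => u x i) (ENNReal.ofReal p) (volume.restrict (unitBall d)) :=
    fun i => (EuclideanSpace.proj (𝕜 := ℝ) i).comp_memLp' hu1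
  have hGp : ∀ i j, MemLp (fun x => G x i j) (ENNReal.ofReal p)
      (volume.restrict (unitBall d)) := fun i j =>
    (hG'p i j).ae_eq (by filter_upwards [hae] with x hx; rw [hx])
  refine ⟨hui, hGp, fun η hη i j => ?_⟩
  have hη' : Continuous (pd j η) := (contDiff_pd hη).continuous
  obtain ⟨C1, hC1⟩ := exists_bound_unitBall hη'
  obtain ⟨C2, hC2⟩ := exists_bound_unitBall hη.continuous
  have hφi : Tendsto (fun n => eLpNorm (fun x => φ n x i - u x i) (ENNReal.ofReal p)
      (volume.restrict (unitBall d))) atTop (𝓝 0) := by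
    refine tendsto_of_tendsto_of_tendsto_of_le_of_le tendsto_const_nhds hφu (fun n => bot_le)
      fun n => eLpNorm_mono fun x => ?_
    exact PiLp.norm_apply_le (φ n x - u x) i
  have hφij : Tendsto (fun n => eLpNorm (fun x => jacobian (φ n) x i j - G' x i j)
      (ENNReal.ofReal p) (volume.restrict (unitBall d))) atTop (𝓝 0) := by
    refine tendsto_of_tendsto_of_tendsto_of_le_of_le tendsto_const_nhds hφG (fun n => bot_le)
      fun n => eLpNorm_mono fun x => ?_
    exact norm_entry_le (jacobian (φ n) x - G' x) i j
  have hjc : ∀ n, Continuous fun x => jacobian (φ n) x i j := fun n => by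
    have := (contDiff_pd (j := j) (contDiff_component (hφ n).1 i)).continuous
    simpa only [← pd_component (hφ n).1] using this
  have l1 := tendsto_integral_mul_of_eLpNorm hq
    (fun n => memLp_of_continuous (contDiff_component (hφ n).1 i).continuous _) (hui i)
    hη'.aestronglyMeasurable hC1 hφi
  have l2 := tendsto_integral_mul_of_eLpNorm hq
    (fun n => memLp_of_continuous (hjc n) _) (hG'p i j)
    hη.continuous.aestronglyMeasurable hC2 hφij
  -- Zero boundary values enter here: the approximating fields have compact support, so `η` needs
  -- none.
  have l3 : (fun n => ∫ x in unitBall d, φ n x i * pd j η x) =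
      fun n => -∫ x in unitBall d, jacobian (φ n) x i j * η x :=
    funext fun n => integral_test_mul_pd (hφ n) hη i j
  rw [l3] at l1
  rw [tendsto_nhds_unique l1 l2.neg]
  congr 1
  refine integral_congr_ae ?_
  filter_upwards [hae] with x hx
  rw [hx]

end Weak

/-! ### The radial profile of a generalised-radial Sobolev function -/

section Profile

variable {d : ℕ}

/-- The hypotheses on a function and its gradient used below: integrability, and integration by
parts up to the boundary of the unit ball. -/
structure IBP (u : E d → E d) (G : E d → M d) : Prop where
  integrable_fun : ∀ i, IntegrableOn (fun x => u x i) (unitBall d)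
  integrable_grad : ∀ i j, IntegrableOn (fun x => G x i j) (unitBall d)
  integral_eq : ∀ η : E d → ℝ, ContDiff ℝ ∞ η → ∀ i j,
    ∫ x in unitBall d, u x i * pd j η x = -∫ x in unitBall d, G x i j * η x

/-- The integral of an entry of `G` over the ball of radius `ρ`. -/
def primG (G : E d → M d) (i j : Fin d) (ρ : ℝ) : ℝ := ∫ s in (0 : ℝ)..ρ, sph (fun x => G x i j) s

/-- The average of `G` over the ball of radius `ρ`. -/
def avgG (G : E d → M d) (ρ : ℝ) : M d :=
  Matrix.of fun i j => primG G i j ρ / (ballVol d * ρ ^ d)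

lemma integrableOn_mul_continuous {f g : E d → ℝ} (hf : IntegrableOn f (unitBall d))
    (hg : Continuous g) : IntegrableOn (fun x => f x * g x) (unitBall d) := by
  obtain ⟨C, hC⟩ := exists_bound_unitBall hg
  exact hf.mul_bdd hg.aestronglyMeasurable (by simpa using hC)

lemma intervalIntegrable_of_Ioo {f : ℝ → ℝ} (hf : IntegrableOn f (Ioo 0 1)) :
    IntervalIntegrable f volume 0 1 := by
  rwa [intervalIntegrable_iff_integrableOn_Ioo_of_le zero_le_one]

lemma integral_Ioo_eq (f : ℝ → ℝ) : ∫ s in Ioo (0 : ℝ) 1, f s = ∫ s in (0 : ℝ)..1, f s := by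
  rw [intervalIntegral.integral_of_le zero_le_one, integral_Ioc_eq_integral_Ioo]

lemma contDiff_radial {ψ : ℝ → ℝ} (hψ : ContDiff ℝ ∞ ψ) :
    ContDiff ℝ ∞ (fun x : E d => ψ (‖x‖ ^ 2)) := hψ.comp (contDiff_norm_sq ℝ)

lemma pd_radial {ψ : ℝ → ℝ} (hψ : ContDiff ℝ ∞ ψ) (j : Fin d) (x : E d) :
    pd j (fun x : E d => ψ (‖x‖ ^ 2)) x = 2 * x j * deriv ψ (‖x‖ ^ 2) := by
  have h1 : HasFDerivAt (fun x : E d => ‖x‖ ^ 2) (2 • innerSL ℝ x) x :=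
    (hasStrictFDerivAt_norm_sq x).hasFDerivAt
  have h2 := ((hψ.differentiable (by simp)) (‖x‖ ^ 2)).hasDerivAt.comp_hasFDerivAt x h1
  have h3 : pd j (fun x : E d => ψ (‖x‖ ^ 2)) x =
      (deriv ψ (‖x‖ ^ 2) • (2 • innerSL ℝ x)) (EuclideanSpace.single j 1) := by
    rw [pd, ← h2.fderiv]; rfl
  rw [h3]
  simp [EuclideanSpace.inner_single_right]
  ring

lemma primG_zero (G : E d → M d) (i j : Fin d) : primG G i j 0 = 0 :=
  intervalIntegral.integral_same

lemma toEuclideanLin_apply_coord (A : M d) (x : E d) (i : Fin d) :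
    Matrix.toEuclideanLin A x i = ∑ k, A i k * x k := by
  simp [Matrix.toLpLin_apply, Matrix.mulVec, dotProduct]

variable [NeZero d] {u : E d → E d} {G : E d → M d}

lemma IBP.intervalIntegrable_sph (h : IBP u G) (i j : Fin d) :
    IntervalIntegrable (sph fun x => G x i j) volume 0 1 :=
  intervalIntegrable_of_Ioo (integrableOn_sph (h.integrable_grad i j))

/-- Testing against the constant `1`: with zero boundary values the gradient has mean zero. -/
lemma IBP.primG_one (h : IBP u G) (i j : Fin d) : primG G i j 1 = 0 := by
  have h1 := h.integral_eq (fun _ => 1) contDiff_const i j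
  simp only [mul_one] at h1
  rw [integral_sph (h.integrable_grad i j), integral_Ioo_eq] at h1
  have h2 : ∀ x : E d, pd j (fun _ : E d => (1 : ℝ)) x = 0 := fun x => by simp [pd]
  simp only [h2, mul_zero, integral_zero] at h1
  rw [primG]
  linarith

lemma IBP.absolutelyContinuous_primG (h : IBP u G) (i j : Fin d) :
    AbsolutelyContinuousOnInterval (primG G i j) 0 1 :=
  (h.intervalIntegrable_sph i j).absolutelyContinuousOnInterval_intervalIntegral (by simp)

lemma IBP.ae_hasDerivAt_primG (h : IBP u G) (i j : Fin d) :
    ∀ᵐ s ∂(volume.restrict (Ioo (0 : ℝ) 1)),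
      HasDerivAt (primG G i j) (sph (fun x => G x i j) s) s := by
  rw [ae_restrict_iff' measurableSet_Ioo]
  filter_upwards [(h.intervalIntegrable_sph i j).ae_hasDerivAt_integral] with s hs hs1
  exact hs (by rw [uIcc_of_le zero_le_one]; exact ⟨hs1.1.le, hs1.2.le⟩) 0 (by simp)

/-- Testing against `ψ(|x|²)` gives, in weak form, the divergence theorem on balls: `∫_{∂B_s} u_i
x_j = s ∫_{B_s} G_ij`. The square keeps the test function smooth at the origin. -/
lemma IBP.integral_profile (h : IBP u G) {ψ : ℝ → ℝ} (hψ : ContDiff ℝ ∞ ψ) (i j : Fin d) :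
    ∫ s in Ioo (0 : ℝ) 1, 2 * deriv ψ (s ^ 2) *
      (sph (fun x => u x i * x j) s - s * primG G i j s) = 0 := by
  have hψ' : Continuous (deriv ψ) := hψ.continuous_deriv (by simp)
  have h1 := h.integral_eq _ (contDiff_radial hψ) i j
  have e1 : ∀ x : E d, u x i * pd j (fun x : E d => ψ (‖x‖ ^ 2)) x =
      (fun s => 2 * deriv ψ (s ^ 2)) ‖x‖ * (u x i * x j) := fun x => by
    rw [pd_radial hψ]; ring
  have e2 : ∀ x : E d, G x i j * ψ (‖x‖ ^ 2) = (fun s => ψ (s ^ 2)) ‖x‖ * G x i j := fun x =>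
    mul_comm _ _
  have hux : IntegrableOn (fun x => u x i * x j) (unitBall d) :=
    integrableOn_mul_continuous (h.integrable_fun i) (by fun_prop)
  have k1 : ∫ x in unitBall d, 2 * deriv ψ (‖x‖ ^ 2) * (u x i * x j) =
      ∫ s in Ioo (0 : ℝ) 1, 2 * deriv ψ (s ^ 2) * sph (fun x => u x i * x j) s := by
    refine integral_radial_mul (ψ := fun s => 2 * deriv ψ (s ^ 2)) ?_
    refine (integrableOn_mul_continuous hux (g := fun x => 2 * deriv ψ (‖x‖ ^ 2))
      (continuous_const.mul (hψ'.comp (by fun_prop)))).congr ?_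
    exact Eventually.of_forall fun x => mul_comm _ _
  have k2 : ∫ x in unitBall d, ψ (‖x‖ ^ 2) * G x i j =
      ∫ s in Ioo (0 : ℝ) 1, ψ (s ^ 2) * sph (fun x => G x i j) s := by
    refine integral_radial_mul (ψ := fun s => ψ (s ^ 2)) ?_
    refine (integrableOn_mul_continuous (h.integrable_grad i j)
      (g := fun x => ψ (‖x‖ ^ 2)) (hψ.continuous.comp (by fun_prop))).congr ?_
    exact Eventually.of_forall fun x => mul_comm _ _
  simp only [e1, e2] at h1
  rw [k1, k2] at h1
  have h2 : ∫ s in Ioo (0 : ℝ) 1, ψ (s ^ 2) * sph (fun x => G x i j) s =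
      -∫ s in Ioo (0 : ℝ) 1, 2 * deriv ψ (s ^ 2) * (s * primG G i j s) := by
    have hac : AbsolutelyContinuousOnInterval (fun s : ℝ => ψ (s ^ 2)) 0 1 :=
      ContDiffOn.absolutelyContinuousOnInterval
        ((hψ.comp (contDiff_id.pow 2)).of_le (by simp)).contDiffOn
    have h3 := hac.integral_mul_deriv_eq_deriv_mul (h.absolutelyContinuous_primG i j)
    -- Integration by parts in `s`; the primitive vanishes at both ends, so no boundary term
    -- survives.
    rw [h.primG_one, primG_zero, ← integral_Ioo_eq, ← integral_Ioo_eq] at h3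
    have h4 : ∫ s in Ioo (0 : ℝ) 1, ψ (s ^ 2) * deriv (primG G i j) s =
        ∫ s in Ioo (0 : ℝ) 1, ψ (s ^ 2) * sph (fun x => G x i j) s := by
      refine integral_congr_ae ?_
      filter_upwards [h.ae_hasDerivAt_primG i j] with s hs
      rw [hs.deriv]
    have h5 : ∀ s : ℝ, deriv (fun s : ℝ => ψ (s ^ 2)) s = deriv ψ (s ^ 2) * (2 * s) := by
      intro s
      have h6 : HasDerivAt (fun s : ℝ => s ^ 2) (2 * s) s := by simpa using hasDerivAt_pow 2 s
      exact (((hψ.differentiable (by simp)) (s ^ 2)).hasDerivAt.comp s h6).deriv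
    rw [← h4, h3]
    simp only [h5, mul_zero, sub_self, zero_sub]
    congr 1
    refine integral_congr_ae (Eventually.of_forall fun s => ?_)
    ring
  rw [h2, neg_neg] at h1
  have i1 : IntegrableOn (fun s => 2 * deriv ψ (s ^ 2) * sph (fun x => u x i * x j) s) (Ioo 0 1) := by
    have : IntegrableOn (fun s => 2 * deriv ψ (s ^ 2) * sph (fun x => u x i * x j) s) (Icc 0 1) := by
      refine IntegrableOn.continuousOn_mul (Continuous.continuousOn ?_) ?_ isCompact_Icc
      · exact continuous_const.mul (hψ'.comp (by fun_prop))
      · rw [integrableOn_Icc_iff_integrableOn_Ioo]; exact integrableOn_sph hux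
    exact this.mono_set Ioo_subset_Icc_self
  have i2 : IntegrableOn (fun s => 2 * deriv ψ (s ^ 2) * (s * primG G i j s)) (Ioo 0 1) := by
    have hc := (h.absolutelyContinuous_primG i j).continuousOn
    rw [uIcc_of_le zero_le_one] at hc
    have : IntegrableOn (fun s => 2 * deriv ψ (s ^ 2) * (s * primG G i j s)) (Icc 0 1) := by
      refine ContinuousOn.integrableOn_Icc ?_
      have h7 : Continuous fun s : ℝ => 2 * deriv ψ (s ^ 2) :=
        continuous_const.mul (hψ'.comp (by fun_prop))
      exact h7.continuousOn.mul (continuousOn_id.mul hc)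
    exact this.mono_set Ioo_subset_Icc_self
  simp only [mul_sub]
  rw [integral_sub i1 i2, h1, sub_self]

/-- Take a primitive of `κ(√t)/2`; it is smooth across `t = 0` because `κ` vanishes near `0`. The
functions `2ψ'(s²)` thus include all test functions on `(0, 1)`. -/
lemma exists_deriv_eq_of_test {κ : ℝ → ℝ} (hκ : ContDiff ℝ ∞ κ) (hs : tsupport κ ⊆ Ioo 0 1) :
    ∃ ψ : ℝ → ℝ, ContDiff ℝ ∞ ψ ∧ ∀ s, 0 < s → 2 * deriv ψ (s ^ 2) = κ s := by
  set χ : ℝ → ℝ := fun t => κ (√t) / 2 with hχ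
  have hχs : ContDiff ℝ ∞ χ := by
    rw [contDiff_iff_contDiffAt]
    intro t
    rcases lt_or_ge 0 t with ht | ht
    · exact (hκ.contDiffAt.comp t (Real.contDiffAt_sqrt ht.ne')).div_const 2
    · have h1 : (tsupport κ)ᶜ ∈ 𝓝 (√t) := by
        refine (isClosed_tsupport κ).isOpen_compl.mem_nhds fun h => ?_
        rw [Real.sqrt_eq_zero_of_nonpos ht] at h
        exact lt_irrefl _ (hs h).1
      have h2 : ∀ᶠ t' in 𝓝 t, χ t' = 0 := by
        filter_upwards [Real.continuous_sqrt.continuousAt.preimage_mem_nhds h1] with t' ht'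
        simp [hχ, image_eq_zero_of_notMem_tsupport ht']
      exact contDiffAt_const.congr_of_eventuallyEq h2
  have hd : ∀ t, HasDerivAt (fun t => ∫ y in (0 : ℝ)..t, χ y) (χ t) t := fun t =>
    intervalIntegral.integral_hasDerivAt_right (hχs.continuous.intervalIntegrable _ _)
      (hχs.continuous.stronglyMeasurableAtFilter _ _) hχs.continuous.continuousAt
  refine ⟨fun t => ∫ y in (0 : ℝ)..t, χ y, ?_, fun s hs => ?_⟩
  · rw [contDiff_infty_iff_deriv]
    exact ⟨fun t => (hd t).differentiableAt, by rwa [funext fun t => (hd t).deriv]⟩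
  · rw [(hd _).deriv, hχ]
    simp only [Real.sqrt_sq hs.le]
    ring

lemma IBP.ae_sph_eq (h : IBP u G) (i j : Fin d) :
    ∀ᵐ s ∂(volume.restrict (Ioo (0 : ℝ) 1)),
      sph (fun x => u x i * x j) s = s * primG G i j s := by
  have hux : IntegrableOn (fun x => u x i * x j) (unitBall d) :=
    integrableOn_mul_continuous (h.integrable_fun i) (by fun_prop)
  have hc := (h.absolutelyContinuous_primG i j).continuousOn
  rw [uIcc_of_le zero_le_one] at hc
  have hi : IntegrableOn (fun s => sph (fun x => u x i * x j) s - s * primG G i j s) (Ioo 0 1) := by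
    refine (integrableOn_sph hux).sub ?_
    exact (continuousOn_id.mul hc).integrableOn_Icc.mono_set
      Ioo_subset_Icc_self
  have key := isOpen_Ioo.ae_eq_zero_of_integral_contDiff_smul_eq_zero (μ := volume)
    (hi.locallyIntegrableOn) fun κ h1 _ h3 => by
      obtain ⟨ψ, hψ, hψ2⟩ := exists_deriv_eq_of_test h1 h3
      rw [← h.integral_profile hψ i j, ← setIntegral_eq_integral_of_forall_compl_eq_zero
        (s := Ioo (0 : ℝ) 1)]
      · refine setIntegral_congr_fun measurableSet_Ioo fun s hs => ?_
        simp only [smul_eq_mul, hψ2 s hs.1]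
      · intro s hs
        rw [image_eq_zero_of_notMem_tsupport fun hh => hs (h3 hh), zero_smul]
  rw [ae_restrict_iff' measurableSet_Ioo]
  filter_upwards [key] with s hs hs1
  linarith [hs hs1]

/-- The radial profile is the average of the gradient. -/
lemma IBP.ae_eq_avgG (h : IBP u G) (hr : IsGeneralisedRadial (unitBall d) u) :
    ∀ᵐ x ∂(volume.restrict (unitBall d)), ∀ i, u x i = ∑ k, avgG G ‖x‖ i k * x k := by
  obtain ⟨r, hr⟩ := hr
  have h1 : ∀ᵐ s ∂(volume.restrict (Ioo (0 : ℝ) 1)), ∀ i j,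
      sph (fun x => u x i * x j) s = s * primG G i j s :=
    ae_all_iff.2 fun i => ae_all_iff.2 fun j => h.ae_sph_eq i j
  have h2 : ∀ᵐ s ∂(volume.restrict (Ioo (0 : ℝ) 1)), r s = avgG G s := by
    filter_upwards [h1, ae_polar hr, ae_restrict_mem measurableSet_Ioo] with s hs hs1 hs2
    have hs0 := hs2.1
    ext i j
    have h3 := hs i j
    -- On a fixed sphere `r s` is a constant matrix, recovered from the second moments; no
    -- regularity of `r` is used.
    have h4 : ∫ θ : Metric.sphere (0 : E d) 1, u (s • (θ : E d)) i * (s • (θ : E d)) j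
        ∂(sphMeasure d) = s ^ 2 * (r s i j * ballVol d) := by
      have h5 : ∫ θ : Metric.sphere (0 : E d) 1, u (s • (θ : E d)) i * (s • (θ : E d)) j
          ∂(sphMeasure d) = ∫ θ : Metric.sphere (0 : E d) 1,
            ∑ k, s ^ 2 * r s i k * ((θ : E d) k * (θ : E d) j) ∂(sphMeasure d) := by
        refine integral_congr_ae ?_
        filter_upwards [hs1] with θ hθ
        have hn : ‖s • (θ : E d)‖ = s := by simp [norm_smul, abs_of_pos hs0]
        rw [hθ, hn, toEuclideanLin_apply_coord, Finset.sum_mul]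
        refine Finset.sum_congr rfl fun k _ => ?_
        simp
        ring
      rw [h5, integral_finsetSum]
      · simp only [integral_const_mul, integral_sphere_coord_mul]
        simp
        ring
      · intro k _
        refine Continuous.integrable_of_hasCompactSupport (by fun_prop) ?_
        exact HasCompactSupport.of_compactSpace _
    rw [sph, h4] at h3
    have hd : s ^ d = s ^ (d - 1) * s := by
      rw [← pow_succ, Nat.sub_add_cancel (NeZero.one_le)]
    have hb := (ballVol_pos d).ne'
    simp only [avgG, Matrix.of_apply]
    rw [eq_div_iff (mul_ne_zero hb (by positivity)), hd]
    have h6 : s * (s ^ (d - 1) * s * (r s i j * ballVol d)) = s * primG G i j s := by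
      rw [← h3]; ring
    have h7 := mul_left_cancel₀ hs0.ne' h6
    rw [← h7]
    ring
  filter_upwards [hr, ae_of_ae_norm h2] with x hx hx2 i
  rw [hx, hx2, toEuclideanLin_apply_coord]

end Profile

/-! ### The angular identity -/

section Angular

variable {d : ℕ}

/-- The angular derivative `x_j ∂_k - x_k ∂_j`. -/
def angDeriv (j k : Fin d) (ζ : E d → ℝ) (x : E d) : ℝ := x j * pd k ζ x - x k * pd j ζ x

lemma pd_coord_mul_sub {ζ : E d → ℝ} (hζ : ContDiff ℝ ∞ ζ) (j k : Fin d) (x : E d) :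
    pd k (fun x => x j * ζ x) x - pd j (fun x => x k * ζ x) x = angDeriv j k ζ x := by
  rw [pd_mul (contDiff_coord j) hζ, pd_mul (contDiff_coord k) hζ, pd_coord, pd_coord, angDeriv]
  by_cases h : j = k
  · subst h; simp
  · simp [h, Ne.symm h]

lemma angDeriv_coord_mul {ζ : E d → ℝ} (hζ : ContDiff ℝ ∞ ζ) (j k l : Fin d) (x : E d) :
    angDeriv j k (fun x => x l * ζ x) x = x l * angDeriv j k ζ x +
      ((if k = l then x j else 0) - (if j = l then x k else 0)) * ζ x := by
  simp only [angDeriv, pd_mul (contDiff_coord l) hζ, pd_coord]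
  split_ifs <;> ring

lemma angDeriv_radial_mul {ψ : ℝ → ℝ} (hψ : ContDiff ℝ ∞ ψ) {ζ : E d → ℝ} (hζ : ContDiff ℝ ∞ ζ)
    (j k : Fin d) (x : E d) :
    angDeriv j k (fun x => ψ (‖x‖ ^ 2) * ζ x) x = ψ (‖x‖ ^ 2) * angDeriv j k ζ x := by
  simp only [angDeriv, pd_mul (contDiff_radial hψ) hζ, pd_radial hψ]
  ring

lemma continuous_angDeriv {ζ : E d → ℝ} (hζ : ContDiff ℝ ∞ ζ) (j k : Fin d) :
    Continuous (angDeriv j k ζ) := by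
  have h1 := (contDiff_pd (j := j) hζ).continuous
  have h2 := (contDiff_pd (j := k) hζ).continuous
  unfold angDeriv
  fun_prop

lemma tsupport_pd_subset (j : Fin d) (ζ : E d → ℝ) : tsupport (pd j ζ) ⊆ tsupport ζ :=
  tsupport_fderiv_apply_subset ℝ _

lemma tsupport_angDeriv_subset (j k : Fin d) (ζ : E d → ℝ) :
    tsupport (angDeriv j k ζ) ⊆ tsupport ζ := by
  refine closure_minimal (fun x hx => ?_) (isClosed_tsupport ζ)
  by_contra h
  have h1 := image_eq_zero_of_notMem_tsupport (fun hh => h (tsupport_pd_subset j ζ hh))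
  have h2 := image_eq_zero_of_notMem_tsupport (fun hh => h (tsupport_pd_subset k ζ hh))
  exact hx (by simp [angDeriv, h1, h2])

lemma hasCompactSupport_angDeriv {ζ : E d → ℝ} (hc : HasCompactSupport ζ) (j k : Fin d) :
    HasCompactSupport (angDeriv j k ζ) :=
  hc.of_isClosed_subset (isClosed_tsupport _) (tsupport_angDeriv_subset j k ζ)

lemma setIntegral_eq_of_tsupport_subset {Ω : Set (E d)} {f : E d → ℝ} (h : tsupport f ⊆ Ω) :
    ∫ x in Ω, f x = ∫ x, f x :=
  setIntegral_eq_integral_of_forall_compl_eq_zero fun _ hx =>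
    image_eq_zero_of_notMem_tsupport fun hh => hx (h hh)

lemma integral_angDeriv {Ω : Set (E d)} {ζ : E d → ℝ} (hζ : IsTestFunction Ω ζ) (j k : Fin d) :
    ∫ x in Ω, angDeriv j k ζ x = 0 := by
  rw [setIntegral_eq_of_tsupport_subset ((tsupport_angDeriv_subset j k ζ).trans hζ.2.2)]
  have hj : ∀ l : Fin d, ContDiff ℝ ∞ (fun x : E d => x l * ζ x) := fun l =>
    (contDiff_coord l).mul hζ.1
  have hc : ∀ l : Fin d, HasCompactSupport (fun x : E d => x l * ζ x) := fun l => hζ.2.1.mul_left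
  have hi : ∀ l m : Fin d, Integrable (pd m (fun x : E d => x l * ζ x)) := fun l m =>
    (contDiff_pd (hj l)).continuous.integrable_of_hasCompactSupport (hasCompactSupport_pd (hc l))
  simp only [← pd_coord_mul_sub hζ.1]
  rw [integral_sub (hi j k) (hi k j), integral_pd_eq_zero (hj j) (hc j),
    integral_pd_eq_zero (hj k) (hc k), sub_self]

lemma isTestFunction_mul {Ω : Set (E d)} {f ζ : E d → ℝ} (hf : ContDiff ℝ ∞ f)
    (hζ : IsTestFunction Ω ζ) : IsTestFunction Ω (fun x => f x * ζ x) :=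
  ⟨hf.mul hζ.1, hζ.2.1.mul_left, (tsupport_mul_subset_right).trans hζ.2.2⟩

/-- The punctured unit ball. -/
def puncturedBall (d : ℕ) : Set (E d) := unitBall d \ {0}

lemma isOpen_puncturedBall : IsOpen (puncturedBall d) :=
  (isOpen_unitBall d).sdiff isClosed_singleton

variable [NeZero d]

/-- Radial factors commute with the angular derivative, so its integral vanishes against every
radial test function, hence on almost every sphere. -/
lemma ae_sph_angDeriv {ζ : E d → ℝ} (hζ : IsTestFunction (unitBall d) ζ) (j k : Fin d) :
    ∀ᵐ s ∂(volume.restrict (Ioo (0 : ℝ) 1)), sph (angDeriv j k ζ) s = 0 := by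
  have hi : IntegrableOn (angDeriv j k ζ) (unitBall d) :=
    integrableOn_of_continuous (continuous_angDeriv hζ.1 j k)
  have key := isOpen_Ioo.ae_eq_zero_of_integral_contDiff_smul_eq_zero (μ := volume)
    (integrableOn_sph hi).locallyIntegrableOn fun κ h1 _ h3 => by
      obtain ⟨ψ, hψ, hψ2⟩ := exists_deriv_eq_of_test h1 h3
      have hψ' : ContDiff ℝ ∞ (fun t => 2 * deriv ψ t) :=
        contDiff_const.mul (contDiff_infty_iff_deriv.1 hψ).2
      have h4 := integral_angDeriv (isTestFunction_mul (contDiff_radial hψ') hζ) j k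
      simp only [angDeriv_radial_mul hψ' hζ.1] at h4
      have h5 : ∫ x in unitBall d, 2 * deriv ψ (‖x‖ ^ 2) * angDeriv j k ζ x =
          ∫ s in Ioo (0 : ℝ) 1, 2 * deriv ψ (s ^ 2) * sph (angDeriv j k ζ) s := by
        refine integral_radial_mul (ψ := fun s => 2 * deriv ψ (s ^ 2)) ?_
        exact integrableOn_of_continuous
          ((contDiff_radial hψ').continuous.mul (continuous_angDeriv hζ.1 j k))
      rw [h5] at h4
      rw [← h4, ← setIntegral_eq_integral_of_forall_compl_eq_zero (s := Ioo (0 : ℝ) 1)]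
      · refine setIntegral_congr_fun measurableSet_Ioo fun s hs => ?_
        simp only [smul_eq_mul, hψ2 s hs.1]
      · intro s hs
        rw [image_eq_zero_of_notMem_tsupport fun hh => hs (h3 hh), zero_smul]
  rw [ae_restrict_iff' measurableSet_Ioo]
  exact key

/-- A radial coefficient acts as a constant for the angular derivative, and needs no smoothness.
This allows integrating by parts against `avgG G ‖x‖`. -/
lemma integral_radial_mul_angDeriv {a : ℝ → ℝ} {ζ : E d → ℝ}
    (hζ : IsTestFunction (unitBall d) ζ) (j k : Fin d)
    (hi : IntegrableOn (fun x => a ‖x‖ * angDeriv j k ζ x) (unitBall d)) :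
    ∫ x in unitBall d, a ‖x‖ * angDeriv j k ζ x = 0 := by
  rw [integral_radial_mul hi]
  refine integral_eq_zero_of_ae ?_
  filter_upwards [ae_sph_angDeriv hζ j k] with s hs
  simp [hs]

variable {u : E d → E d} {G : E d → M d}

lemma restrict_puncturedBall :
    (volume : Measure (E d)).restrict (puncturedBall d) = volume.restrict (unitBall d) := by
  refine Measure.restrict_congr_set ?_
  exact sdiff_null_ae_eq_self (by simp)

lemma IBP.continuousOn_avgG (h : IBP u G) (i j : Fin d) :
    ContinuousOn (fun x : E d => avgG G ‖x‖ i j) (puncturedBall d) := by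
  have h1 := (h.absolutelyContinuous_primG i j).continuousOn
  rw [uIcc_of_le zero_le_one] at h1
  have h2 : ContinuousOn (fun x : E d => primG G i j ‖x‖) (puncturedBall d) :=
    h1.comp continuous_norm.continuousOn fun x hx =>
      ⟨norm_nonneg _, (mem_ball_zero_iff.1 hx.1).le⟩
  simp only [avgG, Matrix.of_apply]
  refine h2.div (by fun_prop) fun x hx => ?_
  have := norm_pos_iff.2 hx.2
  have := ballVol_pos d
  positivity

lemma IBP.integrableOn_avgG_mul (h : IBP u G) (i j : Fin d) {φ : E d → ℝ} (hφ : Continuous φ)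
    (hc : HasCompactSupport φ) (hs : tsupport φ ⊆ puncturedBall d) :
    IntegrableOn (fun x => avgG G ‖x‖ i j * φ x) (unitBall d) := by
  rw [IntegrableOn, ← restrict_puncturedBall]
  exact LocallyIntegrableOn.integrableOn_mul_test
    ((h.continuousOn_avgG i j).locallyIntegrableOn isOpen_puncturedBall.measurableSet) hφ hc hs

lemma IBP.integral_avgG_mul_coord (h : IBP u G) {ζ : E d → ℝ}
    (hζ : IsTestFunction (puncturedBall d) ζ) (i j k l : Fin d) :
    ∫ x in unitBall d, avgG G ‖x‖ i l * (x l * angDeriv j k ζ x) =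
      -∫ x in unitBall d, avgG G ‖x‖ i l *
        (((if k = l then x j else 0) - (if j = l then x k else 0)) * ζ x) := by
  have hB : puncturedBall d ⊆ unitBall d := sdiff_subset
  have hz := isTestFunction_mul (contDiff_coord l) hζ
  have hz' : IsTestFunction (unitBall d) (fun x : E d => x l * ζ x) :=
    ⟨hz.1, hz.2.1, hz.2.2.trans hB⟩
  have i1 := h.integrableOn_avgG_mul i l (continuous_angDeriv hz.1 j k)
    (hasCompactSupport_angDeriv hz.2.1 j k) ((tsupport_angDeriv_subset j k _).trans hz.2.2)
  have i2 : IntegrableOn (fun x => avgG G ‖x‖ i l *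
      (((if k = l then x j else 0) - (if j = l then x k else 0)) * ζ x)) (unitBall d) := by
    refine h.integrableOn_avgG_mul i l ?_ hζ.2.1.mul_left (tsupport_mul_subset_right.trans hζ.2.2)
    refine Continuous.mul ?_ hζ.1.continuous
    split_ifs <;> fun_prop
  have h1 := integral_radial_mul_angDeriv (a := fun s => avgG G s i l) hz' j k i1
  have e : ∀ x : E d, avgG G ‖x‖ i l * (x l * angDeriv j k ζ x) =
      avgG G ‖x‖ i l * angDeriv j k (fun x => x l * ζ x) x - avgG G ‖x‖ i l *
        (((if k = l then x j else 0) - (if j = l then x k else 0)) * ζ x) := fun x => by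
    rw [angDeriv_coord_mul hζ.1]; ring
  simp only [e]
  rw [integral_sub i1 i2, h1, zero_sub]

/-- The integral of `u_i` against an angular derivative is computed twice: through the weak
gradient, and through `u = A(|x|) x` with `A` treated as constant. Supports avoid the origin, where
`A` may be singular. The outcome says that each row of `G - A` is parallel to `x`. -/
lemma IBP.integral_angular (h : IBP u G) (hr : IsGeneralisedRadial (unitBall d) u) {ζ : E d → ℝ}
    (hζ : IsTestFunction (puncturedBall d) ζ) (i j k : Fin d) :
    ∫ x in unitBall d, (x j * (G x i k - avgG G ‖x‖ i k) - x k * (G x i j - avgG G ‖x‖ i j)) * ζ x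
      = 0 := by
  have hx : ∀ l : Fin d, ContDiff ℝ ∞ (fun x : E d => x l * ζ x) := fun l =>
    (contDiff_coord l).mul hζ.1
  have ip : ∀ l m : Fin d, IntegrableOn (fun x => u x i * pd m (fun x => x l * ζ x) x)
      (unitBall d) := fun l m =>
    integrableOn_mul_continuous (h.integrable_fun i) (contDiff_pd (hx l)).continuous
  have ig : ∀ l m : Fin d, IntegrableOn (fun x => G x i m * (x l * ζ x)) (unitBall d) :=
    fun l m => integrableOn_mul_continuous (h.integrable_grad i m) (hx l).continuous
  have ia : ∀ l m : Fin d, IntegrableOn (fun x => avgG G ‖x‖ i m * (x l * ζ x)) (unitBall d) :=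
    fun l m => h.integrableOn_avgG_mul i m (hx l).continuous hζ.2.1.mul_left
      (tsupport_mul_subset_right.trans hζ.2.2)
  have h1 : ∫ x in unitBall d, u x i * angDeriv j k ζ x =
      -(∫ x in unitBall d, G x i k * (x j * ζ x)) + ∫ x in unitBall d, G x i j * (x k * ζ x) := by
    simp only [← pd_coord_mul_sub hζ.1, mul_sub]
    rw [integral_sub (ip j k) (ip k j), h.integral_eq _ (hx j), h.integral_eq _ (hx k)]
    ring
  have h2 : ∫ x in unitBall d, u x i * angDeriv j k ζ x =
      -(∫ x in unitBall d, avgG G ‖x‖ i k * (x j * ζ x)) +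
        ∫ x in unitBall d, avgG G ‖x‖ i j * (x k * ζ x) := by
    have h3 : ∫ x in unitBall d, u x i * angDeriv j k ζ x =
        ∫ x in unitBall d, ∑ l, avgG G ‖x‖ i l * (x l * angDeriv j k ζ x) := by
      refine integral_congr_ae ?_
      filter_upwards [h.ae_eq_avgG hr] with x hx
      rw [hx i, Finset.sum_mul]
      exact Finset.sum_congr rfl fun l _ => mul_assoc _ _ _
    rw [h3, integral_finsetSum]
    · simp only [h.integral_avgG_mul_coord hζ]
      rw [Finset.sum_neg_distrib, ← integral_finsetSum]
      · rw [neg_eq_iff_eq_neg, neg_add, neg_neg, ← sub_eq_add_neg, ← integral_sub (ia j k) (ia k j)]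
        refine integral_congr_ae (Eventually.of_forall fun x => ?_)
        simp only [sub_mul, mul_sub, Finset.sum_sub_distrib, ite_mul, mul_ite, zero_mul, mul_zero,
          Finset.sum_ite_eq, Finset.mem_univ, if_true]
      · intro l _
        refine h.integrableOn_avgG_mul i l ?_ hζ.2.1.mul_left
          (tsupport_mul_subset_right.trans hζ.2.2)
        refine Continuous.mul ?_ hζ.1.continuous
        split_ifs <;> fun_prop
    · intro l _
      exact h.integrableOn_avgG_mul i l
        ((contDiff_coord l).continuous.mul (continuous_angDeriv hζ.1 j k))
        (hasCompactSupport_angDeriv hζ.2.1 j k).mul_left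
        (tsupport_mul_subset_right.trans ((tsupport_angDeriv_subset j k ζ).trans hζ.2.2))
  have h4 : ∀ x : E d,
      (x j * (G x i k - avgG G ‖x‖ i k) - x k * (G x i j - avgG G ‖x‖ i j)) * ζ x =
      (G x i k * (x j * ζ x) - G x i j * (x k * ζ x)) -
        (avgG G ‖x‖ i k * (x j * ζ x) - avgG G ‖x‖ i j * (x k * ζ x)) := fun x => by ring
  simp only [h4]
  have i1 : IntegrableOn (fun x => G x i k * (x j * ζ x) - G x i j * (x k * ζ x)) (unitBall d) :=
    (ig j k).sub (ig k j)
  have i2 : IntegrableOn (fun x => avgG G ‖x‖ i k * (x j * ζ x) - avgG G ‖x‖ i j * (x k * ζ x))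
      (unitBall d) := (ia j k).sub (ia k j)
  rw [integral_sub i1 i2, integral_sub (ig j k) (ig k j), integral_sub (ia j k) (ia k j)]
  linarith

/-- The gradient differs from its radial average by a rank-one matrix `b ⊗ x`. -/
lemma IBP.ae_eq_add_vecMulVec (h : IBP u G) (hr : IsGeneralisedRadial (unitBall d) u) :
    ∀ᵐ x ∂(volume.restrict (unitBall d)), ∃ b : Fin d → ℝ,
      G x = avgG G ‖x‖ + Matrix.vecMulVec b (fun k => x k) := by
  have key : ∀ i j k, ∀ᵐ x ∂(volume.restrict (puncturedBall d)),
      x j * (G x i k - avgG G ‖x‖ i k) - x k * (G x i j - avgG G ‖x‖ i j) = 0 := by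
    intro i j k
    refine ae_eq_zero_of_forall_test isOpen_puncturedBall ?_ fun φ hφ => ?_
    · have hl : ∀ l, LocallyIntegrableOn (fun x => G x i l - avgG G ‖x‖ i l) (puncturedBall d) :=
        fun l => (((h.integrable_grad i l).mono_set sdiff_subset).locallyIntegrableOn).sub
          ((h.continuousOn_avgG i l).locallyIntegrableOn isOpen_puncturedBall.measurableSet)
      have hm : ∀ l m : Fin d, LocallyIntegrableOn
          (fun x => x m * (G x i l - avgG G ‖x‖ i l)) (puncturedBall d) := fun l m =>
        (hl l).continuousOn_mul (contDiff_coord m).continuous.continuousOn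
          isOpen_puncturedBall.isLocallyClosed
      exact (hm k j).sub (hm j k)
    · rw [restrict_puncturedBall]
      exact h.integral_angular hr hφ i j k
  have key2 : ∀ᵐ x ∂(volume.restrict (puncturedBall d)), ∀ i j k,
      x j * (G x i k - avgG G ‖x‖ i k) - x k * (G x i j - avgG G ‖x‖ i j) = 0 :=
    ae_all_iff.2 fun i => ae_all_iff.2 fun j => ae_all_iff.2 fun k => key i j k
  rw [← restrict_puncturedBall]
  filter_upwards [key2, ae_restrict_mem isOpen_puncturedBall.measurableSet] with x hx hx0
  -- A matrix of the form `b ⊗ x` has `b = (G - A) x / |x|²`.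
  refine ⟨fun i => (∑ j, x j * (G x i j - avgG G ‖x‖ i j)) / ‖x‖ ^ 2, ?_⟩
  have hn : ‖x‖ ^ 2 ≠ 0 := by
    have := norm_pos_iff.2 hx0.2
    positivity
  ext i k
  rw [Matrix.add_apply, Matrix.vecMulVec_apply, div_mul_eq_mul_div, Finset.sum_mul]
  have h1 : ∑ j, x j * (G x i j - avgG G ‖x‖ i j) * x k =
      ‖x‖ ^ 2 * (G x i k - avgG G ‖x‖ i k) := by
    rw [EuclideanSpace.norm_sq_eq, Finset.sum_mul]
    refine Finset.sum_congr rfl fun j _ => ?_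
    rw [Real.norm_eq_abs, sq_abs]
    linear_combination -(x j) * hx i j k
  rw [h1, mul_div_cancel_left₀ _ hn]
  ring

end Angular

/-! ### The integral inequality for functions below their rank-one tangents -/

section Tangent

variable {d : ℕ}

lemma matrix_eq_sum_smul_single (B : M d) :
    B = ∑ i, ∑ j, B i j • (Matrix.single i j 1 : M d) := by
  conv_lhs => rw [Matrix.matrix_eq_sum_single B]
  simp [Matrix.smul_single]

lemma clm_apply_eq_sum (ℓ : M d →L[ℝ] ℝ) (B : M d) :
    ℓ B = ∑ i, ∑ j, B i j * ℓ (Matrix.single i j 1) := by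
  conv_lhs => rw [matrix_eq_sum_smul_single B]
  simp only [map_sum, map_smul, smul_eq_mul]

lemma memLp_matrix {q : ENNReal} {μ : Measure (E d)} {G : E d → M d}
    (h : ∀ i j, MemLp (fun x => G x i j) q μ) : MemLp G q μ := by
  have h1 : G = fun x => ∑ i, ∑ j, G x i j • (Matrix.single i j 1 : M d) :=
    funext fun x => matrix_eq_sum_smul_single (G x)
  rw [h1]
  refine memLp_finsetSum _ fun i _ => memLp_finsetSum _ fun j _ => ?_
  exact (ContinuousLinearMap.toSpanSingleton ℝ (Matrix.single i j 1 : M d)).comp_memLp' (h i j)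

lemma integral_matrix_apply {μ : Measure (E d)} {G : E d → M d} (h : Integrable G μ) (i j : Fin d) :
    (∫ x, G x ∂μ) i j = ∫ x, G x i j ∂μ :=
  ((entryL i j).integral_comp_comm h).symm

/-! ### Absolute continuity -/

lemma AbsolutelyContinuousOnInterval.comp_lipschitzOnWith {X Y : Type*} [PseudoMetricSpace X]
    [PseudoMetricSpace Y] {f : ℝ → X} {g : X → Y} {a b : ℝ} {s : Set X} {K : NNReal}
    (hf : AbsolutelyContinuousOnInterval f a b) (hg : LipschitzOnWith K g s)
    (hs : MapsTo f (uIcc a b) s) : AbsolutelyContinuousOnInterval (fun t => g (f t)) a b := by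
  have h0 : Tendsto (fun E : ℕ × (ℕ → ℝ × ℝ) =>
      (K : ℝ) * ∑ i ∈ Finset.range E.1, dist (f (E.2 i).1) (f (E.2 i).2))
      (AbsolutelyContinuousOnInterval.totalLengthFilter ⊓
        𝓟 (AbsolutelyContinuousOnInterval.disjWithin a b)) (𝓝 0) := by
    simpa using Tendsto.const_mul (K : ℝ) hf
  refine squeeze_zero' (Eventually.of_forall fun E => Finset.sum_nonneg fun i _ => dist_nonneg) ?_ h0
  filter_upwards [mem_inf_of_right (mem_principal_self _)] with E hE
  rw [Finset.mul_sum]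
  refine Finset.sum_le_sum fun i hi => ?_
  exact hg.dist_le_mul _ (hs (hE.1 i hi).1) _ (hs (hE.1 i hi).2)

lemma AbsolutelyContinuousOnInterval.smul_const {F : Type*} [NormedAddCommGroup F]
    [NormedSpace ℝ F] {f : ℝ → ℝ} {a b : ℝ} (hf : AbsolutelyContinuousOnInterval f a b) (v : F) :
    AbsolutelyContinuousOnInterval (fun t => f t • v) a b := by
  have h1 : LipschitzWith ‖v‖₊ (fun c : ℝ => c • v) := LipschitzWith.of_dist_le_mul fun x y => by
    rw [dist_eq_norm, dist_eq_norm, ← sub_smul, norm_smul, mul_comm, coe_nnnorm]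
  exact AbsolutelyContinuousOnInterval.comp_lipschitzOnWith (g := fun c : ℝ => c • v) hf
    (h1.lipschitzOnWith (s := univ)) fun _ _ => trivial

lemma AbsolutelyContinuousOnInterval.finset_sum {ι F : Type*} [SeminormedAddCommGroup F]
    (t : Finset ι) {f : ι → ℝ → F} {a b : ℝ}
    (h : ∀ i ∈ t, AbsolutelyContinuousOnInterval (f i) a b) :
    AbsolutelyContinuousOnInterval (fun s => ∑ i ∈ t, f i s) a b := by
  classical
  induction t using Finset.induction_on with
  | empty =>
    simpa using (LipschitzWith.const (0 : F)).lipschitzOnWith.absolutelyContinuousOnInterval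
  | insert i t hi ih =>
    simp only [Finset.sum_insert hi]
    exact (h i (Finset.mem_insert_self _ _)).add
      (ih fun k hk => h k (Finset.mem_insert_of_mem hk))

/-- The energy of the average on the ball of radius `s`. -/
def energyG (U : M d → ℝ) (G : E d → M d) (s : ℝ) : ℝ := ballVol d * s ^ d * U (avgG G s)

lemma avgG_eq_sum (G : E d → M d) : avgG G = fun s =>
    ∑ i, ∑ j, ((ballVol d * s ^ d)⁻¹ * primG G i j s) • (Matrix.single i j 1 : M d) := by
  funext s
  rw [matrix_eq_sum_smul_single (avgG G s)]
  simp only [avgG, Matrix.of_apply, div_eq_inv_mul]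

variable [NeZero d] {u : E d → E d} {G : E d → M d} {U : M d → ℝ} {p C : ℝ}

/-! ### Averages over balls and their energy -/

lemma integral_ball_eq {f : E d → ℝ} (hf : IntegrableOn f (unitBall d)) {ε : ℝ} (h0 : 0 ≤ ε)
    (h1 : ε ≤ 1) : ∫ x in Metric.ball (0 : E d) ε, f x = ∫ s in (0 : ℝ)..ε, sph f s := by
  have hsub : Metric.ball (0 : E d) ε ⊆ unitBall d := Metric.ball_subset_ball h1
  have e1 : ∀ x : E d, (Iio ε).indicator (fun _ => (1 : ℝ)) ‖x‖ * f x =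
      (Metric.ball (0 : E d) ε).indicator f x := by
    intro x
    by_cases hx : ‖x‖ < ε <;> simp [indicator, hx]
  have hi : IntegrableOn (fun x : E d => (Iio ε).indicator (fun _ => (1 : ℝ)) ‖x‖ * f x)
      (unitBall d) := by
    simp only [e1]
    exact hf.indicator Metric.isOpen_ball.measurableSet
  have h2 := integral_radial_mul hi
  simp only [e1] at h2
  rw [setIntegral_indicator Metric.isOpen_ball.measurableSet, inter_eq_right.2 hsub] at h2
  rw [h2, intervalIntegral.integral_of_le h0, integral_Ioc_eq_integral_Ioo]
  have e2 : ∀ s : ℝ, (Iio ε).indicator (fun _ => (1 : ℝ)) s * sph f s =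
      (Iio ε).indicator (sph f) s := by
    intro s
    by_cases hs : s < ε <;> simp [indicator, hs]
  simp only [e2]
  rw [setIntegral_indicator measurableSet_Iio, Ioo_inter_Iio, min_eq_right h1]

lemma volume_real_ball {ε : ℝ} (h0 : 0 ≤ ε) :
    (volume : Measure (E d)).real (Metric.ball 0 ε) = ballVol d * ε ^ d := by
  rw [measureReal_def, Measure.addHaar_ball _ _ h0, ENNReal.toReal_mul,
    ENNReal.toReal_ofReal (by positivity), finrank_euclideanSpace_fin, mul_comm]
  rfl

lemma setAverage_ball_eq (hG : IntegrableOn G (unitBall d)) {ε : ℝ} (h0 : 0 ≤ ε) (h1 : ε ≤ 1) :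
    ⨍ x in Metric.ball (0 : E d) ε, G x = avgG G ε := by
  have hsub : Metric.ball (0 : E d) ε ⊆ unitBall d := Metric.ball_subset_ball h1
  ext i j
  rw [setAverage_eq, volume_real_ball h0, Matrix.smul_apply,
    integral_matrix_apply (hG.mono_set hsub), integral_ball_eq _ h0 h1]
  · simp only [avgG, Matrix.of_apply, primG, smul_eq_mul]
    ring
  · exact (entryL i j).integrable_comp hG

/-- Jensen's inequality on the ball of radius `ε`; it controls the energy near the origin. -/
lemma norm_avgG_rpow_le (hp : 1 ≤ p) (hG : IntegrableOn G (unitBall d))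
    (hGp : IntegrableOn (fun x => ‖G x‖ ^ p) (unitBall d)) {ε : ℝ} (h0 : 0 < ε) (h1 : ε ≤ 1) :
    ballVol d * ε ^ d * ‖avgG G ε‖ ^ p ≤ ∫ s in (0 : ℝ)..ε, sph (fun x => ‖G x‖ ^ p) s := by
  have hsub : Metric.ball (0 : E d) ε ⊆ unitBall d := Metric.ball_subset_ball h1
  have hconv : ConvexOn ℝ univ (fun A : M d => ‖A‖ ^ p) := by
    refine ConvexOn.comp (g := fun t : ℝ => t ^ p) ?_ (convexOn_norm convex_univ) ?_
    · refine (convexOn_rpow hp).subset ?_ ?_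
      · rintro _ ⟨A, _, rfl⟩; exact norm_nonneg A
      -- The image of the norm is an interval, since matrices can be rescaled.
      · refine OrdConnected.convex ⟨?_⟩
        rintro _ ⟨A, _, rfl⟩ _ ⟨B, _, rfl⟩ t ht
        rcases eq_or_ne B 0 with hB | hB
        · refine ⟨0, trivial, ?_⟩
          have h3 : ‖B‖ = 0 := by rw [hB, norm_zero]
          have h4 := norm_nonneg A
          simp only [norm_zero]
          linarith [ht.1, ht.2]
        · have hB' := norm_pos_iff.2 hB
          have ht0 : 0 ≤ t := (norm_nonneg A).trans ht.1
          refine ⟨(t / ‖B‖) • B, trivial, ?_⟩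
          simp only [norm_smul, Real.norm_eq_abs]
          rw [abs_of_nonneg (by positivity), div_mul_cancel₀ _ hB'.ne']
    · rintro _ ⟨A, _, rfl⟩ _ ⟨B, _, rfl⟩ h
      exact Real.rpow_le_rpow (norm_nonneg A) h (by linarith)
  have hcont : Continuous (fun A : M d => ‖A‖ ^ p) :=
    continuous_norm.rpow_const fun _ => Or.inr (by linarith)
  have h2 := hconv.map_set_average_le (μ := volume) (t := Metric.ball (0 : E d) ε) (f := G)
    hcont.continuousOn isClosed_univ (Metric.measure_ball_pos _ _ h0).ne' measure_ball_lt_top.ne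
    (by simp) (hG.mono_set hsub) (hGp.mono_set hsub)
  rw [setAverage_ball_eq hG h0.le h1, setAverage_eq, volume_real_ball h0.le,
    integral_ball_eq hGp h0.le h1, smul_eq_mul, inv_mul_eq_div, le_div_iff₀
      (mul_pos (ballVol_pos d) (pow_pos h0 d))] at h2
  linarith

lemma IBP.absolutelyContinuous_avgG (h : IBP u G) {ε : ℝ} (h0 : 0 < ε) (h1 : ε ≤ 1) :
    AbsolutelyContinuousOnInterval (avgG G) ε 1 := by
  have hb := ballVol_pos d
  have hc : AbsolutelyContinuousOnInterval (fun s : ℝ => (ballVol d * s ^ d)⁻¹) ε 1 := by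
    refine ContDiffOn.absolutelyContinuousOnInterval (ContDiffOn.inv (by fun_prop) fun s hs => ?_)
    rw [uIcc_of_le h1] at hs
    have : 0 < s := h0.trans_le hs.1
    positivity
  rw [avgG_eq_sum]
  refine AbsolutelyContinuousOnInterval.finset_sum _ fun i _ =>
    AbsolutelyContinuousOnInterval.finset_sum _ fun j _ => ?_
  have hN := (h.absolutelyContinuous_primG i j).mono (c := ε) (d := 1) (by
    rw [uIcc_of_le h1, uIcc_of_le zero_le_one]
    exact Icc_subset_Icc_left h0.le)
  exact AbsolutelyContinuousOnInterval.smul_const (hc.fun_mul hN) _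

lemma IBP.absolutelyContinuous_energyG (h : IBP u G) (hU : ContDiff ℝ 1 U) {ε : ℝ} (h0 : 0 < ε)
    (h1 : ε ≤ 1) : AbsolutelyContinuousOnInterval (energyG U G) ε 1 := by
  have hA := h.absolutelyContinuous_avgG h0 h1
  obtain ⟨R, hR⟩ := hA.exists_bound
  obtain ⟨K, hK⟩ := (hU.contDiffOn (s := Metric.closedBall 0 R)).exists_lipschitzOnWith
    (by simp) (convex_closedBall _ _) (isCompact_closedBall _ _)
  have h2 := AbsolutelyContinuousOnInterval.comp_lipschitzOnWith hA hK
    fun s hs => mem_closedBall_zero_iff.2 (hR s hs)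
  have h3 : AbsolutelyContinuousOnInterval (fun s : ℝ => ballVol d * s ^ d) ε 1 :=
    ContDiffOn.absolutelyContinuousOnInterval (by fun_prop)
  exact h3.mul h2

/-- The derivative of the average is the flux minus `d |B| s^{d-1} A(s)`, divided by `|B| s^d`; the
volume prefactor of the energy cancels the denominator. The result is the upper bound in
`IBP.ae_sph_comp_le`. -/
lemma IBP.ae_hasDerivAt_energyG (h : IBP u G) (hU : ContDiff ℝ 1 U) :
    ∀ᵐ s ∂(volume.restrict (Ioo (0 : ℝ) 1)), HasDerivAt (energyG U G)
      (d * ballVol d * s ^ (d - 1) * U (avgG G s) + ∑ i, ∑ j,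
        (sph (fun x => G x i j) s - d * ballVol d * s ^ (d - 1) * avgG G s i j) *
          fderiv ℝ U (avgG G s) (Matrix.single i j 1)) s := by
  have h1 : ∀ᵐ s ∂(volume.restrict (Ioo (0 : ℝ) 1)), ∀ i j,
      HasDerivAt (primG G i j) (sph (fun x => G x i j) s) s :=
    ae_all_iff.2 fun i => ae_all_iff.2 fun j => h.ae_hasDerivAt_primG i j
  filter_upwards [h1, ae_restrict_mem measurableSet_Ioo] with s hs hs1
  have hb := (ballVol_pos d).ne'
  have hs0 := hs1.1.ne'
  have hv : ballVol d * s ^ d ≠ 0 := mul_ne_zero hb (pow_ne_zero _ hs0)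
  have hw : HasDerivAt (fun s : ℝ => ballVol d * s ^ d) (ballVol d * (d * s ^ (d - 1))) s :=
    (hasDerivAt_pow d s).const_mul _
  have hA : HasDerivAt (avgG G) (∑ i, ∑ j,
      (-(ballVol d * (d * s ^ (d - 1))) / (ballVol d * s ^ d) ^ 2 * primG G i j s +
        (ballVol d * s ^ d)⁻¹ * sph (fun x => G x i j) s) • (Matrix.single i j 1 : M d)) s := by
    rw [avgG_eq_sum]
    exact HasDerivAt.fun_sum fun i _ => HasDerivAt.fun_sum fun j _ =>
      ((hw.fun_inv hv).mul (hs i j)).smul_const _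
  have hUA := ((hU.differentiable one_ne_zero) (avgG G s)).hasFDerivAt.comp_hasDerivAt s hA
  refine (hw.mul hUA).congr_deriv ?_
  simp only [map_sum, map_smul, smul_eq_mul, Function.comp_apply]
  congr 1
  · ring
  · rw [Finset.mul_sum]
    refine Finset.sum_congr rfl fun i _ => ?_
    rw [Finset.mul_sum]
    refine Finset.sum_congr rfl fun j _ => ?_
    set y := fderiv ℝ U (avgG G s) (Matrix.single i j 1)
    simp only [avgG, Matrix.of_apply]
    field_simp
    ring

/-- On a sphere the average `A` is fixed and `G - A` is rank-one, so the tangent inequality at `A`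
applies pointwise and can be integrated. -/
lemma IBP.ae_sph_comp_le (h : IBP u G) (hr : IsGeneralisedRadial (unitBall d) u)
    (hUG : IntegrableOn (fun x => U (G x)) (unitBall d))
    (htan : ∀ (A : M d) (a b : Fin d → ℝ), U (A + Matrix.vecMulVec a b) ≤
      U A + fderiv ℝ U A (Matrix.vecMulVec a b)) :
    ∀ᵐ s ∂(volume.restrict (Ioo (0 : ℝ) 1)), sph (fun x => U (G x)) s ≤
      d * ballVol d * s ^ (d - 1) * U (avgG G s) + ∑ i, ∑ j,
        (sph (fun x => G x i j) s - d * ballVol d * s ^ (d - 1) * avgG G s i j) *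
          fderiv ℝ U (avgG G s) (Matrix.single i j 1) := by
  have h1 : ∀ᵐ s ∂(volume.restrict (Ioo (0 : ℝ) 1)), ∀ i j,
      Integrable (fun θ : Metric.sphere (0 : E d) 1 => G (s • (θ : E d)) i j) (sphMeasure d) :=
    ae_all_iff.2 fun i => ae_all_iff.2 fun j => ae_integrable_sphere (h.integrable_grad i j)
  filter_upwards [h1, ae_integrable_sphere hUG, ae_polar (h.ae_eq_add_vecMulVec hr),
    ae_restrict_mem measurableSet_Ioo] with s hi hUi hs hs1
  have hs0 := hs1.1
  set A := avgG G s with hA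
  set ℓ := fderiv ℝ U A with hℓ
  have hterm : ∀ i j, Integrable (fun θ : Metric.sphere (0 : E d) 1 =>
      (G (s • (θ : E d)) i j - A i j) * ℓ (Matrix.single i j 1)) (sphMeasure d) := fun i j =>
    ((hi i j).sub (integrable_const _)).mul_const _
  have hint : Integrable (fun θ : Metric.sphere (0 : E d) 1 =>
      U A + ∑ i, ∑ j, (G (s • (θ : E d)) i j - A i j) * ℓ (Matrix.single i j 1))
      (sphMeasure d) :=
    (integrable_const _).add (integrable_finsetSum _ fun i _ => integrable_finsetSum _ fun j _ =>
      hterm i j)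
  have hle : ∫ θ : Metric.sphere (0 : E d) 1, U (G (s • (θ : E d))) ∂(sphMeasure d) ≤
      ∫ θ : Metric.sphere (0 : E d) 1,
        (U A + ∑ i, ∑ j, (G (s • (θ : E d)) i j - A i j) * ℓ (Matrix.single i j 1))
        ∂(sphMeasure d) := by
    refine integral_mono_ae hUi hint ?_
    filter_upwards [hs] with θ hθ
    obtain ⟨b, hb⟩ := hθ
    have hn : ‖s • (θ : E d)‖ = s := by simp [norm_smul, abs_of_pos hs0]
    rw [hn] at hb
    have h2 := htan A b (fun k => (s • (θ : E d)) k)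
    rw [← hb, clm_apply_eq_sum] at h2
    refine h2.trans_eq ?_
    congr 1
    refine Finset.sum_congr rfl fun i _ => Finset.sum_congr rfl fun j _ => ?_
    rw [hb, Matrix.add_apply, add_sub_cancel_left]
  have heq : ∫ θ : Metric.sphere (0 : E d) 1,
      (U A + ∑ i, ∑ j, (G (s • (θ : E d)) i j - A i j) * ℓ (Matrix.single i j 1))
        ∂(sphMeasure d) = d * ballVol d * U A + ∑ i, ∑ j,
        ((∫ θ : Metric.sphere (0 : E d) 1, G (s • (θ : E d)) i j ∂(sphMeasure d)) -
          d * ballVol d * A i j) * ℓ (Matrix.single i j 1) := by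
    rw [integral_add (integrable_const _) (integrable_finsetSum _ fun i _ =>
      integrable_finsetSum _ fun j _ => hterm i j), integral_const, sphMeasure_real_univ,
      smul_eq_mul, integral_finsetSum _ fun i _ => integrable_finsetSum _ fun j _ => hterm i j]
    congr 1
    refine Finset.sum_congr rfl fun i _ => ?_
    rw [integral_finsetSum _ fun j _ => hterm i j]
    refine Finset.sum_congr rfl fun j _ => ?_
    rw [integral_mul_const, integral_sub (hi i j) (integrable_const _), integral_const,
      sphMeasure_real_univ, smul_eq_mul]
  rw [heq] at hle
  have hs2 : 0 ≤ s ^ (d - 1) := pow_nonneg hs0.le _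
  refine (mul_le_mul_of_nonneg_left hle hs2).trans_eq ?_
  rw [mul_add, Finset.mul_sum]
  congr 1
  · ring
  · refine Finset.sum_congr rfl fun i _ => ?_
    rw [Finset.mul_sum]
    refine Finset.sum_congr rfl fun j _ => ?_
    rw [sph]
    ring

lemma IBP.avgG_one (h : IBP u G) : avgG G 1 = 0 := by
  ext i j
  simp [avgG, h.primG_one]

/-- By growth and Jensen, the energy is at most `C (|B_ε| + ∫_{B_ε} |G|^p)`. -/
lemma tendsto_energyG (hp : 1 ≤ p) (hC : ∀ A, |U A| ≤ C * (1 + ‖A‖ ^ p))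
    (hG : IntegrableOn G (unitBall d)) (hGp : IntegrableOn (fun x => ‖G x‖ ^ p) (unitBall d)) :
    Tendsto (energyG U G) (𝓝[>] 0) (𝓝 0) := by
  have hC0 : 0 ≤ C := by
    have := (abs_nonneg _).trans (hC 0)
    rw [norm_zero, Real.zero_rpow (by linarith)] at this
    linarith
  have hac := (intervalIntegrable_of_Ioo
    (integrableOn_sph hGp)).absolutelyContinuousOnInterval_intervalIntegral (c := 0) (by simp)
  have hb := ballVol_pos d
  have hcont := hac.continuousOn 0 (by simp)
  rw [uIcc_of_le zero_le_one, ContinuousWithinAt, intervalIntegral.integral_same] at hcont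
  have h1 : Tendsto (fun ε => ∫ s in (0 : ℝ)..ε, sph (fun x => ‖G x‖ ^ p) s) (𝓝[>] 0) (𝓝 0) :=
    hcont.mono_left (by
      rw [← nhdsWithin_Ioo_eq_nhdsGT (zero_lt_one (α := ℝ))]
      exact nhdsWithin_mono _ Ioo_subset_Icc_self)
  have h2 : Tendsto (fun ε : ℝ => ballVol d * ε ^ d) (𝓝[>] 0) (𝓝 0) := by
    have : Continuous fun ε : ℝ => ballVol d * ε ^ d := by fun_prop
    have h3 := (this.tendsto 0).mono_left (nhdsWithin_le_nhds (s := Ioi 0))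
    simpa [zero_pow (NeZero.ne d)] using h3
  have h3 := (h2.add h1).const_mul C
  simp only [add_zero, mul_zero] at h3
  refine squeeze_zero_norm' ?_ h3
  filter_upwards [Ioo_mem_nhdsGT (zero_lt_one (α := ℝ))] with ε hε
  have h4 := norm_avgG_rpow_le hp hG hGp hε.1 hε.2.le
  have hv : 0 ≤ ballVol d * ε ^ d := mul_nonneg hb.le (pow_nonneg hε.1.le _)
  rw [energyG, Real.norm_eq_abs, abs_mul, abs_of_nonneg hv]
  calc ballVol d * ε ^ d * |U (avgG G ε)|
      ≤ ballVol d * ε ^ d * (C * (1 + ‖avgG G ε‖ ^ p)) := by gcongr; exact hC _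
    _ = C * (ballVol d * ε ^ d + ballVol d * ε ^ d * ‖avgG G ε‖ ^ p) := by ring
    _ ≤ _ := by gcongr

/-- A quasiconvexity-type inequality for generalised-radial functions: it suffices that `U` lies
below its tangents along rank-one directions. -/
theorem IBP.integral_comp_le (h : IBP u G) (hr : IsGeneralisedRadial (unitBall d) u)
    (hp : 1 ≤ p) (hG : MemLp G (ENNReal.ofReal p) (volume.restrict (unitBall d)))
    (hU : ContDiff ℝ 1 U) (hC : ∀ A, |U A| ≤ C * (1 + ‖A‖ ^ p))
    (htan : ∀ (A : M d) (a b : Fin d → ℝ), U (A + Matrix.vecMulVec a b) ≤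
      U A + fderiv ℝ U A (Matrix.vecMulVec a b)) :
    ∫ x in unitBall d, U (G x) ≤ ballVol d * U 0 := by
  have hp0 : 0 < p := by linarith
  have hGi : IntegrableOn G (unitBall d) := hG.integrable (by simpa using hp)
  have hGp : IntegrableOn (fun x => ‖G x‖ ^ p) (unitBall d) := by
    have := hG.integrable_norm_rpow'
    rwa [ENNReal.toReal_ofReal hp0.le] at this
  have hUG : IntegrableOn (fun x => U (G x)) (unitBall d) := by
    refine Integrable.mono' (g := fun x => C * (1 + ‖G x‖ ^ p))
      (((integrable_const 1).add hGp).const_mul C)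
      (hU.continuous.comp_aestronglyMeasurable hG.aestronglyMeasurable)
      (Eventually.of_forall fun x => hC _)
  have hint := intervalIntegrable_of_Ioo (integrableOn_sph hUG)
  -- Absolute continuity of the energy is available only away from the origin, so integration starts
  -- at `ε`, which tends to `0` afterwards.
  have hstep : ∀ ε ∈ Ioo (0 : ℝ) 1, (∫ s in (0 : ℝ)..1, sph (fun x => U (G x)) s) -
      ∫ s in (0 : ℝ)..ε, sph (fun x => U (G x)) s ≤ ballVol d * U 0 - energyG U G ε := by
    intro ε hε
    have hac := h.absolutelyContinuous_energyG hU hε.1 hε.2.le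
    have hsub : uIcc ε 1 ⊆ uIcc 0 1 := by
      rw [uIcc_of_le hε.2.le, uIcc_of_le zero_le_one]
      exact Icc_subset_Icc_left hε.1.le
    have hsub' : uIcc 0 ε ⊆ uIcc 0 1 := by
      rw [uIcc_of_le hε.1.le, uIcc_of_le zero_le_one]
      exact Icc_subset_Icc_right hε.2.le
    rw [← intervalIntegral.integral_add_adjacent_intervals (hint.mono_set hsub')
      (hint.mono_set hsub), add_sub_cancel_left]
    have h1 : energyG U G 1 = ballVol d * U 0 := by simp [energyG, h.avgG_one]
    rw [← h1, ← hac.integral_deriv_eq_sub]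
    refine intervalIntegral.integral_mono_ae_restrict hε.2.le (hint.mono_set hsub)
      hac.intervalIntegrable_deriv ?_
    rw [← restrict_Ioo_eq_restrict_Icc]
    have hsub2 : Ioo ε 1 ⊆ Ioo (0 : ℝ) 1 := Ioo_subset_Ioo_left hε.1.le
    filter_upwards [ae_restrict_of_ae_restrict_of_subset hsub2 (h.ae_sph_comp_le hr hUG htan),
      ae_restrict_of_ae_restrict_of_subset hsub2 (h.ae_hasDerivAt_energyG hU)] with s hs1 hs2
    rw [hs2.deriv]
    exact hs1
  have hcont := (hint.absolutelyContinuousOnInterval_intervalIntegral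
    (c := 0) (by simp)).continuousOn 0 (by simp)
  rw [uIcc_of_le zero_le_one, ContinuousWithinAt, intervalIntegral.integral_same] at hcont
  have h1 : Tendsto (fun ε => ∫ s in (0 : ℝ)..ε, sph (fun x => U (G x)) s) (𝓝[>] 0) (𝓝 0) :=
    hcont.mono_left (by
      rw [← nhdsWithin_Ioo_eq_nhdsGT (zero_lt_one (α := ℝ))]
      exact nhdsWithin_mono _ Ioo_subset_Icc_self)
  have h2 := le_of_tendsto_of_tendsto (tendsto_const_nhds.sub h1)
    (tendsto_const_nhds.sub (tendsto_energyG hp hC hGi hGp))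
    (by filter_upwards [Ioo_mem_nhdsGT (zero_lt_one (α := ℝ))] with ε hε using hstep ε hε)
  rw [integral_sph hUG, integral_Ioo_eq]
  simpa using h2

end Tangent

/-! ### The upper bounds -/

section Upper

variable {d : ℕ}

/-- The smoothed Burkholder function of two linear images of a matrix. -/
def burkReg (p T δ : ℝ) (S K : M d →L[ℝ] EuclideanSpace ℝ (Fin d × Fin d)) (A : M d) : ℝ :=
  burk p T (√(δ + ‖S A‖ ^ 2)) (√(δ + ‖K A‖ ^ 2))

lemma contDiff_burkReg {p T δ : ℝ} (hδ : 0 < δ)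
    (S K : M d →L[ℝ] EuclideanSpace ℝ (Fin d × Fin d)) : ContDiff ℝ 1 (burkReg p T δ S K) := by
  have h1 : ∀ L : M d →L[ℝ] EuclideanSpace ℝ (Fin d × Fin d),
      ContDiff ℝ 1 (fun A : M d => √(δ + ‖L A‖ ^ 2)) := fun L =>
    (contDiff_const.add ((contDiff_norm_sq ℝ).comp L.contDiff)).sqrt fun A =>
      (show (0 : ℝ) < δ + ‖L A‖ ^ 2 by positivity).ne'
  unfold burkReg burk
  refine ((h1 K).sub (contDiff_const.mul (h1 S))).mul
    (((h1 S).add (h1 K)).rpow_const_of_ne fun A => ?_)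
  have h2 : 0 < √(δ + ‖S A‖ ^ 2) := Real.sqrt_pos.2 (by positivity)
  have h3 : 0 < √(δ + ‖K A‖ ^ 2) := Real.sqrt_pos.2 (by positivity)
  exact (add_pos h2 h3).ne'

lemma burkReg_add_le {p T δ : ℝ} (hp : 1 < p) (hT : T = pStar p - 1) (hδ : 0 < δ)
    {S K : M d →L[ℝ] EuclideanSpace ℝ (Fin d × Fin d)} {B : M d} (hB : ‖K B‖ ≤ ‖S B‖) (A : M d) :
    burkReg p T δ S K (A + B) ≤ burkReg p T δ S K A + fderiv ℝ (burkReg p T δ S K) A B := by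
  have h1 : HasDerivAt (fun t : ℝ => A + t • B) B 0 := by
    simpa using ((hasDerivAt_id (0 : ℝ)).smul_const B).const_add A
  have h2 : HasFDerivAt (burkReg p T δ S K) (fderiv ℝ (burkReg p T δ S K) A)
      (A + (0 : ℝ) • B) := by
    rw [zero_smul, add_zero]
    exact ((contDiff_burkReg hδ S K).differentiable one_ne_zero A).hasFDerivAt
  have h3 := h2.comp_hasDerivAt (0 : ℝ) h1
  rw [burkReg, map_add, map_add]
  refine burk_zigzag hp hT hδ (S A) (K A) (S B) (K B) hB ?_
  refine h3.congr_of_eventuallyEq (Eventually.of_forall fun t => ?_)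
  simp [burkReg]

lemma abs_burk_le {p T X Y : ℝ} (hT : 1 ≤ T) (hX : 0 ≤ X) (hY : 0 ≤ Y) :
    |burk p T X Y| ≤ T * (X + Y) ^ (p - 1) * (X + Y) := by
  have h0 : 0 ≤ (X + Y) ^ (p - 1) := Real.rpow_nonneg (by positivity) _
  rw [burk, abs_mul, abs_of_nonneg h0]
  have h1 : |Y - T * X| ≤ T * (X + Y) := by
    rw [abs_le]
    constructor <;> nlinarith
  calc |Y - T * X| * (X + Y) ^ (p - 1) ≤ T * (X + Y) * (X + Y) ^ (p - 1) := by gcongr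
    _ = _ := by ring

lemma one_add_rpow_le {p a : ℝ} (hp : 0 < p) (ha : 0 ≤ a) :
    (1 + a) ^ p ≤ 2 ^ p * (1 + a ^ p) := by
  have h0 := Real.rpow_nonneg ha p
  rcases le_total a 1 with h | h
  · calc (1 + a) ^ p ≤ 2 ^ p := Real.rpow_le_rpow (by positivity) (by linarith) hp.le
      _ ≤ 2 ^ p * (1 + a ^ p) := le_mul_of_one_le_right (by positivity) (by linarith)
  · calc (1 + a) ^ p ≤ (2 * a) ^ p := Real.rpow_le_rpow (by positivity) (by linarith) hp.le
      _ = 2 ^ p * a ^ p := Real.mul_rpow (by norm_num) ha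
      _ ≤ 2 ^ p * (1 + a ^ p) := by gcongr; linarith

/-- Uniform in `δ`, including `δ = 0`: this dominates the passage to the limit in
`IBP.integral_burk_nonpos`. -/
lemma exists_burkReg_bound {p T : ℝ} (hp : 1 < p) (hT : 1 ≤ T)
    (S K : M d →L[ℝ] EuclideanSpace ℝ (Fin d × Fin d)) :
    ∃ C : ℝ, ∀ δ ∈ Icc (0 : ℝ) 1, ∀ A, |burkReg p T δ S K A| ≤ C * (1 + ‖A‖ ^ p) := by
  set c := 2 + ‖S‖ + ‖K‖ with hc
  refine ⟨T * (c ^ p * 2 ^ p), fun δ hδ A => ?_⟩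
  have h1 : ∀ L : M d →L[ℝ] EuclideanSpace ℝ (Fin d × Fin d),
      √(δ + ‖L A‖ ^ 2) ≤ 1 + ‖L‖ * ‖A‖ := by
    intro L
    have h2 := L.le_opNorm A
    rw [Real.sqrt_le_left (by positivity)]
    nlinarith [hδ.2, norm_nonneg (L A), mul_nonneg (norm_nonneg L) (norm_nonneg A)]
  set X := √(δ + ‖S A‖ ^ 2) with hX
  set Y := √(δ + ‖K A‖ ^ 2) with hY
  have hX0 : 0 ≤ X := Real.sqrt_nonneg _
  have hY0 : 0 ≤ Y := Real.sqrt_nonneg _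
  have hXY : X + Y ≤ c * (1 + ‖A‖) := by
    have := h1 S
    have := h1 K
    have := norm_nonneg S
    have := norm_nonneg K
    have := norm_nonneg A
    rw [hc]
    nlinarith
  have hpow : (X + Y) ^ (p - 1) * (X + Y) = (X + Y) ^ p := by
    rcases (add_nonneg hX0 hY0).eq_or_lt with h | h
    · rw [← h, Real.zero_rpow (by linarith), Real.zero_rpow (by linarith), zero_mul]
    · rw [← Real.rpow_add_one h.ne']; ring_nf
  calc |burkReg p T δ S K A| ≤ T * (X + Y) ^ (p - 1) * (X + Y) := abs_burk_le hT hX0 hY0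
    _ = T * (X + Y) ^ p := by rw [mul_assoc, hpow]
    _ ≤ T * (c * (1 + ‖A‖)) ^ p := by gcongr
    _ = T * (c ^ p * (1 + ‖A‖) ^ p) := by rw [Real.mul_rpow (by positivity) (by positivity)]
    _ ≤ T * (c ^ p * (2 ^ p * (1 + ‖A‖ ^ p))) := by
        gcongr
        exact one_add_rpow_le (by linarith) (norm_nonneg A)
    _ = _ := by ring

lemma burkReg_zero (p T : ℝ) (S K : M d →L[ℝ] EuclideanSpace ℝ (Fin d × Fin d)) (A : M d) :
    burkReg p T 0 S K A = burk p T ‖S A‖ ‖K A‖ := by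
  simp [burkReg, Real.sqrt_sq]

lemma burkReg_at_zero_nonpos {p T δ : ℝ} (hT : 1 ≤ T)
    (S K : M d →L[ℝ] EuclideanSpace ℝ (Fin d × Fin d)) : burkReg p T δ S K 0 ≤ 0 := by
  simp only [burkReg, map_zero, norm_zero, burk]
  have h := Real.sqrt_nonneg (δ + 0 ^ 2)
  refine mul_nonpos_of_nonpos_of_nonneg (by nlinarith) (Real.rpow_nonneg (by positivity) _)

variable [NeZero d] {u : E d → E d} {G : E d → M d}

/-- The integral of the Burkholder function is nonpositive. -/
theorem IBP.integral_burk_nonpos {p T : ℝ} (h : IBP u G)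
    (hr : IsGeneralisedRadial (unitBall d) u) (hp : 1 < p) (hT : T = pStar p - 1)
    (hG : MemLp G (ENNReal.ofReal p) (volume.restrict (unitBall d)))
    {S K : M d →L[ℝ] EuclideanSpace ℝ (Fin d × Fin d)}
    (hSK : ∀ a b : Fin d → ℝ, ‖K (Matrix.vecMulVec a b)‖ ≤ ‖S (Matrix.vecMulVec a b)‖) :
    IntegrableOn (fun x => burk p T ‖S (G x)‖ ‖K (G x)‖) (unitBall d) ∧
      ∫ x in unitBall d, burk p T ‖S (G x)‖ ‖K (G x)‖ ≤ 0 := by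
  have hT1 : 1 ≤ T := hT ▸ one_le_pStar_sub_one hp
  obtain ⟨C, hC⟩ := exists_burkReg_bound hp hT1 S K
  set δ : ℕ → ℝ := fun n => 1 / ((n : ℝ) + 1) with hδ
  have hδ0 : ∀ n, 0 < δ n := fun n => by positivity
  have hδ1 : ∀ n, δ n ∈ Icc (0 : ℝ) 1 := fun n => ⟨(hδ0 n).le, by
    rw [hδ, div_le_one (by positivity)]; simp⟩
  have hδl : Tendsto δ atTop (𝓝 0) := tendsto_one_div_add_atTop_nhds_zero_nat
  have hGp : IntegrableOn (fun x => ‖G x‖ ^ p) (unitBall d) := by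
    have := hG.integrable_norm_rpow'
    rwa [ENNReal.toReal_ofReal (by linarith)] at this
  have hdom : IntegrableOn (fun x => C * (1 + ‖G x‖ ^ p)) (unitBall d) :=
    ((integrable_const 1).add hGp).const_mul C
  have hmeas : ∀ n, AEStronglyMeasurable (fun x => burkReg p T (δ n) S K (G x))
      (volume.restrict (unitBall d)) := fun n =>
    (contDiff_burkReg (hδ0 n) S K).continuous.comp_aestronglyMeasurable hG.aestronglyMeasurable
  have hlim : ∀ x, Tendsto (fun n => burkReg p T (δ n) S K (G x)) atTop
      (𝓝 (burk p T ‖S (G x)‖ ‖K (G x)‖)) := by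
    intro x
    have hc : Continuous fun t : ℝ => burkReg p T t S K (G x) := by
      unfold burkReg
      exact continuousOn_burk hp (by fun_prop) (by fun_prop)
    rw [← burkReg_zero]
    exact (hc.tendsto 0).comp hδl
  -- For `δ > 0` both arguments of `b` stay positive, so the smoothed function is `C¹` and the
  -- tangent argument applies.
  have hle : ∀ n, ∫ x in unitBall d, burkReg p T (δ n) S K (G x) ≤ 0 := by
    intro n
    have h1 := h.integral_comp_le hr hp.le hG (contDiff_burkReg (hδ0 n) S K) (hC (δ n) (hδ1 n))
      fun A a b => burkReg_add_le hp hT (hδ0 n) (hSK a b) A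
    refine h1.trans (mul_nonpos_of_nonneg_of_nonpos (ballVol_pos d).le
      (burkReg_at_zero_nonpos hT1 S K))
  refine ⟨Integrable.mono' hdom (aestronglyMeasurable_of_tendsto_ae atTop hmeas
    (Eventually.of_forall hlim)) (Eventually.of_forall fun x => ?_), ?_⟩
  · rw [← burkReg_zero]
    exact hC 0 (by simp) _
  · refine le_of_tendsto (tendsto_integral_of_dominated_convergence _ hmeas hdom
      (fun n => Eventually.of_forall fun x => hC _ (hδ1 n) _) (Eventually.of_forall hlim))
      (Eventually.of_forall hle)

lemma eLpNorm_le_of_integral_le {α F F' : Type*} [MeasurableSpace α] {μ : Measure α}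
    [NormedAddCommGroup F] [NormedAddCommGroup F'] {f : α → F} {g : α → F'} {p c : ℝ} (hp : 0 < p)
    (hc : 0 ≤ c) (hf : MemLp f (ENNReal.ofReal p) μ) (hg : MemLp g (ENNReal.ofReal p) μ)
    (h : ∫ x, ‖f x‖ ^ p ∂μ ≤ c ^ p * ∫ x, ‖g x‖ ^ p ∂μ) :
    eLpNorm f (ENNReal.ofReal p) μ ≤ ENNReal.ofReal c * eLpNorm g (ENNReal.ofReal p) μ := by
  have h0 : ENNReal.ofReal p ≠ 0 := by simpa using hp
  rw [hf.eLpNorm_eq_integral_rpow_norm h0 ENNReal.ofReal_ne_top,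
    hg.eLpNorm_eq_integral_rpow_norm h0 ENNReal.ofReal_ne_top, ← ENNReal.ofReal_mul hc,
    ENNReal.toReal_ofReal hp.le]
  refine ENNReal.ofReal_le_ofReal ?_
  have h1 : 0 ≤ ∫ x, ‖f x‖ ^ p ∂μ := integral_nonneg fun x => Real.rpow_nonneg (norm_nonneg _) _
  have h2 : 0 ≤ ∫ x, ‖g x‖ ^ p ∂μ := integral_nonneg fun x => Real.rpow_nonneg (norm_nonneg _) _
  refine (Real.rpow_le_rpow h1 h (inv_nonneg.2 hp.le)).trans_eq ?_
  rw [Real.mul_rpow (Real.rpow_nonneg hc _) h2, Real.rpow_rpow_inv hc hp.ne']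

/-- The two bounds for a pair of linear maps under which rank-one matrices are contracted and
which split matrices orthogonally. -/
theorem radialBound_of_linearMap {p : ℝ} (hp : 1 < p) (S K : M d →ₗ[ℝ] M d)
    (hSK : ∀ a b : Fin d → ℝ, ‖K (Matrix.vecMulVec a b)‖ ≤ ‖S (Matrix.vecMulVec a b)‖)
    (hadd : ∀ A, ‖A‖ ^ 2 = ‖S A‖ ^ 2 + ‖K A‖ ^ 2) :
    RadialBound d p K S (pStar p - 1) ∧ RadialBound d p id S (cKorn p) := by
  have hp0 : 0 < p := by linarith
  set T := pStar p - 1 with hT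
  have hT1 : 1 ≤ T := one_le_pStar_sub_one hp
  set S' : M d →L[ℝ] M d := LinearMap.toContinuousLinearMap S with hS'
  set K' : M d →L[ℝ] M d := LinearMap.toContinuousLinearMap K with hK'
  have key : ∀ (u : E d → E d) (G : E d → M d), MemW01p p (unitBall d) u →
      HasWeakGradient (unitBall d) u G → IsGeneralisedRadial (unitBall d) u →
      MemLp G (ENNReal.ofReal p) (volume.restrict (unitBall d)) ∧
      IntegrableOn (fun x => burk p T ‖S (G x)‖ ‖K (G x)‖) (unitBall d) ∧
      ∫ x in unitBall d, burk p T ‖S (G x)‖ ‖K (G x)‖ ≤ 0 := by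
    intro u G hu hG hr
    obtain ⟨h1, h2, h3⟩ := MemW01p.integral_mul_pd hp hu hG
    have hq : 1 ≤ ENNReal.ofReal p := by simpa using hp.le
    have h4 : IBP u G := ⟨fun i => (h1 i).integrable hq, fun i j => (h2 i j).integrable hq, h3⟩
    refine ⟨memLp_matrix h2, ?_⟩
    have h5 := h4.integral_burk_nonpos hr hp hT (memLp_matrix h2)
      (S := (flat d).comp S') (K := (flat d).comp K')
      (fun a b => by
        rw [ContinuousLinearMap.comp_apply, ContinuousLinearMap.comp_apply, norm_flat, norm_flat]
        exact hSK a b)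
    simp only [ContinuousLinearMap.comp_apply, norm_flat] at h5
    exact h5
  -- A pointwise majorant is integrated and its Burkholder term, being nonpositive, is dropped.
  have conv : ∀ (G : E d → M d) (f : E d → M d) (α c : ℝ), 0 ≤ α → 0 ≤ c →
      MemLp G (ENNReal.ofReal p) (volume.restrict (unitBall d)) →
      MemLp f (ENNReal.ofReal p) (volume.restrict (unitBall d)) →
      IntegrableOn (fun x => burk p T ‖S (G x)‖ ‖K (G x)‖) (unitBall d) →
      ∫ x in unitBall d, burk p T ‖S (G x)‖ ‖K (G x)‖ ≤ 0 →
      (∀ x, ‖f x‖ ^ p - c ^ p * ‖S (G x)‖ ^ p ≤ α * burk p T ‖S (G x)‖ ‖K (G x)‖) →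
      eLpNorm f (ENNReal.ofReal p) (volume.restrict (unitBall d)) ≤ ENNReal.ofReal c *
        eLpNorm (fun x => S (G x)) (ENNReal.ofReal p) (volume.restrict (unitBall d)) := by
    intro G f α c hα hc hG hf hb hb0 hle
    have hSG : MemLp (fun x => S (G x)) (ENNReal.ofReal p) (volume.restrict (unitBall d)) :=
      S'.comp_memLp' hG
    refine eLpNorm_le_of_integral_le hp0 hc hf hSG ?_
    have i1 := hf.integrable_norm_rpow'
    have i2 := hSG.integrable_norm_rpow'
    rw [ENNReal.toReal_ofReal hp0.le] at i1 i2
    have h1 := integral_mono (i1.sub (i2.const_mul (c ^ p))) (hb.const_mul α) hle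
    simp only [Pi.sub_apply] at h1
    rw [integral_sub i1 (i2.const_mul _), integral_const_mul, integral_const_mul] at h1
    linarith [mul_nonpos_of_nonneg_of_nonpos hα hb0]
  constructor
  · intro u G hu hG hr
    obtain ⟨h1, h2, h3⟩ := key u G hu hG hr
    obtain ⟨α, hα, h4⟩ := exists_majorant hp hT
    exact conv G (fun x => K (G x)) α T hα (by linarith) h1 (K'.comp_memLp' h1) h2 h3
      fun x => h4 _ _ (norm_nonneg _) (norm_nonneg _)
  · intro u G hu hG hr
    obtain ⟨h1, h2, h3⟩ := key u G hu hG hr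
    obtain ⟨hc, α, hα, h4⟩ := exists_norm_majorant hp hT
    refine conv G (fun x => id (G x)) α _ hα hc h1 h1 h2 h3 fun x => ?_
    rw [← sq_rpow_half (norm_nonneg (id (G x)))]
    simp only [id]
    rw [hadd (G x)]
    exact h4 _ _ (norm_nonneg _) (norm_nonneg _)

end Upper

/-! ### The parts of a matrix -/

section Parts

variable {d : ℕ}

/-- `symPart` as a linear map. -/
def symL (d : ℕ) : M d →ₗ[ℝ] M d where
  toFun := symPart
  map_add' A B := by simp only [symPart, Matrix.transpose_add]; module
  map_smul' c A := by simp only [symPart, Matrix.transpose_smul, RingHom.id_apply]; module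

/-- `skewPart` as a linear map. -/
def skewL (d : ℕ) : M d →ₗ[ℝ] M d where
  toFun := skewPart
  map_add' A B := by simp only [skewPart, Matrix.transpose_add]; module
  map_smul' c A := by simp only [skewPart, Matrix.transpose_smul, RingHom.id_apply]; module

/-- The multiple of the identity with the trace of a matrix, as a linear map. -/
def traceL (d : ℕ) : M d →ₗ[ℝ] M d where
  toFun A := (A.trace / (d : ℝ)) • (1 : M d)
  map_add' A B := by simp only [Matrix.trace_add]; module
  map_smul' c A := by
    simp only [Matrix.trace_smul, RingHom.id_apply, smul_smul, smul_eq_mul, mul_div_assoc]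

lemma norm_symPart_sq (A : M d) :
    ‖symPart A‖ ^ 2 = (‖A‖ ^ 2 + ∑ i, ∑ j, A i j * A j i) / 2 := by
  have h1 : ∑ i, ∑ j, A j i ^ 2 = ∑ i, ∑ j, A i j ^ 2 := Finset.sum_comm
  simp only [frobenius_norm_sq]
  have h2 : ∀ i j, symPart A i j ^ 2 = (A i j ^ 2 + A j i ^ 2) / 4 + A i j * A j i / 2 := by
    intro i j; simp [symPart]; ring
  simp only [h2, Finset.sum_add_distrib, ← Finset.sum_div, h1]
  ring

lemma norm_skewPart_sq (A : M d) :
    ‖skewPart A‖ ^ 2 = (‖A‖ ^ 2 - ∑ i, ∑ j, A i j * A j i) / 2 := by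
  have h1 : ∑ i, ∑ j, A j i ^ 2 = ∑ i, ∑ j, A i j ^ 2 := Finset.sum_comm
  simp only [frobenius_norm_sq]
  have h2 : ∀ i j, skewPart A i j ^ 2 = (A i j ^ 2 + A j i ^ 2) / 4 - A i j * A j i / 2 := by
    intro i j; simp [skewPart]; ring
  simp only [h2, Finset.sum_add_distrib, Finset.sum_sub_distrib, ← Finset.sum_div, h1]
  ring

lemma norm_add_smul_one_sq (A : M d) (c : ℝ) :
    ‖A + c • (1 : M d)‖ ^ 2 = ‖A‖ ^ 2 + 2 * c * A.trace + c ^ 2 * d := by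
  simp only [frobenius_norm_sq]
  have h2 : ∀ i j, (A + c • (1 : M d)) i j ^ 2 =
      A i j ^ 2 + if i = j then 2 * c * A i j + c ^ 2 else 0 := by
    intro i j
    by_cases h : i = j
    · simp [h]; ring
    · simp [Matrix.one_apply_ne h, h]
  simp only [h2, Finset.sum_add_distrib, Finset.sum_ite_eq, Finset.mem_univ, if_true,
    ← Finset.mul_sum, Matrix.trace, Matrix.diag_apply, Finset.sum_const, Finset.card_univ,
    Fintype.card_fin, nsmul_eq_mul]
  ring

lemma trace_symPart (A : M d) : (symPart A).trace = A.trace := by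
  simp [symPart, Matrix.trace_smul, Matrix.trace_add]
  ring

lemma trace_skewPart (A : M d) : (skewPart A).trace = 0 := by
  simp [skewPart, Matrix.trace_smul, Matrix.trace_sub]

lemma norm_symPart₀_sq [NeZero d] (A : M d) :
    ‖symPart₀ A‖ ^ 2 = ‖symPart A‖ ^ 2 - A.trace ^ 2 / d := by
  have h0 : (d : ℝ) ≠ 0 := Nat.cast_ne_zero.2 (NeZero.ne d)
  rw [symPart₀, sub_eq_add_neg, ← neg_smul, norm_add_smul_one_sq, trace_symPart]
  field_simp
  ring

lemma norm_skewPart₀_sq [NeZero d] (A : M d) :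
    ‖skewPart₀ A‖ ^ 2 = ‖skewPart A‖ ^ 2 + A.trace ^ 2 / d := by
  have h0 : (d : ℝ) ≠ 0 := Nat.cast_ne_zero.2 (NeZero.ne d)
  rw [skewPart₀, norm_add_smul_one_sq, trace_skewPart]
  field_simp
  ring

/-- The squared norms of the two parts differ by `tr(A²)`, which equals `(tr A)²` for a rank-one
matrix. -/
lemma norm_skewPart_vecMulVec_sq (a b : Fin d → ℝ) :
    ‖skewPart (Matrix.vecMulVec a b)‖ ^ 2 =
      ‖symPart (Matrix.vecMulVec a b)‖ ^ 2 - (Matrix.vecMulVec a b).trace ^ 2 := by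
  have h : ∑ i, ∑ j, Matrix.vecMulVec a b i j * Matrix.vecMulVec a b j i =
      (Matrix.vecMulVec a b).trace ^ 2 := by
    rw [sq, Matrix.trace, Finset.sum_mul_sum]
    refine Finset.sum_congr rfl fun i _ => Finset.sum_congr rfl fun j _ => ?_
    simp only [Matrix.vecMulVec_apply, Matrix.diag_apply]
    ring
  rw [norm_skewPart_sq, norm_symPart_sq, h]
  ring

/-- The bounds for the symmetric and skew parts. -/
theorem radialBound_symPart [NeZero d] {p : ℝ} (hp : 1 < p) :
    RadialBound d p skewPart symPart (pStar p - 1) ∧ RadialBound d p id symPart (cKorn p) := by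
  refine radialBound_of_linearMap hp (symL d) (skewL d) (fun a b => ?_) fun A => ?_
  · refine le_of_sq_le_sq ?_ (norm_nonneg _)
    change ‖skewPart _‖ ^ 2 ≤ ‖symPart _‖ ^ 2
    rw [norm_skewPart_vecMulVec_sq]
    linarith [sq_nonneg (Matrix.vecMulVec a b).trace]
  · change _ = ‖symPart A‖ ^ 2 + ‖skewPart A‖ ^ 2
    rw [norm_symPart_sq, norm_skewPart_sq]
    ring

/-- The bounds for the trace-free symmetric part and its complement. -/
theorem radialBound_symPart₀ [NeZero d] {p : ℝ} (hp : 1 < p) (hd : 2 ≤ d) :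
    RadialBound d p skewPart₀ symPart₀ (pStar p - 1) ∧ RadialBound d p id symPart₀ (cKorn p) := by
  have hd' : (2 : ℝ) ≤ d := by exact_mod_cast hd
  refine radialBound_of_linearMap hp (symL d - traceL d) (skewL d + traceL d)
    (fun a b => ?_) fun A => ?_
  · refine le_of_sq_le_sq ?_ (norm_nonneg _)
    change ‖skewPart₀ _‖ ^ 2 ≤ ‖symPart₀ _‖ ^ 2
    rw [norm_skewPart₀_sq, norm_symPart₀_sq, norm_skewPart_vecMulVec_sq]
    -- The trace part moves `tr²/d` from one side to the other, so `2 tr²/d ≤ tr²` is required: this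
    -- is where `d ≥ 2` enters.
    have h : (Matrix.vecMulVec a b).trace ^ 2 / d ≤ (Matrix.vecMulVec a b).trace ^ 2 / 2 := by
      gcongr
    linarith
  · change _ = ‖symPart₀ A‖ ^ 2 + ‖skewPart₀ A‖ ^ 2
    rw [norm_symPart₀_sq, norm_skewPart₀_sq, norm_symPart_sq, norm_skewPart_sq]
    ring

end Parts

/-! ### Rotational fields in the plane -/

section Rotational

/-- The rotation by a right angle. -/
def rotM : M 2 := !![0, -1; 1, 0]

/-- The vector field `h(|x|²) J x` with `J` the rotation by a right angle. -/
def rotField (h : ℝ → ℝ) (x : E 2) : E 2 := Matrix.toEuclideanLin (h (‖x‖ ^ 2) • rotM) x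

variable {h : ℝ → ℝ}

lemma rotField_zero (x : E 2) : rotField h x 0 = h (‖x‖ ^ 2) * -x 1 := by
  simp [rotField, toEuclideanLin_apply_coord, rotM, Fin.sum_univ_two]

lemma rotField_one (x : E 2) : rotField h x 1 = h (‖x‖ ^ 2) * x 0 := by
  simp [rotField, toEuclideanLin_apply_coord, rotM, Fin.sum_univ_two]

lemma isGeneralisedRadial_rotField : IsGeneralisedRadial (unitBall 2) (rotField h) :=
  ⟨fun s => h (s ^ 2) • rotM, Eventually.of_forall fun _ => rfl⟩

lemma contDiff_rotField (hh : ContDiff ℝ ∞ h) : ContDiff ℝ ∞ (rotField h) := by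
  rw [contDiff_euclidean]
  intro i
  fin_cases i
  · exact (funext rotField_zero : (fun x => rotField h x 0) = _) ▸
      (contDiff_radial hh).mul (contDiff_coord 1).neg
  · exact (funext rotField_one : (fun x => rotField h x 1) = _) ▸
      (contDiff_radial hh).mul (contDiff_coord 0)

lemma isTestFunction_rotField (hh : ContDiff ℝ ∞ h) {R : ℝ} (hR0 : 0 ≤ R) (hR : R < 1)
    (hs : ∀ t, R ^ 2 < t → h t = 0) : IsTestFunction (unitBall 2) (rotField h) := by
  have hsub : tsupport (rotField h) ⊆ Metric.closedBall 0 R := by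
    refine closure_minimal (fun x hx => ?_) Metric.isClosed_closedBall
    rw [mem_closedBall_zero_iff]
    by_contra hcon
    refine hx ?_
    have : h (‖x‖ ^ 2) = 0 := hs _ (by gcongr; exact not_le.1 hcon)
    simp [rotField, this]
  exact ⟨contDiff_rotField hh, (isCompact_closedBall _ _).of_isClosed_subset
    (isClosed_tsupport _) hsub, hsub.trans (Metric.closedBall_subset_ball hR)⟩

lemma jacobian_rotField (hh : ContDiff ℝ ∞ h) (x : E 2) : jacobian (rotField h) x =
    !![-(2 * x 0 * deriv h (‖x‖ ^ 2) * x 1), -(2 * x 1 * deriv h (‖x‖ ^ 2) * x 1 + h (‖x‖ ^ 2));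
      2 * x 0 * deriv h (‖x‖ ^ 2) * x 0 + h (‖x‖ ^ 2), 2 * x 1 * deriv h (‖x‖ ^ 2) * x 0] := by
  have h0 : (fun x => rotField h x 0) = fun x => h (‖x‖ ^ 2) * ((fun _ => -1) x * x 1) :=
    funext fun x => by rw [rotField_zero]; ring
  have h1 : (fun x => rotField h x 1) = fun x => h (‖x‖ ^ 2) * x 0 :=
    funext fun x => rotField_one x
  have hc : ContDiff ℝ ∞ (fun x : E 2 => (fun _ => (-1 : ℝ)) x * x 1) :=
    contDiff_const.mul (contDiff_coord 1)
  have e1 : ∀ j, jacobian (rotField h) x 1 j =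
      2 * x j * deriv h (‖x‖ ^ 2) * x 0 + h (‖x‖ ^ 2) * (if j = 0 then 1 else 0) := by
    intro j
    rw [← pd_component (contDiff_rotField hh), h1, pd_mul (contDiff_radial hh) (contDiff_coord 0),
      pd_radial hh, pd_coord]
  have e0 : ∀ j, jacobian (rotField h) x 0 j =
      -(2 * x j * deriv h (‖x‖ ^ 2) * x 1) - h (‖x‖ ^ 2) * (if j = 1 then 1 else 0) := by
    intro j
    rw [← pd_component (contDiff_rotField hh), h0, pd_mul (contDiff_radial hh) hc,
      pd_radial hh, pd_mul contDiff_const (contDiff_coord 1), pd_coord]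
    simp only [pd, fderiv_fun_const, Pi.zero_apply, zero_apply]
    ring
  ext i j
  fin_cases i <;> fin_cases j <;> simp [e0, e1]
  ring

lemma norm_sq_two (x : E 2) : ‖x‖ ^ 2 = x 0 ^ 2 + x 1 ^ 2 := by
  simp [EuclideanSpace.norm_sq_eq, Fin.sum_univ_two]

lemma norm_symPart_rotField (hh : ContDiff ℝ ∞ h) (x : E 2) :
    ‖symPart (jacobian (rotField h) x)‖ ^ 2 = 2 * (‖x‖ ^ 2 * deriv h (‖x‖ ^ 2)) ^ 2 := by
  rw [jacobian_rotField hh, frobenius_norm_sq]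
  have hx := norm_sq_two x
  generalize h (‖x‖ ^ 2) = a
  generalize deriv h (‖x‖ ^ 2) = b
  rw [hx]
  simp [symPart, Fin.sum_univ_two]
  ring

lemma norm_skewPart_rotField (hh : ContDiff ℝ ∞ h) (x : E 2) :
    ‖skewPart (jacobian (rotField h) x)‖ ^ 2 =
      2 * (h (‖x‖ ^ 2) + ‖x‖ ^ 2 * deriv h (‖x‖ ^ 2)) ^ 2 := by
  rw [jacobian_rotField hh, frobenius_norm_sq]
  have hx := norm_sq_two x
  generalize h (‖x‖ ^ 2) = a
  generalize deriv h (‖x‖ ^ 2) = b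
  rw [hx]
  simp [skewPart, Fin.sum_univ_two]
  ring

/-- Consequently the trace corrections vanish on these fields, and one family tests all four
inequalities. -/
lemma trace_rotField (hh : ContDiff ℝ ∞ h) (x : E 2) : (jacobian (rotField h) x).trace = 0 := by
  rw [jacobian_rotField hh, Matrix.trace_fin_two]
  simp
  ring

lemma continuous_jacobian {d : ℕ} {φ : E d → E d} (hφ : ContDiff ℝ ∞ φ) (i j : Fin d) :
    Continuous fun x => jacobian φ x i j := by
  have := (contDiff_pd (j := j) (contDiff_component hφ i)).continuous
  simpa only [← pd_component hφ] using this

lemma IsTestFunction.hasWeakGradient {d : ℕ} {Ω : Set (E d)} {φ : E d → E d}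
    (hφ : IsTestFunction Ω φ) : HasWeakGradient Ω φ (jacobian φ) :=
  ⟨hφ.1.continuous.locallyIntegrable.locallyIntegrableOn _,
    fun i j => (continuous_jacobian hφ.1 i j).locallyIntegrable.locallyIntegrableOn _,
    fun _ hη i j => integral_test_mul_pd hφ hη.1 i j⟩

lemma IsTestFunction.memW01p {d : ℕ} {φ : E d → E d} {p : ℝ}
    (hφ : IsTestFunction (unitBall d) φ) : MemW01p p (unitBall d) φ := by
  refine ⟨(hφ.1.continuous.memLp_of_hasCompactSupport hφ.2.1).restrict _, jacobian φ,
    hφ.hasWeakGradient, fun i j => memLp_of_continuous (continuous_jacobian hφ.1 i j) _,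
    fun _ => φ, fun _ => hφ, ?_, ?_⟩
  · simp
  · have h0 : ∀ x, jacobian φ x - jacobian φ x = 0 := fun x => sub_self _
    simp only [h0]
    have : eLpNorm (fun _ : E d => (0 : M d)) (ENNReal.ofReal p) (volume.restrict (unitBall d))
      = 0 := eLpNorm_zero
    rw [this]
    exact tendsto_const_nhds

/-- Polar coordinates with a logarithmic radius. -/
lemma integral_unitBall_two {F : ℝ → ℝ} (hF : Continuous F) {l : ℝ} (hl : 0 < l) :
    ∫ x in unitBall 2, F (‖x‖ ^ 2) =
      ballVol 2 / l * ∫ σ in Ioi (0 : ℝ), Real.exp (-σ / l) * F (Real.exp (-σ / l)) := by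
  have h1 : ∫ x in unitBall 2, F (‖x‖ ^ 2) * (fun _ => 1) x =
      ∫ s in Ioo (0 : ℝ) 1, F (s ^ 2) * sph (fun _ : E 2 => (1 : ℝ)) s :=
    integral_radial_mul (ψ := fun s => F (s ^ 2)) (f := fun _ => 1)
      (integrableOn_of_continuous (by fun_prop))
  simp only [mul_one, sph_one] at h1
  rw [h1]
  -- The substitution `s = exp(-σ/(2l))` gives `s² = exp(-σ/l)`, so that `σ = -l log |x|²`.
  have himg : (fun σ : ℝ => Real.exp (-σ / (2 * l))) '' Ioi 0 = Ioo 0 1 := by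
    ext y
    constructor
    · rintro ⟨σ, hσ, rfl⟩
      have hσ0 : 0 < σ := hσ
      refine ⟨Real.exp_pos _, Real.exp_lt_one_iff.2 ?_⟩
      rw [neg_div]
      exact neg_neg_of_pos (by positivity)
    · rintro ⟨hy0, hy1⟩
      refine ⟨-(2 * l * Real.log y), ?_, ?_⟩
      · have := Real.log_neg hy0 hy1
        rw [mem_Ioi]
        nlinarith
      · have : -(-(2 * l * Real.log y)) / (2 * l) = Real.log y := by field_simp
        simp only [this, Real.exp_log hy0]
  have hinj : InjOn (fun σ : ℝ => Real.exp (-σ / (2 * l))) (Ioi 0) := by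
    intro a _ b _ hab
    have := Real.exp_injective hab
    field_simp at this
    linarith
  have hder : ∀ σ ∈ Ioi (0 : ℝ), HasDerivWithinAt (fun σ : ℝ => Real.exp (-σ / (2 * l)))
      (Real.exp (-σ / (2 * l)) * (-1 / (2 * l))) (Ioi 0) σ := fun σ _ =>
    (((hasDerivAt_id σ).neg.div_const (2 * l)).exp).hasDerivWithinAt
  rw [← himg, integral_image_eq_integral_abs_deriv_smul measurableSet_Ioi hder hinj,
    ← integral_const_mul]
  refine integral_congr_ae (Eventually.of_forall fun σ => ?_)
  have e1 : Real.exp (-σ / (2 * l)) ^ 2 = Real.exp (-σ / l) := by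
    rw [← Real.exp_nat_mul]
    congr 1
    push_cast
    field_simp
  have e2 : |Real.exp (-σ / (2 * l)) * (-1 / (2 * l))| = Real.exp (-σ / (2 * l)) / (2 * l) := by
    rw [abs_mul, abs_of_pos (Real.exp_pos _), abs_div, abs_neg, abs_one,
      abs_of_pos (by positivity : 0 < 2 * l)]
    ring
  simp only [e2, smul_eq_mul]
  rw [← e1]
  push_cast
  field_simp

lemma integral_rpow_le_of_eLpNorm_le {α F F' : Type*} [MeasurableSpace α] {μ : Measure α}
    [NormedAddCommGroup F] [NormedAddCommGroup F'] {f : α → F} {g : α → F'} {p c : ℝ} (hp : 0 < p)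
    (hc : 0 ≤ c) (hf : MemLp f (ENNReal.ofReal p) μ) (hg : MemLp g (ENNReal.ofReal p) μ)
    (h : eLpNorm f (ENNReal.ofReal p) μ ≤ ENNReal.ofReal c * eLpNorm g (ENNReal.ofReal p) μ) :
    ∫ x, ‖f x‖ ^ p ∂μ ≤ c ^ p * ∫ x, ‖g x‖ ^ p ∂μ := by
  have h0 : ENNReal.ofReal p ≠ 0 := by simpa using hp
  have h1 : 0 ≤ ∫ x, ‖f x‖ ^ p ∂μ := integral_nonneg fun x => Real.rpow_nonneg (norm_nonneg _) _
  have h2 : 0 ≤ ∫ x, ‖g x‖ ^ p ∂μ := integral_nonneg fun x => Real.rpow_nonneg (norm_nonneg _) _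
  rw [hf.eLpNorm_eq_integral_rpow_norm h0 ENNReal.ofReal_ne_top,
    hg.eLpNorm_eq_integral_rpow_norm h0 ENNReal.ofReal_ne_top, ← ENNReal.ofReal_mul hc,
    ENNReal.toReal_ofReal hp.le, ENNReal.ofReal_le_ofReal_iff (by positivity)] at h
  have h3 := Real.rpow_le_rpow (by positivity) h hp.le
  rwa [Real.rpow_inv_rpow h1 hp.ne', Real.mul_rpow hc (by positivity),
    Real.rpow_inv_rpow h2 hp.ne'] at h3

end Rotational

/-! ### Sharpness -/

section Sharp

/-- A smooth bump supported in `[1, 2]`. -/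
def bump : ContDiffBump (3 / 2 : ℝ) := ⟨1 / 4, 1 / 2, by norm_num, by norm_num⟩

lemma bump_eq_zero {s : ℝ} (hs : s ∉ Ioo (1 : ℝ) 2) : bump s = 0 := by
  refine bump.zero_of_le_dist ?_
  rw [Real.dist_eq]
  by_contra hcon
  have h1 := abs_lt.1 (not_le.1 hcon)
  have h2 : bump.rOut = 1 / 2 := rfl
  rw [h2] at h1
  exact hs ⟨by linarith [h1.1], by linarith [h1.2]⟩

lemma deriv_bump_eq_zero {s : ℝ} (hs : s ∉ Icc (1 : ℝ) 2) : deriv bump s = 0 := by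
  have h1 : ∀ᶠ t in 𝓝 s, bump t = 0 := by
    filter_upwards [isClosed_Icc.isOpen_compl.mem_nhds hs] with t ht
    exact bump_eq_zero fun h => ht (Ioo_subset_Icc_self h)
  have h2 : (bump : ℝ → ℝ) =ᶠ[𝓝 s] fun _ => 0 := h1
  rw [h2.deriv_eq, deriv_const]

/-- The logarithmic cut-off of the power `t^(-1/p)`. -/
def logProfile (p l t : ℝ) : ℝ := Real.exp (-Real.log t / p) * bump (-l * Real.log t)

lemma logProfile_eq_zero_of_gt {p l t : ℝ} (hl : 0 < l) (ht : Real.exp (-1 / l) < t) :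
    logProfile p l t = 0 := by
  rw [logProfile, bump_eq_zero, mul_zero]
  rintro ⟨h1, -⟩
  have h2 := (Real.lt_log_iff_exp_lt ((Real.exp_pos _).trans ht)).2 ht
  rw [div_lt_iff₀ hl] at h2
  linarith

lemma hasDerivAt_logProfile (p l : ℝ) {t : ℝ} (ht : t ≠ 0) :
    HasDerivAt (logProfile p l) (Real.exp (-Real.log t / p) * (-t⁻¹ / p) * bump (-l * Real.log t) +
      Real.exp (-Real.log t / p) * (deriv bump (-l * Real.log t) * (-l * t⁻¹))) t := by
  have h1 := Real.hasDerivAt_log ht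
  have h2 : HasDerivAt bump (deriv bump (-l * Real.log t)) (-l * Real.log t) :=
    ((bump.contDiff (n := 1)).differentiable one_ne_zero _).hasDerivAt
  exact (h1.neg.div_const p).exp.mul
    (HasDerivAt.comp (h₂ := (bump : ℝ → ℝ)) t h2 (h1.const_mul (-l)))

lemma contDiff_logProfile (p : ℝ) {l : ℝ} (hl : 0 < l) : ContDiff ℝ ∞ (logProfile p l) := by
  rw [contDiff_iff_contDiffAt]
  intro t
  rcases eq_or_ne t 0 with rfl | ht
  · have h1 : ∀ᶠ t in 𝓝 (0 : ℝ), logProfile p l t = 0 := by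
      filter_upwards [Ioo_mem_nhds (neg_neg_of_pos (Real.exp_pos (-2 / l)))
        (Real.exp_pos (-2 / l))] with t ht
      rw [logProfile]
      rcases eq_or_ne t 0 with rfl | ht0
      -- `Real.log 0 = 0` puts the argument of the bump at `0`, outside its support.
      · rw [Real.log_zero, mul_zero, bump_eq_zero (by simp), mul_zero]
      · rw [bump_eq_zero, mul_zero]
        rintro ⟨-, h2⟩
        have h3 : Real.log t < -2 / l := by
          rw [← Real.log_abs, Real.log_lt_iff_lt_exp (abs_pos.2 ht0)]
          exact abs_lt.2 ht
        rw [lt_div_iff₀ hl] at h3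
        linarith
    exact contDiffAt_const.congr_of_eventuallyEq h1
  · have h1 : ContDiffAt ℝ ∞ Real.log t := Real.contDiffAt_log.2 ht
    have h2 : ContDiff ℝ ∞ (bump : ℝ → ℝ) := bump.contDiff
    exact (h1.neg.div_const p).exp.mul
      (ContDiffAt.comp (g := (bump : ℝ → ℝ)) t h2.contDiffAt (contDiffAt_const.mul h1))

/-- The quadratic form in the norms of the symmetric and skew parts, to the power `p / 2`. -/
def quadPow (p a b X Y : ℝ) : ℝ := (2 * (a * X ^ 2 + b * Y ^ 2)) ^ (p / 2)

/-- The energy of `logProfile`, up to a factor. -/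
def profileEnergy (p a b l : ℝ) : ℝ :=
  ∫ σ in (1 : ℝ)..2, quadPow p a b (bump σ / p + l * deriv bump σ)
    ((1 - 1 / p) * bump σ - l * deriv bump σ)

lemma quadPow_mul {p a b X Y c : ℝ} (ha : 0 ≤ a) (hb : 0 ≤ b) (hc : 0 ≤ c) :
    quadPow p a b (c * X) (c * Y) = c ^ p * quadPow p a b X Y := by
  have h1 : 2 * (a * (c * X) ^ 2 + b * (c * Y) ^ 2) = c ^ 2 * (2 * (a * X ^ 2 + b * Y ^ 2)) := by
    ring
  rw [quadPow, h1, Real.mul_rpow (by positivity) (by positivity), sq_rpow_half hc, quadPow]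

/-- In the variable `σ = -l log t` the power `t^{-1/p}`, raised to `p`, cancels the Jacobian. The
parameter `l` survives only in front of `deriv bump`, so the cut-off becomes free as `l → 0`. -/
lemma integral_quadPow_logProfile {p a b l : ℝ} (hp : 0 < p) (ha : 0 ≤ a) (hb : 0 ≤ b)
    (hl : 0 < l) :
    ∫ x in unitBall 2, quadPow p a b (‖x‖ ^ 2 * deriv (logProfile p l) (‖x‖ ^ 2))
      (logProfile p l (‖x‖ ^ 2) + ‖x‖ ^ 2 * deriv (logProfile p l) (‖x‖ ^ 2)) =
      ballVol 2 / l * profileEnergy p a b l := by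
  have hh := contDiff_logProfile p hl
  have hh' := hh.continuous_deriv (by simp)
  have hF : Continuous fun t => quadPow p a b (t * deriv (logProfile p l) t)
      (logProfile p l t + t * deriv (logProfile p l) t) := by
    have := hh.continuous
    unfold quadPow
    exact Continuous.rpow_const (by fun_prop) fun _ => Or.inr (by positivity)
  rw [integral_unitBall_two hF hl]
  congr 1
  have h1 : ∀ σ : ℝ, Real.exp (-σ / l) * quadPow p a b
      (Real.exp (-σ / l) * deriv (logProfile p l) (Real.exp (-σ / l)))
      (logProfile p l (Real.exp (-σ / l)) +
        Real.exp (-σ / l) * deriv (logProfile p l) (Real.exp (-σ / l))) =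
      quadPow p a b (bump σ / p + l * deriv bump σ)
        ((1 - 1 / p) * bump σ - l * deriv bump σ) := by
    intro σ
    set e := Real.exp (-σ / l) with he
    have he0 : 0 < e := Real.exp_pos _
    have hlog : Real.log e = -σ / l := Real.log_exp _
    have hσ : -l * (-σ / l) = σ := by field_simp
    set c := Real.exp (-(-σ / l) / p) with hc
    have hc0 : 0 < c := Real.exp_pos _
    have hcp : e * c ^ p = 1 := by
      rw [he, hc, ← Real.exp_mul, ← Real.exp_add, Real.exp_eq_one_iff]
      field_simp
      ring
    have e1 : logProfile p l e = c * bump σ := by rw [logProfile, hlog, hσ]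
    have e2 : e * deriv (logProfile p l) e = c * -(bump σ / p + l * deriv bump σ) := by
      rw [(hasDerivAt_logProfile p l he0.ne').deriv, hlog, hσ, ← hc]
      field_simp
      ring
    have e3 : logProfile p l e + e * deriv (logProfile p l) e =
        c * ((1 - 1 / p) * bump σ - l * deriv bump σ) := by
      rw [e1, e2]; ring
    rw [e3, e2, quadPow_mul ha hb hc0.le, ← mul_assoc, hcp, one_mul, quadPow, neg_sq, quadPow]
  simp only [h1]
  rw [profileEnergy, intervalIntegral.integral_of_le (by norm_num), ← integral_Icc_eq_integral_Ioc]
  refine setIntegral_eq_of_subset_of_forall_sdiff_eq_zero measurableSet_Ioi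
    (fun x hx => lt_of_lt_of_le one_pos hx.1) fun σ hσ => ?_
  rw [bump_eq_zero fun h => hσ.2 (Ioo_subset_Icc_self h), deriv_bump_eq_zero hσ.2, quadPow]
  simp [Real.zero_rpow (by positivity : p / 2 ≠ 0)]

lemma continuous_profileEnergy {p : ℝ} (hp : 0 < p) (a b : ℝ) :
    Continuous (profileEnergy p a b) := by
  have h1 : Continuous bump := bump.continuous
  have h2 : Continuous (deriv bump) := (bump.contDiff (n := 1)).continuous_deriv le_rfl
  refine intervalIntegral.continuous_parametric_intervalIntegral_of_continuous' ?_ 1 2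
  unfold quadPow Function.uncurry
  exact Continuous.rpow_const (by fun_prop) fun _ => Or.inr (by positivity)

lemma profileEnergy_zero {p a b : ℝ} (ha : 0 ≤ a) (hb : 0 ≤ b) :
    profileEnergy p a b 0 = quadPow p a b (1 / p) (1 - 1 / p) * ∫ σ in (1 : ℝ)..2, bump σ ^ p := by
  rw [profileEnergy, ← intervalIntegral.integral_const_mul]
  refine intervalIntegral.integral_congr fun σ _ => ?_
  have h1 : bump σ / p + 0 * deriv bump σ = bump σ * (1 / p) := by ring
  have h2 : (1 - 1 / p) * bump σ - 0 * deriv bump σ = bump σ * (1 - 1 / p) := by ring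
  simp only [h1, h2]
  rw [quadPow_mul ha hb bump.nonneg, mul_comm]

lemma integral_bump_rpow_pos {p : ℝ} (hp : 0 < p) : 0 < ∫ σ in (1 : ℝ)..2, bump σ ^ p := by
  refine intervalIntegral.intervalIntegral_pos_of_pos_on ?_ (fun σ hσ => ?_) (by norm_num)
  · exact (bump.continuous.rpow_const fun _ => Or.inr hp.le).intervalIntegrable _ _
  · refine Real.rpow_pos_of_pos (bump.pos_of_mem_ball ?_) _
    rw [Metric.mem_ball, Real.dist_eq, abs_lt]
    have h2 : bump.rOut = 1 / 2 := rfl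
    rw [h2]
    constructor <;> linarith [hσ.1, hσ.2]

/-- A lower bound for constants, for maps whose norms on trace-free matrices are quadratic forms
in the norms of the symmetric and skew parts. -/
theorem sqrt_le_of_radialBound {p m K : ℝ} (hp : 1 < p) (hm : 0 ≤ m) (hK : 0 ≤ K)
    {T S : M 2 → M 2} (hTc : Continuous T) (hSc : Continuous S)
    (hT : ∀ A : M 2, A.trace = 0 → ‖T A‖ ^ 2 = m * ‖symPart A‖ ^ 2 + ‖skewPart A‖ ^ 2)
    (hS : ∀ A : M 2, A.trace = 0 → ‖S A‖ ^ 2 = ‖symPart A‖ ^ 2)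
    (h : RadialBound 2 p T S K) : √(m + (p - 1) ^ 2) ≤ K := by
  have hp0 : 0 < p := by linarith
  have hle : ∀ l : ℝ, 0 < l → profileEnergy p m 1 l ≤ K ^ p * profileEnergy p 1 0 l := by
    intro l hl
    have hh := contDiff_logProfile p hl
    set R := √(Real.exp (-1 / l)) with hR
    have hR1 : R < 1 := by
      rw [hR, Real.sqrt_lt' one_pos, one_pow, Real.exp_lt_one_iff, neg_div]
      exact neg_neg_of_pos (by positivity)
    have htest : IsTestFunction (unitBall 2) (rotField (logProfile p l)) :=
      isTestFunction_rotField hh (Real.sqrt_nonneg _) hR1 fun t ht => by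
        rw [Real.sq_sqrt (Real.exp_pos _).le] at ht
        exact logProfile_eq_zero_of_gt hl ht
    set G := jacobian (rotField (logProfile p l)) with hG
    have h1 := h _ G htest.memW01p htest.hasWeakGradient isGeneralisedRadial_rotField
    have hGc : Continuous G := by
      have : G = fun x => ∑ i, ∑ j, G x i j • (Matrix.single i j 1 : M 2) :=
        funext fun x => matrix_eq_sum_smul_single (G x)
      rw [this]
      refine continuous_finsetSum _ fun i _ => continuous_finsetSum _ fun j _ => ?_
      exact (continuous_jacobian htest.1 i j).smul continuous_const
    have hmem : ∀ V : M 2 → M 2, Continuous V →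
        MemLp (fun x => V (G x)) (ENNReal.ofReal p) (volume.restrict (unitBall 2)) := by
      intro V hV
      obtain ⟨C, hC⟩ := exists_bound_unitBall (continuous_norm.comp (hV.comp hGc))
      refine MemLp.of_bound (hV.comp hGc).aestronglyMeasurable C ?_
      filter_upwards [hC] with x hx
      exact (le_abs_self _).trans hx
    have h2 := integral_rpow_le_of_eLpNorm_le hp0 hK (hmem T hTc) (hmem S hSc) h1
    have eT : ∀ x, ‖T (G x)‖ ^ p = quadPow p m 1 (‖x‖ ^ 2 * deriv (logProfile p l) (‖x‖ ^ 2))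
        (logProfile p l (‖x‖ ^ 2) + ‖x‖ ^ 2 * deriv (logProfile p l) (‖x‖ ^ 2)) := by
      intro x
      rw [← sq_rpow_half (norm_nonneg _), hT _ (trace_rotField hh x),
        norm_symPart_rotField hh, norm_skewPart_rotField hh, quadPow]
      congr 1
      ring
    have eS : ∀ x, ‖S (G x)‖ ^ p = quadPow p 1 0 (‖x‖ ^ 2 * deriv (logProfile p l) (‖x‖ ^ 2))
        (logProfile p l (‖x‖ ^ 2) + ‖x‖ ^ 2 * deriv (logProfile p l) (‖x‖ ^ 2)) := by
      intro x
      rw [← sq_rpow_half (norm_nonneg _), hS _ (trace_rotField hh x),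
        norm_symPart_rotField hh, quadPow]
      congr 1
      ring
    simp only [eT, eS] at h2
    rw [integral_quadPow_logProfile hp0 hm zero_le_one hl,
      integral_quadPow_logProfile hp0 zero_le_one le_rfl hl, mul_left_comm] at h2
    exact le_of_mul_le_mul_left h2 (div_pos (ballVol_pos 2) hl)
  -- The common factor `ballVol 2 / l` has been cancelled, so the limit `l → 0` is finite on both
  -- sides.
  have h0 : profileEnergy p m 1 0 ≤ K ^ p * profileEnergy p 1 0 0 := by
    refine le_of_tendsto_of_tendsto
      (((continuous_profileEnergy hp0 m 1).tendsto 0).mono_left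
        (nhdsWithin_le_nhds (s := Ioi 0)))
      ((((continuous_profileEnergy hp0 1 0).tendsto 0).mono_left
        (nhdsWithin_le_nhds (s := Ioi 0))).const_mul (K ^ p)) ?_
    filter_upwards [self_mem_nhdsWithin] with l hl using hle l hl
  rw [profileEnergy_zero hm zero_le_one, profileEnergy_zero zero_le_one le_rfl,
    ← mul_assoc] at h0
  have h1 := le_of_mul_le_mul_right h0 (integral_bump_rpow_pos hp0)
  -- The pair `(1/p, 1 - 1/p)` is `p⁻¹ (1, p - 1)`: the extremal ratio `p - 1` appears.
  have e1 : (1 : ℝ) / p = p⁻¹ * 1 := by ring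
  have e2 : 1 - p⁻¹ * 1 = p⁻¹ * (p - 1) := by field_simp
  have hpi : 0 < p⁻¹ ^ p := Real.rpow_pos_of_pos (by positivity) _
  rw [e1, e2, quadPow_mul hm zero_le_one (by positivity), quadPow_mul zero_le_one le_rfl
    (by positivity), mul_left_comm] at h1
  have h2 := le_of_mul_le_mul_left h1 hpi
  simp only [quadPow] at h2
  rw [Real.mul_rpow (by norm_num) (by positivity), Real.mul_rpow (by norm_num) (by positivity),
    mul_left_comm] at h2
  have h3 := le_of_mul_le_mul_left h2 (Real.rpow_pos_of_pos (by norm_num) _)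
  simp only [one_pow, mul_one, one_mul, zero_mul, add_zero, Real.one_rpow] at h3
  rw [← sqrt_rpow_eq (by positivity)] at h3
  exact (Real.rpow_le_rpow_iff (Real.sqrt_nonneg _) hK hp0).1 h3

lemma continuous_linearMap {d : ℕ} (L : M d →ₗ[ℝ] M d) : Continuous L :=
  (LinearMap.toContinuousLinearMap L).continuous

/-- Upper bounds in the plane with the constants `p* - 1` and `c(p)` are optimal for `p ≥ 2`. -/
theorem isLeast_of_radialBound {p : ℝ} (hp : 2 ≤ p) {K S : M 2 → M 2} (hKc : Continuous K)
    (hSc : Continuous S)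
    (hK : ∀ A : M 2, A.trace = 0 → ‖K A‖ ^ 2 = ‖skewPart A‖ ^ 2)
    (hS : ∀ A : M 2, A.trace = 0 → ‖S A‖ ^ 2 = ‖symPart A‖ ^ 2)
    (h : RadialBound 2 p K S (pStar p - 1) ∧ RadialBound 2 p id S (cKorn p)) :
    IsLeast {c : ℝ | 0 ≤ c ∧ RadialBound 2 p K S c} (pStar p - 1) ∧
      IsLeast {c : ℝ | 0 ≤ c ∧ RadialBound 2 p id S c} (cKorn p) := by
  have hp1 : 1 < p := by linarith
  have hid : ∀ A : M 2, A.trace = 0 → ‖id A‖ ^ 2 = 1 * ‖symPart A‖ ^ 2 + ‖skewPart A‖ ^ 2 := by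
    intro A _
    rw [id, norm_symPart_sq, norm_skewPart_sq]
    ring
  refine ⟨⟨⟨by linarith [one_le_pStar_sub_one hp1], h.1⟩, fun c hc => ?_⟩,
    ⟨⟨(exists_norm_majorant hp1 rfl).1, h.2⟩, fun c hc => ?_⟩⟩
  -- The skew bound is the case `m = 0`, the full gradient the case `m = 1`.
  · have h1 := sqrt_le_of_radialBound hp1 le_rfl hc.1 hKc hSc
      (fun A hA => by rw [hK A hA, zero_mul, zero_add]) hS hc.2
    rwa [zero_add, Real.sqrt_sq (by linarith), ← pStar_sub_one_of_two_le hp] at h1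
  · have h1 := sqrt_le_of_radialBound hp1 zero_le_one hc.1 continuous_id hSc hid hS hc.2
    rwa [← pStar_sub_one_of_two_le hp, ← cKorn_of_two_le (Or.inl hp)] at h1

lemma isLeast_symPart {p : ℝ} (hp : 2 ≤ p) :
    IsLeast {c : ℝ | 0 ≤ c ∧ RadialBound 2 p skewPart symPart c} (pStar p - 1) ∧
      IsLeast {c : ℝ | 0 ≤ c ∧ RadialBound 2 p id symPart c} (cKorn p) :=
  isLeast_of_radialBound hp (continuous_linearMap (skewL 2)) (continuous_linearMap (symL 2))
    (fun _ _ => rfl) (fun _ _ => rfl) (radialBound_symPart (by linarith))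

lemma isLeast_symPart₀ {p : ℝ} (hp : 2 ≤ p) :
    IsLeast {c : ℝ | 0 ≤ c ∧ RadialBound 2 p skewPart₀ symPart₀ c} (pStar p - 1) ∧
      IsLeast {c : ℝ | 0 ≤ c ∧ RadialBound 2 p id symPart₀ c} (cKorn p) :=
  isLeast_of_radialBound hp (continuous_linearMap (skewL 2 + traceL 2))
    (continuous_linearMap (symL 2 - traceL 2))
    (fun A hA => by rw [norm_skewPart₀_sq, hA]; ring)
    (fun A hA => by rw [norm_symPart₀_sq, hA]; ring)
    (radialBound_symPart₀ (by linarith) le_rfl)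

end Sharp

end RadialKorn

end

theorem mainTheorem8 (p : ℝ) (hp : 1 < p) :
    -- upper bounds
    (∀ d : ℕ, 1 ≤ d →
      RadialKorn.RadialBound d p RadialKorn.skewPart RadialKorn.symPart (RadialKorn.pStar p - 1) ∧
      RadialKorn.RadialBound d p id RadialKorn.symPart (RadialKorn.cKorn p)) ∧
    -- upper bounds, trace-free versions
    (∀ d : ℕ, 2 ≤ d →
      RadialKorn.RadialBound d p RadialKorn.skewPart₀ RadialKorn.symPart₀
        (RadialKorn.pStar p - 1) ∧
      RadialKorn.RadialBound d p id RadialKorn.symPart₀ (RadialKorn.cKorn p)) ∧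
    -- sharpness in dimension two
    (2 ≤ p →
      IsLeast {K : ℝ | 0 ≤ K ∧
        RadialKorn.RadialBound 2 p RadialKorn.skewPart RadialKorn.symPart K}
        (RadialKorn.pStar p - 1) ∧
      IsLeast {K : ℝ | 0 ≤ K ∧ RadialKorn.RadialBound 2 p id RadialKorn.symPart K}
        (RadialKorn.cKorn p) ∧
      IsLeast {K : ℝ | 0 ≤ K ∧
        RadialKorn.RadialBound 2 p RadialKorn.skewPart₀ RadialKorn.symPart₀ K}
        (RadialKorn.pStar p - 1) ∧
      IsLeast {K : ℝ | 0 ≤ K ∧ RadialKorn.RadialBound 2 p id RadialKorn.symPart₀ K}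
        (RadialKorn.cKorn p)) := by
  refine ⟨fun d hd => ?_, fun d hd => ?_, fun hp2 => ?_⟩
  · have : NeZero d := ⟨by omega⟩
    exact RadialKorn.radialBound_symPart hp
  · have : NeZero d := ⟨by omega⟩
    exact RadialKorn.radialBound_symPart₀ hp hd
  · obtain ⟨h1, h2⟩ := RadialKorn.isLeast_symPart hp2
    obtain ⟨h3, h4⟩ := RadialKorn.isLeast_symPart₀ hp2
    exact ⟨h1, h2, h3, h4⟩
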